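/- Conventions. The spacetime $(M,g)$ is a smooth oriented four-dimensional Lorentzian manifold of signature $(-,+,+,+)$; $R^a{}_{bcd}=\partial_c\Gamma^a_{db}-\partial_d\Gamma^a_{cb}+\Gamma^a_{ce}\Gamma^e_{db}-\Gamma^a_{de}\Gamma^e_{cb}$, $R_{ab}=R^c{}_{acb}$, $W_{\alpha\beta\mu\nu}$ is the Weyl tensor, $\varepsilon_{\alpha\beta\mu\nu}$ is the Levi-Civita tensor ($\varepsilon_{0123}=\sqrt{|g|}$ in positively oriented coordinates) and $W^*{}_{\alpha\beta\mu\nu}=\tfrac12 W_{\alpha\beta\rho\sigma}\,\varepsilon^{\rho\sigma}{}_{\mu\nu}$. For an immersed spatial hypersurface $\Sigma$ with smooth unit normal $n^\mu$ ($n_\mu n^\mu=-1$), let $\gamma_{ij}$ be the induced Riemannian metric, $D$ (written $|$) its Levi-Civita derivative, $K_{ij}=-\nabla_i n_j$ the extrinsic curvature, $K=K^i{}_i$, $P^i{}_j=-K^i{}_j+K\,\delta^i{}_j$ the canonical ADM momentum, $B_{\alpha\beta}=W^*{}_{\alpha\mu\nu\beta}n^\mu n^\nu$ the magnetic part of the Weyl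 tensor, and $\varepsilon_{ijk}=n^\mu\varepsilon_{\mu ijk}$ the Levi-Civita tensor of $\Sigma$, which also orients $\Sigma$. **Theorem.** Let $\Sigma$ be a flat spatial hypersurface smoothly immersed in $(M,g)$, where $g$ satisfies the Einstein vacuum equations $R_{\mu\nu}-\tfrac12 R\,g_{\mu\nu}+\Lambda g_{\mu\nu}=0$ for some $\Lambda\in\mathbb R$ (for instance $\Lambda=0$). Suppose that $B^i{}_{j|i}=0$ on $\Sigma$. Let $k\in\{1,2,3\}$, and let $\mathcal T[k]$, $\mathcal R[k]$ be vector fields on $\Sigma$ which are the generators of translations along, and of rotations around, the axis $k$: near each point of $\Sigma$ there are positively oriented Cartesian coordinates $(x^1,x^2,x^3)$ (that is, $\gamma_{ij}=\delta_{ij}$, $\varepsilon_{123}=1$) in which $$\mathcal T[k]=\frac{\partial}{\partial x^k},\qquad \mathcal R[k]=\varepsilon_k{}^{ij}x_i\frac{\partial}{\partial x^j}.$$ Then for every oriented closed (compact, without boundary) two-dimensional surface $A$ smoothly immersed in $\Sigma$, $$\int_A B^i{}_j\,\mathcal R^j[k]\,dS_i=\int_A P^i{}_j\,\mathcal T^j[k]\,dS_i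 ,$$ where $\int_A V^i\,dS_i$ denotes the integral over $A$ of the two-form $\tfrac12\varepsilon_{ijk}V^i\,dx^j\wedge dx^k$. -/

import Mathlib

open scoped Manifold ContDiff

noncomputable section

namespace GravCharge

/-! ### Local tensor calculus in coordinates -/

/-- The coordinate space of an `n`-dimensional manifold. -/
abbrev Coord (n : ℕ) : Type := EuclideanSpace ℝ (Fin n)

/-- The `i`-th coordinate vector. -/
def basisVec {n : ℕ} (i : Fin n) : Coord n := EuclideanSpace.single i 1

/-- The partial derivative `∂f/∂x^i` at `y`. -/
def pd {n : ℕ} (i : Fin n) (f : Coord n → ℝ) (y : Coord n) : ℝ :=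
  fderiv ℝ f y (basisVec i)

/-- The Christoffel symbol
`Γ^l_{ij} = 1/2 G^{lm} (∂_i G_{mj} + ∂_j G_{mi} - ∂_m G_{ij})`. -/
def christoffel {n : ℕ} (G : Coord n → Matrix (Fin n) (Fin n) ℝ) (l i j : Fin n)
    (y : Coord n) : ℝ :=
  (1 / 2 : ℝ) * ∑ m, (G y)⁻¹ l m *
    (pd i (fun z => G z m j) y + pd j (fun z => G z m i) y - pd m (fun z => G z i j) y)

/-- The Riemann tensor
`R^a_{bcd} = ∂_c Γ^a_{db} - ∂_d Γ^a_{cb} + Γ^a_{ce} Γ^e_{db} - Γ^a_{de} Γ^e_{cb}`. -/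
def riemannUp {n : ℕ} (G : Coord n → Matrix (Fin n) (Fin n) ℝ) (a b c d : Fin n)
    (y : Coord n) : ℝ :=
  pd c (christoffel G a d b) y - pd d (christoffel G a c b) y
    + ∑ e, (christoffel G a c e y * christoffel G e d b y
      - christoffel G a d e y * christoffel G e c b y)

/-- The Riemann tensor with all indices lowered, `R_{abcd} = G_{ae} R^e_{bcd}`. -/
def riemannDown {n : ℕ} (G : Coord n → Matrix (Fin n) (Fin n) ℝ) (a b c d : Fin n)
    (y : Coord n) : ℝ :=
  ∑ e, G y a e * riemannUp G e b c d y

/-- The Ricci tensor `R_{ab} = R^c_{acb}`. -/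
def ricci {n : ℕ} (G : Coord n → Matrix (Fin n) (Fin n) ℝ) (a b : Fin n)
    (y : Coord n) : ℝ :=
  ∑ c, riemannUp G c a c b y

/-- The curvature scalar `R = G^{ab} R_{ab}`. -/
def scalarCurv {n : ℕ} (G : Coord n → Matrix (Fin n) (Fin n) ℝ) (y : Coord n) : ℝ :=
  ∑ a, ∑ b, (G y)⁻¹ a b * ricci G a b y

/-- The Weyl tensor of a four-dimensional metric, all indices lowered. -/
def weyl (G : Coord 4 → Matrix (Fin 4) (Fin 4) ℝ) (a b c d : Fin 4) (y : Coord 4) : ℝ :=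
  riemannDown G a b c d y
    - (1 / 2 : ℝ) * (G y a c * ricci G d b y - G y a d * ricci G c b y
        - G y b c * ricci G d a y + G y b d * ricci G c a y)
    + (1 / 6 : ℝ) * scalarCurv G y * (G y a c * G y d b - G y a d * G y c b)

/-- The permutation symbol `[i₁ … iₙ]`: the sign of the index sequence if it is a permutation,
and zero otherwise. -/
def permSymbol {n : ℕ} (idx : Fin n → Fin n) : ℝ :=
  Matrix.det (Matrix.of fun i j => if idx i = j then (1 : ℝ) else 0)

/-- The Levi-Civita tensor `ε_{i₁…iₙ} = √|det G| [i₁ … iₙ]` in positively oriented coordinates. -/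
def leviCivita {n : ℕ} (G : Matrix (Fin n) (Fin n) ℝ) (idx : Fin n → Fin n) : ℝ :=
  Real.sqrt |G.det| * permSymbol idx

/-- The right dual of the Weyl tensor, `W*_{abcd} = 1/2 W_{abls} ε^{ls}_{cd}`. -/
def weylDual (G : Coord 4 → Matrix (Fin 4) (Fin 4) ℝ) (a b c d : Fin 4) (y : Coord 4) : ℝ :=
  (1 / 2 : ℝ) * ∑ l, ∑ s, ∑ l', ∑ s', weyl G a b l s y *
    ((G y)⁻¹ l l' * (G y)⁻¹ s s' * leviCivita (G y) ![l', s', c, d])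

/-! ### Manifolds, metrics and orientations -/

/-- A field of bilinear forms on the tangent spaces. -/
abbrev BilinField (n : ℕ) (N : Type*) [TopologicalSpace N] [ChartedSpace (Coord n) N] : Type _ :=
  ∀ p : N, TangentSpace (𝓡 n) p →ₗ[ℝ] TangentSpace (𝓡 n) p →ₗ[ℝ] ℝ

/-- A vector field, without regularity. -/
abbrev VecField (n : ℕ) (N : Type*) [TopologicalSpace N] [ChartedSpace (Coord n) N] : Type _ :=
  ∀ p : N, TangentSpace (𝓡 n) p

section Manifold

variable {n : ℕ} {N : Type*} [TopologicalSpace N] [ChartedSpace (Coord n) N]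

/-- The coordinate vector `∂/∂x^i` of the chart `e` at the point with coordinates `y`. -/
def frame (e : OpenPartialHomeomorph N (Coord n)) (i : Fin n) (y : Coord n) :
    TangentSpace (𝓡 n) (e.symm y) :=
  mfderiv (𝓡 n) (𝓡 n) e.symm y (basisVec i)

/-- The components `v^i = dx^i(v)` of the tangent vector `v` at `p` in the chart `e`. -/
def comp (e : OpenPartialHomeomorph N (Coord n)) (p : N) (v : TangentSpace (𝓡 n) p) : Coord n :=
  mfderiv (𝓡 n) (𝓡 n) e p v

/-- The derivative `u(f)` of a function along a tangent vector. -/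
def dirDeriv (f : N → ℝ) (q : N) (u : TangentSpace (𝓡 n) q) : ℝ :=
  mfderiv (𝓡 n) 𝓘(ℝ, ℝ) f q u

/-- The components `h_{ij} = h(∂_i, ∂_j)` of a bilinear form field in the chart `e`. -/
def coordMatrix (h : ∀ p : N, TangentSpace (𝓡 n) p → TangentSpace (𝓡 n) p → ℝ)
    (e : OpenPartialHomeomorph N (Coord n)) (y : Coord n) : Matrix (Fin n) (Fin n) ℝ :=
  Matrix.of fun i j => h (e.symm y) (frame e i y) (frame e j y)

/-- The components of a metric in the chart `e`. -/
def coordMetric (g : BilinField n N) (e : OpenPartialHomeomorph N (Coord n)) (y : Coord n) :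
    Matrix (Fin n) (Fin n) ℝ :=
  coordMatrix (fun p u v => g p u v) e y

/-- Vanishing of the Riemann tensor; its components at `q` are computed in the preferred chart
at `q`. -/
def IsFlat (γ : BilinField n N) : Prop :=
  ∀ (q : N) (a b c d : Fin n),
    riemannUp (coordMetric γ (chartAt (Coord n) q)) a b c d (chartAt (Coord n) q q) = 0

/-- The components `h^i_{j|i} = γ^{ik} (∂_k h_{ij} - Γ^m_{ki} h_{mj} - Γ^m_{kj} h_{im})` at `q` of
the covariant divergence of the tensor field `h`, in the preferred chart at `q`. -/
def divergence (γ : BilinField n N)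
    (h : ∀ p : N, TangentSpace (𝓡 n) p → TangentSpace (𝓡 n) p → ℝ) (q : N) (j : Fin n) : ℝ :=
  let e := chartAt (Coord n) q
  let y := e q
  let G := coordMetric γ e
  let H := coordMatrix h e
  ∑ i, ∑ k, (G y)⁻¹ i k * (pd k (fun z => H z i j) y
    - ∑ m, (christoffel G m k i y * H y m j + christoffel G m k j y * H y i m))

/-- The matrix of `γ_q` in the standard basis of the tangent space at `q`. -/
def gram (γ : BilinField n N) (q : N) : Matrix (Fin n) (Fin n) ℝ :=
  Matrix.of fun i j => γ q (basisVec i : Coord n) (basisVec j : Coord n)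

/-- The trace `γ^{ij} h_{ij}` at `q`. -/
def trace (γ : BilinField n N)
    (h : ∀ p : N, TangentSpace (𝓡 n) p → TangentSpace (𝓡 n) p → ℝ) (q : N) : ℝ :=
  ∑ i, ∑ j, (gram γ q)⁻¹ i j * h q (basisVec i : Coord n) (basisVec j : Coord n)

/-- The vector `h^i_j X^j`, the first index of `h` being raised with `γ`. -/
def raiseContract (γ : BilinField n N)
    (h : ∀ p : N, TangentSpace (𝓡 n) p → TangentSpace (𝓡 n) p → ℝ) (X : VecField n N) (q : N) :
    TangentSpace (𝓡 n) q :=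
  ∑ i, (∑ a, (gram γ q)⁻¹ i a * h q (basisVec a : Coord n) (X q)) • (basisVec i : Coord n)

variable (n N) in
/-- The charts of the atlas are positively oriented: the Jacobians of all coordinate changes are
positive. -/
def IsOrientedAtlas : Prop :=
  ∀ e ∈ atlas (Coord n) N, ∀ e' ∈ atlas (Coord n) N, ∀ y ∈ (e.symm.trans e').source,
    0 < (fderiv ℝ (e.symm.trans e') y).det

end Manifold

/-- A smooth Lorentzian metric of signature `(-,+,+,+)`. -/
structure LorentzMetric (M : Type*) [TopologicalSpace M] [ChartedSpace (Coord 4) M] where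
  form : BilinField 4 M
  symm : ∀ p u v, form p u v = form p v u
  signature : ∀ p, ∃ b : Module.Basis (Fin 4) ℝ (TangentSpace (𝓡 4) p), ∀ i j,
    form p (b i) (b j) = if i = j then (if i = 0 then -1 else 1) else 0
  smooth : ∀ e ∈ atlas (Coord 4) M, ∀ a b,
    ContDiffOn ℝ ∞ (fun y => coordMetric form e y a b) e.target

/-- The Einstein vacuum equations `R_{ab} - 1/2 R g_{ab} + Λ g_{ab} = 0`. -/
def LorentzMetric.IsVacuum {M : Type*} [TopologicalSpace M] [ChartedSpace (Coord 4) M]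
    (g : LorentzMetric M) (Λ : ℝ) : Prop :=
  ∀ (p : M) (a b : Fin 4),
    let e := chartAt (Coord 4) p
    let y := e p
    let G := coordMetric g.form e
    ricci G a b y - (1 / 2 : ℝ) * scalarCurv G y * G y a b + Λ * G y a b = 0

/-! ### Spatial hypersurfaces -/

/-- A smoothly immersed spatial hypersurface with a smooth unit normal field. The immersion
property is part of `spatial`. -/
structure SpatialHypersurface {M : Type*} [TopologicalSpace M] [ChartedSpace (Coord 4) M]
    [IsManifold (𝓡 4) ∞ M] (g : LorentzMetric M)
    (S : Type*) [TopologicalSpace S] [ChartedSpace (Coord 3) S] where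
  map : S → M
  map_smooth : ContMDiff (𝓡 3) (𝓡 4) ∞ map
  spatial : ∀ (q : S) (u : TangentSpace (𝓡 3) q), u ≠ 0 →
    0 < g.form (map q) (mfderiv (𝓡 3) (𝓡 4) map q u) (mfderiv (𝓡 3) (𝓡 4) map q u)
  normal : ∀ q : S, TangentSpace (𝓡 4) (map q)
  normal_smooth : ContMDiff (𝓡 3) (𝓡 4).tangent ∞
    (fun q => (⟨map q, normal q⟩ : TangentBundle (𝓡 4) M))
  normal_unit : ∀ q, g.form (map q) (normal q) (normal q) = -1
  normal_orthogonal : ∀ (q : S) (u : TangentSpace (𝓡 3) q),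
    g.form (map q) (normal q) (mfderiv (𝓡 3) (𝓡 4) map q u) = 0

namespace SpatialHypersurface

variable {M : Type*} [TopologicalSpace M] [ChartedSpace (Coord 4) M] [IsManifold (𝓡 4) ∞ M]
  {g : LorentzMetric M} {S : Type*} [TopologicalSpace S] [ChartedSpace (Coord 3) S]

/-- The push-forward to spacetime of a vector tangent to the hypersurface. -/
def push (φ : SpatialHypersurface g S) (q : S) (u : TangentSpace (𝓡 3) q) :
    TangentSpace (𝓡 4) (φ.map q) :=
  mfderiv (𝓡 3) (𝓡 4) φ.map q u

/-- The induced metric `γ`. -/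
def inducedMetric (φ : SpatialHypersurface g S) : BilinField 3 S := fun q =>
  (g.form (φ.map q)).compl₁₂ (mfderiv (𝓡 3) (𝓡 4) φ.map q).toLinearMap
    (mfderiv (𝓡 3) (𝓡 4) φ.map q).toLinearMap

/-- The components in the chart `e` of the covariant derivative of the unit normal,
`(∇_u n)^μ = u(n^μ) + Γ^μ_{αβ} u^α n^β`. -/
def normalDeriv (φ : SpatialHypersurface g S) (e : OpenPartialHomeomorph M (Coord 4)) (q : S)
    (u : TangentSpace (𝓡 3) q) (μ : Fin 4) : ℝ :=
  dirDeriv (fun q' : S => comp e (φ.map q') (φ.normal q') μ) q u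
    + ∑ α, ∑ β, christoffel (coordMetric g.form e) μ α β (e (φ.map q)) *
        comp e (φ.map q) (φ.push q u) α * comp e (φ.map q) (φ.normal q) β

/-- The extrinsic curvature `K(u,v) = -g(∇_u n, v)`, computed in the preferred spacetime chart at
the point. -/
def extrinsicCurv (φ : SpatialHypersurface g S) (q : S) (u v : TangentSpace (𝓡 3) q) : ℝ :=
  let e := chartAt (Coord 4) (φ.map q)
  ∑ μ, ∑ ν, -(coordMetric g.form e (e (φ.map q)) μ ν *
      φ.normalDeriv e q u μ * comp e (φ.map q) (φ.push q v) ν)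

/-- The canonical ADM momentum `P_{ij} = -K_{ij} + K γ_{ij}`. -/
def admMomentum (φ : SpatialHypersurface g S) (q : S) (u v : TangentSpace (𝓡 3) q) : ℝ :=
  -φ.extrinsicCurv q u v + trace φ.inducedMetric φ.extrinsicCurv q * φ.inducedMetric q u v

/-- The magnetic part `B_{αβ} = W*_{αμνβ} n^μ n^ν` of the Weyl tensor on the hypersurface,
computed in the preferred spacetime chart at the point. -/
def magneticPart (φ : SpatialHypersurface g S) (q : S) (u v : TangentSpace (𝓡 3) q) : ℝ :=
  let e := chartAt (Coord 4) (φ.map q)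
  let N := comp e (φ.map q) (φ.normal q)
  ∑ α, ∑ β, ∑ μ, ∑ ν, weylDual (coordMetric g.form e) α μ ν β (e (φ.map q)) * N μ * N ν *
    comp e (φ.map q) (φ.push q u) α * comp e (φ.map q) (φ.push q v) β

/-- The Levi-Civita tensor of the hypersurface, `ε_{abc} = n^μ ε_{μabc}`, the spacetime being
oriented by its atlas. -/
def volForm (φ : SpatialHypersurface g S) (q : S) (u v w : TangentSpace (𝓡 3) q) : ℝ :=
  let e := chartAt (Coord 4) (φ.map q)
  ∑ μ, ∑ α, ∑ β, ∑ δ, leviCivita (coordMetric g.form e (e (φ.map q))) ![μ, α, β, δ] *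
    comp e (φ.map q) (φ.normal q) μ * comp e (φ.map q) (φ.push q u) α *
    comp e (φ.map q) (φ.push q v) β * comp e (φ.map q) (φ.push q w) δ

/-- Positively oriented Cartesian coordinates: `γ_{ij} = δ_{ij}` and `ε_{123} = 1`. -/
def IsCartesian (φ : SpatialHypersurface g S) (c : OpenPartialHomeomorph S (Coord 3)) : Prop :=
  c ∈ IsManifold.maximalAtlas (𝓡 3) ∞ S ∧ ∀ y ∈ c.target,
    coordMetric φ.inducedMetric c y = 1 ∧
    φ.volForm (c.symm y) (frame c 0 y) (frame c 1 y) (frame c 2 y) = 1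

/-- `T` and `R` are the generators of translations along, and of rotations around, the axis `k`:
near each point there are positively oriented Cartesian coordinates in which
`T = ∂_k` and `R = ε_k^{ij} x_i ∂_j`. -/
def AreGenerators (φ : SpatialHypersurface g S) (k : Fin 3) (T R : VecField 3 S) : Prop :=
  ∀ q : S, ∃ c : OpenPartialHomeomorph S (Coord 3), q ∈ c.source ∧ φ.IsCartesian c ∧
    ∀ y ∈ c.target,
      T (c.symm y) = frame c k y ∧
      R (c.symm y) = ∑ i, ∑ j, (permSymbol ![k, i, j] * y i) • frame c j y

end SpatialHypersurface

/-! ### Surface integrals -/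

section Surface

variable {M : Type*} [TopologicalSpace M] [ChartedSpace (Coord 4) M] [IsManifold (𝓡 4) ∞ M]
  {g : LorentzMetric M} {S : Type*} [TopologicalSpace S] [ChartedSpace (Coord 3) S]
  (A : Type*) [TopologicalSpace A] [ChartedSpace (Coord 2) A]
  [IsManifold (𝓡 2) ∞ A] [CompactSpace A] [T2Space A]

/-- A smooth partition of unity subordinate to the preferred charts. -/
def unityPartition : SmoothPartitionOfUnity A (𝓡 2) A Set.univ :=
  (SmoothPartitionOfUnity.exists_isSubordinate_chartAt_source (𝓡 2) A).choose

variable {A}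

/-- The flux `∫_A V^i dS_i`, that is, the integral over `A` of the pull-back by `ι : A → S` of the
two-form `ε(V, ·, ·)`, computed in the charts of `A` with a smooth partition of unity. The atlas of
`A` is meant to be oriented; the value then does not depend on the partition of unity. -/
def flux (φ : SpatialHypersurface g S) (ι : A → S) (V : VecField 3 S) : ℝ :=
  ∑ᶠ a : A, ∫ y in (chartAt (Coord 2) a).target,
    unityPartition A a ((chartAt (Coord 2) a).symm y) *
      φ.volForm (ι ((chartAt (Coord 2) a).symm y)) (V (ι ((chartAt (Coord 2) a).symm y)))
        (mfderiv (𝓡 2) (𝓡 3) (ι ∘ (chartAt (Coord 2) a).symm) y (basisVec 0 : Coord 2))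
        (mfderiv (𝓡 2) (𝓡 3) (ι ∘ (chartAt (Coord 2) a).symm) y (basisVec 1 : Coord 2))

end Surface

end GravCharge

end

/-! Let θ = K(·, R) be the one-form obtained by inserting the rotation field into the extrinsic
curvature. In Cartesian coordinates the magnetic part is B_ij = -ε_i^{kl} ∂_k K_lj, while ∂_m R^j is
the constant ε_{kmj} and ε_{iml} ε_{kmj} K_lj = K δ_ik - K_ik = P_ij T^j. The product rule therefore
gives B_ij R^j - P_ij T^j = -ε_i^{ml} ∂_m θ_l (`mag_sub_momentum_eq_curl`): the two flux two-forms
differ by -dθ (`volForm_magneticPart`). Cartesian charts are only local, but R and K, hence θ, are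
global, so θ pulls back to a global one-form on the closed surface and Stokes' theorem
(`finsum_setIntegral_curl_eq_zero`) makes the two fluxes equal.

The curl formula for B (`magForm_eq_curl`) has three sources. In Cartesian coordinates ∇_i ∂_j has
no tangential part, so the Codazzi equation (`codazzi`) holds with partial derivatives: ∂_k K_lj -
∂_l K_kj = -g(Riem(∂_k, ∂_l) n, ∂_j). The vacuum equations make Ricci a multiple of the metric, for
any Λ, so Weyl and Riemann differ by products of metrics, which drop out because n is orthogonal to
the slice (`magForm_eq_curvOp`). This yields B_ij as minus the transposed curl of K; the
antisymmetric part of the curl vanishes by the momentum constraint Ric(n, ∂_k) = 0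
(`sum_form_curvOp`), so the transposition is harmless.

The differential geometry is done for maps between normed spaces, with a connection as a field of
bilinear maps, and then carried to manifolds through charts. Since the extrinsic curvature is
defined in a spacetime chart that varies with the point, it must be shown chart independent
(`extrinsicCurv_frame`) before its components can be differentiated. -/

noncomputable section

namespace GravCharge

open scoped Topology

/-! ### Covariant differentiation along a map and the curvature of a connection. -/

section Calculus

variable {X E : Type*} [NormedAddCommGroup X] [NormedSpace ℝ X] [NormedAddCommGroup E]
  [NormedSpace ℝ E]

/-- The covariant derivative along `F`, in the direction `u`, of a vector field `V` along `F`. -/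
def covAlong (Γ : E → E →L[ℝ] E →L[ℝ] E) (F V : X → E) (x u : X) : E :=
  fderiv ℝ V x u + Γ (F x) (fderiv ℝ F x u) (V x)

/-- The curvature operator of the connection `Γ`. -/
def curvOp (Γ : E → E →L[ℝ] E →L[ℝ] E) (y u v w : E) : E :=
  fderiv ℝ Γ y u v w - fderiv ℝ Γ y v u w + (Γ y u (Γ y v w) - Γ y v (Γ y u w))

/-- `Γ` is a torsion-free connection compatible with the field of bilinear forms `B` at `y`. -/
structure IsLeviCivitaAt (B : E → E →L[ℝ] E →L[ℝ] ℝ) (Γ : E → E →L[ℝ] E →L[ℝ] E) (y : E) :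
    Prop where
  symm : ∀ u v, B y u v = B y v u
  torsion : ∀ u v, Γ y u v = Γ y v u
  compat : ∀ u v w, fderiv ℝ B y u v w = B y (Γ y u v) w + B y v (Γ y u w)

theorem fderiv_fderiv_apply_comm {Y : Type*} [NormedAddCommGroup Y] [NormedSpace ℝ Y]
    {f : X → Y} {x : X} (hf : ContDiffAt ℝ 2 f x) (u v : X) :
    fderiv ℝ (fun z => fderiv ℝ f z v) x u = fderiv ℝ (fun z => fderiv ℝ f z u) x v := by
  have h1 : DifferentiableAt ℝ (fderiv ℝ f) x :=
    (hf.fderiv_right (m := 1) (by norm_num)).differentiableAt (by norm_num)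
  have h2 : ∀ w, fderiv ℝ (fun z => fderiv ℝ f z w) x = (fderiv ℝ (fderiv ℝ f) x).flip w := by
    intro w
    ext t
    rw [fderiv_clm_apply h1 (differentiableAt_const w)]
    simp
  rw [h2, h2]
  have := (hf.isSymmSndFDerivAt (by simp)).eq u v
  simpa using this

theorem differentiableAt_covAlong {Γ : E → E →L[ℝ] E →L[ℝ] E} {F V : X → E} {x : X}
    (hF : ContDiffAt ℝ 2 F x) (hV : ContDiffAt ℝ 2 V x) (hΓ : DifferentiableAt ℝ Γ (F x)) (u : X) :
    DifferentiableAt ℝ (fun z => covAlong Γ F V z u) x := by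
  have h1 : DifferentiableAt ℝ (fderiv ℝ F) x :=
    (hF.fderiv_right (m := 1) (by norm_num)).differentiableAt (by norm_num)
  have h2 : DifferentiableAt ℝ (fderiv ℝ V) x :=
    (hV.fderiv_right (m := 1) (by norm_num)).differentiableAt (by norm_num)
  have h3 : DifferentiableAt ℝ F x := hF.differentiableAt (by norm_num)
  have h4 : DifferentiableAt ℝ V x := hV.differentiableAt (by norm_num)
  have h5 : DifferentiableAt ℝ (fun z => Γ (F z)) x := DifferentiableAt.comp (G := E →L[ℝ] E →L[ℝ] E) x hΓ h3
  unfold covAlong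
  exact (h2.clm_apply (differentiableAt_const u)).add
    ((h5.clm_apply (h1.clm_apply (differentiableAt_const u))).clm_apply h4)

/-- The directions `u` and `v` are constant, so no bracket term occurs; the mixed second derivatives
of `F` and `V` cancel by symmetry, and what survives is the derivative of `Γ` and its quadratic
terms. -/
theorem covAlong_comm {Γ : E → E →L[ℝ] E →L[ℝ] E} {F V : X → E} {x : X}
    (hF : ContDiffAt ℝ 2 F x) (hV : ContDiffAt ℝ 2 V x) (hΓ : DifferentiableAt ℝ Γ (F x))
    (u v : X) :
    covAlong Γ F (fun z => covAlong Γ F V z v) x u - covAlong Γ F (fun z => covAlong Γ F V z u) x v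
      = curvOp Γ (F x) (fderiv ℝ F x u) (fderiv ℝ F x v) (V x) := by
  have h1 : DifferentiableAt ℝ (fderiv ℝ F) x :=
    (hF.fderiv_right (m := 1) (by norm_num)).differentiableAt (by norm_num)
  have h2 : DifferentiableAt ℝ (fderiv ℝ V) x :=
    (hV.fderiv_right (m := 1) (by norm_num)).differentiableAt (by norm_num)
  have h3 : DifferentiableAt ℝ F x := hF.differentiableAt (by norm_num)
  have h4 : DifferentiableAt ℝ V x := hV.differentiableAt (by norm_num)
  have h5 : DifferentiableAt ℝ (fun z => Γ (F z)) x := DifferentiableAt.comp (G := E →L[ℝ] E →L[ℝ] E) x hΓ h3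
  have h6 : ∀ w, DifferentiableAt ℝ (fun z => fderiv ℝ F z w) x := fun w =>
    h1.clm_apply (differentiableAt_const w)
  have key : ∀ a b : X, fderiv ℝ (fun z => covAlong Γ F V z b) x a =
      fderiv ℝ (fun z => fderiv ℝ V z b) x a
        + (fderiv ℝ Γ (F x) (fderiv ℝ F x a) (fderiv ℝ F x b) (V x)
        + Γ (F x) (fderiv ℝ (fun z => fderiv ℝ F z b) x a) (V x)
        + Γ (F x) (fderiv ℝ F x b) (fderiv ℝ V x a)) := by
    intro a b
    have h7 : fderiv ℝ (fun z => Γ (F z)) x = (fderiv ℝ Γ (F x)).comp (fderiv ℝ F x) :=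
      fderiv_comp (G := E →L[ℝ] E →L[ℝ] E) x hΓ h3
    unfold covAlong
    rw [fderiv_fun_add (h2.clm_apply (differentiableAt_const b))
      ((h5.clm_apply (h6 b)).clm_apply h4),
      fderiv_clm_apply (h5.clm_apply (h6 b)) h4, fderiv_clm_apply h5 (h6 b), h7]
    simp
    abel
  unfold curvOp
  have hexp : ∀ a b : X, covAlong Γ F (fun z => covAlong Γ F V z b) x a =
      fderiv ℝ (fun z => covAlong Γ F V z b) x a
        + Γ (F x) (fderiv ℝ F x a) (covAlong Γ F V x b) := fun _ _ => rfl
  rw [hexp, hexp, key, key]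
  rw [fderiv_fderiv_apply_comm hF u v, fderiv_fderiv_apply_comm hV u v]
  simp only [covAlong, map_add]
  abel

/-- Metric compatibility pulled back along `F`: the Leibniz rule for the inner product of two fields
along the map. -/
theorem fderiv_form_along {B : E → E →L[ℝ] E →L[ℝ] ℝ} {Γ : E → E →L[ℝ] E →L[ℝ] E}
    {F V W : X → E} {x : X} (h : IsLeviCivitaAt B Γ (F x)) (hB : DifferentiableAt ℝ B (F x))
    (hF : DifferentiableAt ℝ F x) (hV : DifferentiableAt ℝ V x) (hW : DifferentiableAt ℝ W x)
    (u : X) :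
    fderiv ℝ (fun z => B (F z) (V z) (W z)) x u
      = B (F x) (covAlong Γ F V x u) (W x) + B (F x) (V x) (covAlong Γ F W x u) := by
  have h5 : DifferentiableAt ℝ (fun z => B (F z)) x := DifferentiableAt.comp (G := E →L[ℝ] E →L[ℝ] ℝ) x hB hF
  have h7 : fderiv ℝ (fun z => B (F z)) x = (fderiv ℝ B (F x)).comp (fderiv ℝ F x) :=
    fderiv_comp (G := E →L[ℝ] E →L[ℝ] ℝ) x hB hF
  rw [fderiv_clm_apply (h5.clm_apply hV) hW, fderiv_clm_apply h5 hV, h7]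
  simp [covAlong, h.compat]
  ring

/-- Absence of torsion, seen along a map: ∇_u ∂_v F = ∇_v ∂_u F. -/
theorem covAlong_fderiv_comm {Γ : E → E →L[ℝ] E →L[ℝ] E} {F : X → E} {x : X}
    (hΓ : ∀ u v, Γ (F x) u v = Γ (F x) v u) (hF : ContDiffAt ℝ 2 F x) (u v : X) :
    covAlong Γ F (fun z => fderiv ℝ F z v) x u = covAlong Γ F (fun z => fderiv ℝ F z u) x v := by
  unfold covAlong
  rw [fderiv_fderiv_apply_comm hF, hΓ]

/-- The second derivative of the function B(w, t), for constant `w` and `t`, is symmetric; expanding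
it twice by the Leibniz rule along the identity map, the commutator leaves exactly the two curvature
terms. Compatibility is differentiated once, hence is needed in a neighbourhood. -/
theorem curvOp_skew {B : E → E →L[ℝ] E →L[ℝ] ℝ} {Γ : E → E →L[ℝ] E →L[ℝ] E} {y : E}
    (h : ∀ᶠ z in 𝓝 y, IsLeviCivitaAt B Γ z) (hB : ContDiffAt ℝ 2 B y)
    (hΓ : DifferentiableAt ℝ Γ y) (u v w t : E) :
    B y (curvOp Γ y u v w) t + B y w (curvOp Γ y u v t) = 0 := by
  have hid : ContDiffAt ℝ 2 (id : E → E) y := contDiffAt_id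
  have hc : ∀ w : E, ContDiffAt ℝ 2 (fun _ : E => w) y := fun w => contDiffAt_const
  have hB1 : ∀ᶠ z in 𝓝 y, DifferentiableAt ℝ B z := by
    filter_upwards [hB.eventually (by simp)] with z hz using hz.differentiableAt (by norm_num)
  have hd : ∀ a w : E, DifferentiableAt ℝ (fun z => covAlong Γ id (fun _ => w) z a) y :=
    fun a w => differentiableAt_covAlong hid (hc w) hΓ a
  have h0 := h.self_of_nhds
  have hf : ContDiffAt ℝ 2 (fun z => B z w t) y := (hB.clm_apply (hc w)).clm_apply (hc t)
  have key : ∀ a b : E, fderiv ℝ (fun z => fderiv ℝ (fun z => B z w t) z b) y a =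
      B y (covAlong Γ id (fun z => covAlong Γ id (fun _ => w) z b) y a) t
      + B y (covAlong Γ id (fun _ => w) y b) (covAlong Γ id (fun _ => t) y a)
      + (B y (covAlong Γ id (fun _ => w) y a) (covAlong Γ id (fun _ => t) y b)
      + B y w (covAlong Γ id (fun z => covAlong Γ id (fun _ => t) z b) y a)) := by
    intro a b
    have e1 : (fun z => fderiv ℝ (fun z => B z w t) z b) =ᶠ[𝓝 y] fun z =>
        B z (covAlong Γ id (fun _ => w) z b) t + B z w (covAlong Γ id (fun _ => t) z b) := by
      filter_upwards [h, hB1] with z hz hBz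
      exact fderiv_form_along (F := id) (V := fun _ => w) (W := fun _ => t) hz hBz
        differentiableAt_id (differentiableAt_const _) (differentiableAt_const _) b
    have hBy := hB1.self_of_nhds
    rw [e1.fderiv_eq, fderiv_fun_add
      ((hBy.clm_apply (hd b w)).clm_apply (differentiableAt_const _))
      ((hBy.clm_apply (differentiableAt_const _)).clm_apply (hd b t)), add_apply]
    exact congrArg₂ (· + ·)
      (fderiv_form_along (F := id) (V := fun z => covAlong Γ id (fun _ => w) z b)
        (W := fun _ => t) h0 hBy differentiableAt_id (hd b w) (differentiableAt_const _) a)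
      (fderiv_form_along (F := id) (V := fun _ => w)
        (W := fun z => covAlong Γ id (fun _ => t) z b) h0 hBy differentiableAt_id
        (differentiableAt_const _) (hd b t) a)
  have hs := fderiv_fderiv_apply_comm hf u v
  rw [key, key] at hs
  have c1 := covAlong_comm hid (hc w) hΓ u v
  have c2 := covAlong_comm hid (hc t) hΓ u v
  simp only [fderiv_id, id_eq, ContinuousLinearMap.id_apply] at c1 c2
  rw [← c1, ← c2]
  simp only [map_sub, sub_apply]
  linarith

end Calculus

/-! ### Second fundamental form, change of coordinates and the Codazzi equation. -/

section Hypersurface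

variable {X E : Type*} [NormedAddCommGroup X] [NormedSpace ℝ X] [NormedAddCommGroup E]
  [NormedSpace ℝ E]

/-- The second fundamental form of the hypersurface `F` with unit normal `N`. -/
def secondForm (B : E → E →L[ℝ] E →L[ℝ] ℝ) (Γ : E → E →L[ℝ] E →L[ℝ] E) (F N : X → E) (x u v : X) :
    ℝ :=
  -B (F x) (covAlong Γ F N x u) (fderiv ℝ F x v)

/-- Determines the connection by the metric, which is what lets connections in two charts be
compared without writing out Christoffel symbols. -/
theorem IsLeviCivitaAt.koszul {B : E → E →L[ℝ] E →L[ℝ] ℝ} {Γ : E → E →L[ℝ] E →L[ℝ] E} {y : E}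
    (h : IsLeviCivitaAt B Γ y) (u v w : E) :
    2 * B y (Γ y u v) w =
      fderiv ℝ B y u v w + fderiv ℝ B y v u w - fderiv ℝ B y w u v := by
  rw [h.compat, h.compat, h.compat, h.torsion v u, h.torsion w u, h.torsion w v,
    h.symm v (Γ y u w)]
  ring

/-- The covariant derivative along a map transforms as a vector under a change of coordinates. -/
theorem form_covAlong_comp {B B' : E → E →L[ℝ] E →L[ℝ] ℝ} {Γ Γ' : E → E →L[ℝ] E →L[ℝ] E}
    {F V : X → E} {x : X} {ψ : E → E} (hψ : ContDiffAt ℝ 2 ψ (F x))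
    (hB' : DifferentiableAt ℝ B' (ψ (F x)))
    (hF : DifferentiableAt ℝ F x) (hV : DifferentiableAt ℝ V x)
    (hBB : ∀ᶠ y in 𝓝 (F x), ∀ u v, B y u v = B' (ψ y) (fderiv ℝ ψ y u) (fderiv ℝ ψ y v))
    (hB : DifferentiableAt ℝ B (F x))
    (h : IsLeviCivitaAt B Γ (F x)) (h' : IsLeviCivitaAt B' Γ' (ψ (F x))) (u : X) (w : E) :
    B' (ψ (F x)) (covAlong Γ' (fun z => ψ (F z)) (fun z => fderiv ℝ ψ (F z) (V z)) x u)
      (fderiv ℝ ψ (F x) w) = B (F x) (covAlong Γ F V x u) w := by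
  have hψ0 : DifferentiableAt ℝ ψ (F x) := hψ.differentiableAt (by norm_num)
  have hψ1 : DifferentiableAt ℝ (fderiv ℝ ψ) (F x) :=
    (hψ.fderiv_right (m := 1) (by norm_num)).differentiableAt (by norm_num)
  have hc : DifferentiableAt ℝ (fun z => fderiv ℝ ψ (F z)) x :=
    DifferentiableAt.comp (G := E →L[ℝ] E) x hψ1 hF
  have hcd : fderiv ℝ (fun z => fderiv ℝ ψ (F z)) x
      = (fderiv ℝ (fderiv ℝ ψ) (F x)).comp (fderiv ℝ F x) :=
    fderiv_comp (G := E →L[ℝ] E) x hψ1 hF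
  have hFd : fderiv ℝ (fun z => ψ (F z)) x = (fderiv ℝ ψ (F x)).comp (fderiv ℝ F x) :=
    fderiv_comp x hψ0 hF
  have hcB : DifferentiableAt ℝ (fun y => B' (ψ y)) (F x) :=
    DifferentiableAt.comp (G := E →L[ℝ] E →L[ℝ] ℝ) _ hB' hψ0
  have hcBd : fderiv ℝ (fun y => B' (ψ y)) (F x)
      = (fderiv ℝ B' (ψ (F x))).comp (fderiv ℝ ψ (F x)) :=
    fderiv_comp (G := E →L[ℝ] E →L[ℝ] ℝ) _ hB' hψ0
  set D := fderiv ℝ ψ (F x) with hD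
  set DD := fderiv ℝ (fderiv ℝ ψ) (F x) with hDD
  have hDsymm : ∀ a b, DD a b = DD b a := fun a b =>
    (hψ.isSymmSndFDerivAt (by simp)).eq a b
  have h0 := hBB.self_of_nhds
  have hder : ∀ a b c, fderiv ℝ B (F x) a b c = fderiv ℝ B' (ψ (F x)) (D a) (D b) (D c)
      + B' (ψ (F x)) (DD a b) (D c) + B' (ψ (F x)) (D b) (DD a c) := by
    intro a b c
    have e1 : fderiv ℝ (fun y => B y b c) (F x) a = fderiv ℝ B (F x) a b c := by
      rw [fderiv_clm_apply (hB.clm_apply (differentiableAt_const b)) (differentiableAt_const c),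
        fderiv_clm_apply hB (differentiableAt_const b)]
      simp
    have e2 : (fun y => B y b c) =ᶠ[𝓝 (F x)]
        fun y => B' (ψ y) (fderiv ℝ ψ y b) (fderiv ℝ ψ y c) := by
      filter_upwards [hBB] with y hy using hy b c
    have hb : ∀ b : E, DifferentiableAt ℝ (fun y => fderiv ℝ ψ y b) (F x) := fun b =>
      hψ1.clm_apply (differentiableAt_const b)
    have hbd : ∀ b a : E, fderiv ℝ (fun y => fderiv ℝ ψ y b) (F x) a = DD a b := fun b a => by
      rw [fderiv_clm_apply hψ1 (differentiableAt_const b)]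
      simp [hDD]
    rw [← e1, e2.fderiv_eq, fderiv_clm_apply (hcB.clm_apply (hb b)) (hb c),
      fderiv_clm_apply hcB (hb b), hcBd]
    simp [hbd, ← hD]
    ring
  -- The inhomogeneous transformation law of the connection: in the Koszul combination four of the
  -- six second-derivative terms cancel, leaving twice the term with `DD a b`. Testing only against
  -- vectors `D c` avoids inverting `D`.
  have key : ∀ a b c, B (F x) (Γ (F x) a b) c = B' (ψ (F x)) (Γ' (ψ (F x)) (D a) (D b)) (D c)
      + B' (ψ (F x)) (DD a b) (D c) := by
    intro a b c
    have k1 := h.koszul a b c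
    have k2 := h'.koszul (D a) (D b) (D c)
    rw [hder, hder, hder, hDsymm b a, hDsymm c a, hDsymm c b, h'.symm (DD a c) (D b)] at k1
    linarith
  have e3 : fderiv ℝ (fun z => fderiv ℝ ψ (F z) (V z)) x u
      = D (fderiv ℝ V x u) + DD (fderiv ℝ F x u) (V x) := by
    rw [fderiv_clm_apply hc hV, hcd]
    simp [hD]
  unfold covAlong
  rw [e3, hFd]
  simp only [map_add, add_apply, ContinuousLinearMap.coe_comp, Function.comp_apply, key, h0]
  ring

/-- A hypersurface, given near `x` in coordinates by `F` with unit normal `N`, whose coordinate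
vectors are orthonormal. -/
structure IsOrthonormalSlice (B : E → E →L[ℝ] E →L[ℝ] ℝ) (Γ : E → E →L[ℝ] E →L[ℝ] E)
    (F N : X → E) {ι : Type*} [DecidableEq ι] (b : ι → X) (x : X) : Prop where
  form_smooth : ContDiffAt ℝ ∞ B (F x)
  conn_smooth : ContDiffAt ℝ ∞ Γ (F x)
  map_smooth : ContDiffAt ℝ ∞ F x
  normal_smooth : ContDiffAt ℝ ∞ N x
  leviCivita : ∀ᶠ y in 𝓝 (F x), IsLeviCivitaAt B Γ y
  tangent : ∀ᶠ z in 𝓝 x, ∀ i j,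
    B (F z) (fderiv ℝ F z (b i)) (fderiv ℝ F z (b j)) = if i = j then 1 else 0
  orthogonal : ∀ᶠ z in 𝓝 x, ∀ i, B (F z) (N z) (fderiv ℝ F z (b i)) = 0
  unit : ∀ᶠ z in 𝓝 x, B (F z) (N z) (N z) = -1

namespace IsOrthonormalSlice

variable {B : E → E →L[ℝ] E →L[ℝ] ℝ} {Γ : E → E →L[ℝ] E →L[ℝ] E}
    {F N : X → E} {ι : Type*} [DecidableEq ι] {b : ι → X} {x : X}

theorem eventually (h : IsOrthonormalSlice B Γ F N b x) :
    ∀ᶠ z in 𝓝 x, DifferentiableAt ℝ B (F z) ∧ DifferentiableAt ℝ Γ (F z) ∧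
      ContDiffAt ℝ 2 F z ∧ DifferentiableAt ℝ N z ∧ IsLeviCivitaAt B Γ (F z) ∧
      (∀ u, DifferentiableAt ℝ (fun z => fderiv ℝ F z u) z) := by
  have hc : Filter.Tendsto F (𝓝 x) (𝓝 (F x)) := h.map_smooth.continuousAt
  have h2 : ContDiffAt ℝ 2 F x := h.map_smooth.of_le ENat.LEInfty.out
  have h3 : ContDiffAt ℝ 1 B (F x) := h.form_smooth.of_le ENat.LEInfty.out
  have h4 : ContDiffAt ℝ 1 Γ (F x) := h.conn_smooth.of_le ENat.LEInfty.out
  have h5 : ContDiffAt ℝ 1 N x := h.normal_smooth.of_le ENat.LEInfty.out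
  filter_upwards [hc.eventually (h3.eventually (by simp)), hc.eventually (h4.eventually (by simp)),
    h2.eventually (by simp), h5.eventually (by simp), hc.eventually h.leviCivita]
    with z z1 z2 z3 z4 z5
  refine ⟨z1.differentiableAt (by norm_num), z2.differentiableAt (by norm_num), z3,
    z4.differentiableAt (by norm_num), z5, fun u => ?_⟩
  exact ((z3.fderiv_right (m := 1) (by norm_num)).differentiableAt (by norm_num)).clm_apply
    (differentiableAt_const u)

/-- Differentiating g(N, ∂_j F) = 0 turns K_ij into g(N, ∇_i ∂_j F), which is symmetric as there is
no torsion. -/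
theorem secondForm_symm (h : IsOrthonormalSlice B Γ F N b x) (i j : ι) :
    secondForm B Γ F N x (b i) (b j) = secondForm B Γ F N x (b j) (b i) := by
  obtain ⟨h1, h2, h3, h4, h5, h6⟩ := h.eventually.self_of_nhds
  have key : ∀ i j, secondForm B Γ F N x (b i) (b j)
      = B (F x) (N x) (covAlong Γ F (fun z => fderiv ℝ F z (b j)) x (b i)) := by
    intro i j
    have e1 : (fun z => B (F z) (N z) (fderiv ℝ F z (b j))) =ᶠ[𝓝 x] fun _ => 0 := by
      filter_upwards [h.orthogonal] with z hz using hz j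
    have e2 := fderiv_form_along h5 h1 (h3.differentiableAt (by norm_num)) h4 (h6 (b j)) (b i)
    rw [e1.fderiv_eq] at e2
    simp at e2
    unfold secondForm
    linarith
  rw [key, key, covAlong_fderiv_comm h5.torsion h3]

/-- The norm of `N` is constant, so its derivative is tangent to the slice. -/
theorem form_covAlong_normal (h : IsOrthonormalSlice B Γ F N b x) (u : X) :
    B (F x) (covAlong Γ F N x u) (N x) = 0 := by
  obtain ⟨h1, h2, h3, h4, h5, h6⟩ := h.eventually.self_of_nhds
  have e1 : (fun z => B (F z) (N z) (N z)) =ᶠ[𝓝 x] fun _ => -1 := by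
    filter_upwards [h.unit] with z hz using hz
  have e2 := fderiv_form_along h5 h1 (h3.differentiableAt (by norm_num)) h4 h4 u
  rw [e1.fderiv_eq, h5.symm (N x)] at e2
  simp at e2
  linarith

/-- The induced Christoffel symbols vanish in Cartesian coordinates: the expression is symmetric in
`i`, `j` (no torsion) and antisymmetric in `j`, `m` (the induced metric is constant), hence zero. -/
theorem form_covAlong_tangent (h : IsOrthonormalSlice B Γ F N b x) (i j m : ι) :
    B (F x) (covAlong Γ F (fun z => fderiv ℝ F z (b j)) x (b i)) (fderiv ℝ F x (b m)) = 0 := by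
  obtain ⟨h1, h2, h3, h4, h5, h6⟩ := h.eventually.self_of_nhds
  have e : ∀ i j m,
      B (F x) (covAlong Γ F (fun z => fderiv ℝ F z (b j)) x (b i)) (fderiv ℝ F x (b m))
      + B (F x) (covAlong Γ F (fun z => fderiv ℝ F z (b m)) x (b i)) (fderiv ℝ F x (b j)) = 0 := by
    intro i j m
    have e1 : (fun z => B (F z) (fderiv ℝ F z (b j)) (fderiv ℝ F z (b m)))
        =ᶠ[𝓝 x] fun _ => if j = m then 1 else 0 := by
      filter_upwards [h.tangent] with z hz using hz j m
    have e2 := fderiv_form_along h5 h1 (h3.differentiableAt (by norm_num)) (h6 (b j)) (h6 (b m))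
      (b i)
    rw [e1.fderiv_eq, h5.symm (fderiv ℝ F x (b j))] at e2
    simp at e2
    linarith
  have s : ∀ i j, covAlong Γ F (fun z => fderiv ℝ F z (b j)) x (b i)
      = covAlong Γ F (fun z => fderiv ℝ F z (b i)) x (b j) := fun i j =>
    covAlong_fderiv_comm h5.torsion h3 _ _
  have a1 := e i j m
  have a2 := e j m i
  have a3 := e m i j
  rw [s j m] at a2
  rw [s m i] at a3
  rw [s j i] at a2
  linarith

/-- In ∂_i g(∇_l N, ∂_j F) the term g(∇_l N, ∇_i ∂_j F) drops out, since ∇_l N is tangent and ∇_i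
∂_j F is normal; antisymmetrising the remaining second covariant derivative gives the curvature.
`hcomplete` is the orthonormal expansion in which this orthogonality can be read off. -/
theorem codazzi [Fintype ι] (h : IsOrthonormalSlice B Γ F N b x)
    (hcomplete : ∀ z w, B (F x) z w = -(B (F x) z (N x) * B (F x) w (N x))
      + ∑ m, B (F x) z (fderiv ℝ F x (b m)) * B (F x) w (fderiv ℝ F x (b m))) (i l j : ι) :
    fderiv ℝ (fun z => secondForm B Γ F N z (b l) (b j)) x (b i)
      - fderiv ℝ (fun z => secondForm B Γ F N z (b i) (b j)) x (b l)
      = -B (F x) (curvOp Γ (F x) (fderiv ℝ F x (b i)) (fderiv ℝ F x (b l)) (N x))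
          (fderiv ℝ F x (b j)) := by
  obtain ⟨h1, h2, h3, h4, h5, h6⟩ := h.eventually.self_of_nhds
  have hN : ContDiffAt ℝ 2 N x := h.normal_smooth.of_le ENat.LEInfty.out
  have key : ∀ i l, fderiv ℝ (fun z => secondForm B Γ F N z (b l) (b j)) x (b i) =
      -B (F x) (covAlong Γ F (fun z => covAlong Γ F N z (b l)) x (b i)) (fderiv ℝ F x (b j)) := by
    intro i l
    have hd := differentiableAt_covAlong h3 hN h2 (b l)
    unfold secondForm
    rw [fderiv_fun_neg, neg_apply, fderiv_form_along h5 h1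
      (h3.differentiableAt (by norm_num)) hd (h6 (b j)) (b i),
      hcomplete (covAlong Γ F N x (b l)), h.form_covAlong_normal]
    simp [h.form_covAlong_tangent]
  rw [key, key, ← covAlong_comm h3 hN h2]
  simp
  ring

end IsOrthonormalSlice

end Hypersurface

set_option maxSynthPendingDepth 3

/-! ### The Levi-Civita connection and the Riemann tensor of a metric given by a matrix. -/

section MatrixMetric

variable {n : ℕ}

@[simp]
theorem basisVec_apply (i j : Fin n) : (basisVec i : Coord n) j = if j = i then 1 else 0 := by
  simp [basisVec]

theorem sum_apply_smul_basisVec (u : Coord n) : ∑ i, u i • basisVec i = u := by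
  ext j
  simp

/-- The bilinear form with matrix `A`. -/
def matForm (A : Matrix (Fin n) (Fin n) ℝ) : Coord n →L[ℝ] Coord n →L[ℝ] ℝ :=
  ∑ i, ∑ j, A i j • (EuclideanSpace.proj i : Coord n →L[ℝ] ℝ).smulRight
    (EuclideanSpace.proj j : Coord n →L[ℝ] ℝ)

theorem matForm_apply (A : Matrix (Fin n) (Fin n) ℝ) (u v : Coord n) :
    matForm A u v = ∑ i, ∑ j, A i j * u i * v j := by
  simp [matForm, mul_assoc]

/-- The connection with the Christoffel symbols of `G`. -/
def connOf (G : Coord n → Matrix (Fin n) (Fin n) ℝ) (y : Coord n) :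
    Coord n →L[ℝ] Coord n →L[ℝ] Coord n :=
  ∑ l, ∑ i, ∑ j, christoffel G l i j y • (EuclideanSpace.proj i : Coord n →L[ℝ] ℝ).smulRight
    ((EuclideanSpace.proj j : Coord n →L[ℝ] ℝ).smulRight (basisVec l : Coord n))

theorem connOf_apply (G : Coord n → Matrix (Fin n) (Fin n) ℝ) (y u v : Coord n) (l : Fin n) :
    connOf G y u v l = ∑ i, ∑ j, christoffel G l i j y * u i * v j := by
  simp [connOf, Finset.sum_apply, mul_assoc]

@[simp]
theorem connOf_basisVec (G : Coord n → Matrix (Fin n) (Fin n) ℝ) (y : Coord n) (l i j : Fin n) :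
    connOf G y (basisVec i) (basisVec j) l = christoffel G l i j y := by
  simp [connOf_apply]

theorem contDiffAt_det {X : Type*} [NormedAddCommGroup X] [NormedSpace ℝ X] {m : WithTop ℕ∞}
    {A : X → Matrix (Fin n) (Fin n) ℝ} {x : X}
    (hA : ∀ i j, ContDiffAt ℝ m (fun z => A z i j) x) : ContDiffAt ℝ m (fun z => (A z).det) x := by
  simp only [Matrix.det_apply]
  exact ContDiffAt.sum fun σ _ => (contDiffAt_prod fun i _ => hA _ _).const_smul _

/-- Cramer's rule: each entry is a determinant with one row replaced by a constant vector, divided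
by the determinant. -/
theorem contDiffAt_inv_entry {X : Type*} [NormedAddCommGroup X] [NormedSpace ℝ X]
    {m : WithTop ℕ∞} {A : X → Matrix (Fin n) (Fin n) ℝ} {x : X}
    (hA : ∀ i j, ContDiffAt ℝ m (fun z => A z i j) x) (hdet : (A x).det ≠ 0) (i j : Fin n) :
    ContDiffAt ℝ m (fun z => (A z)⁻¹ i j) x := by
  simp only [Matrix.inv_def, Ring.inverse_eq_inv', Matrix.smul_apply, smul_eq_mul,
    Matrix.adjugate_apply]
  refine ((contDiffAt_det hA).inv hdet).mul (contDiffAt_det fun a b => ?_)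
  by_cases h : a = j
  · subst h
    simpa using contDiffAt_const
  · simpa [Matrix.updateRow_ne h] using hA a b

/-- `G` is, near `y`, a smooth field of symmetric nondegenerate matrices. -/
def IsMetricNear (G : Coord n → Matrix (Fin n) (Fin n) ℝ) (y : Coord n) : Prop :=
  ∀ᶠ z in 𝓝 y, (∀ i j, ContDiffAt ℝ ∞ (fun z => G z i j) z) ∧ (∀ i j, G z i j = G z j i) ∧
    (G z).det ≠ 0

variable {G : Coord n → Matrix (Fin n) (Fin n) ℝ} {y : Coord n}

theorem IsMetricNear.eventually (h : IsMetricNear G y) : ∀ᶠ z in 𝓝 y, IsMetricNear G z :=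
  eventually_eventually_nhds.2 h

theorem IsMetricNear.smooth (h : IsMetricNear G y) (i j : Fin n) :
    ContDiffAt ℝ ∞ (fun z => G z i j) y :=
  h.self_of_nhds.1 i j

theorem IsMetricNear.nondeg (h : IsMetricNear G y) : (G y).det ≠ 0 :=
  h.self_of_nhds.2.2

theorem IsMetricNear.contDiffAt_matForm (h : IsMetricNear G y) :
    ContDiffAt ℝ ∞ (fun z => matForm (G z)) y := by
  unfold matForm
  exact ContDiffAt.sum fun i _ => ContDiffAt.sum fun j _ => (h.smooth i j).smul contDiffAt_const

theorem IsMetricNear.contDiffAt_pd (h : IsMetricNear G y) (k i j : Fin n) :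
    ContDiffAt ℝ ∞ (pd k (fun z => G z i j)) y := by
  unfold pd
  exact ((h.smooth i j).fderiv_right (m := ∞) (by simp)).clm_apply contDiffAt_const

theorem IsMetricNear.contDiffAt_christoffel (h : IsMetricNear G y) (l i j : Fin n) :
    ContDiffAt ℝ ∞ (christoffel G l i j) y := by
  unfold christoffel
  refine contDiffAt_const.mul (ContDiffAt.sum fun m _ => ?_)
  exact (contDiffAt_inv_entry h.smooth h.nondeg l m).mul
    (((h.contDiffAt_pd i m j).add (h.contDiffAt_pd j m i)).sub (h.contDiffAt_pd m i j))

theorem IsMetricNear.contDiffAt_connOf (h : IsMetricNear G y) : ContDiffAt ℝ ∞ (connOf G) y := by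
  unfold connOf
  exact ContDiffAt.sum fun l _ => ContDiffAt.sum fun i _ => ContDiffAt.sum fun j _ =>
    (h.contDiffAt_christoffel l i j).smul contDiffAt_const

theorem fderiv_matForm (h : IsMetricNear G y) (u v w : Coord n) :
    fderiv ℝ (fun z => matForm (G z)) y u v w
      = ∑ k, ∑ i, ∑ j, pd k (fun z => G z i j) y * u k * v i * w j := by
  have hd : ∀ i j, DifferentiableAt ℝ (fun z => G z i j) y := fun i j =>
    (h.smooth i j).differentiableAt (by simp)
  have hB : DifferentiableAt ℝ (fun z => matForm (G z)) y :=
    h.contDiffAt_matForm.differentiableAt (by simp)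
  have e1 : fderiv ℝ (fun z => matForm (G z) v w) y u
      = fderiv ℝ (fun z => matForm (G z)) y u v w := by
    rw [fderiv_clm_apply (hB.clm_apply (differentiableAt_const _)) (differentiableAt_const _),
      fderiv_clm_apply hB (differentiableAt_const _)]
    simp
  rw [← e1]
  simp only [matForm_apply]
  rw [fderiv_fun_sum fun i _ => DifferentiableAt.fun_sum fun j _ =>
    ((hd i j).mul_const _).mul_const _]
  have e2 : ∀ i, fderiv ℝ (fun z => ∑ j, G z i j * v i * w j) y
      = ∑ j, (v i * w j) • fderiv ℝ (fun z => G z i j) y := by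
    intro i
    rw [fderiv_fun_sum fun j _ => ((hd i j).mul_const _).mul_const _]
    refine Finset.sum_congr rfl fun j _ => ?_
    simp only [mul_assoc]
    rw [fderiv_mul_const (hd i j)]
  have e3 : ∀ i j, fderiv ℝ (fun z => G z i j) y u = ∑ k, pd k (fun z => G z i j) y * u k := by
    intro i j
    conv_lhs => rw [← sum_apply_smul_basisVec u]
    simp [pd, mul_comm]
  simp only [e2, sum_apply, FunLike.coe_smul, Pi.smul_apply, smul_eq_mul, e3,
    Finset.mul_sum]
  symm
  rw [Finset.sum_comm]
  refine Finset.sum_congr rfl fun i _ => ?_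
  rw [Finset.sum_comm]
  refine Finset.sum_congr rfl fun i _ => Finset.sum_congr rfl fun i _ => by ring

theorem fderiv_matForm_basisVec (h : IsMetricNear G y) (k i j : Fin n) :
    fderiv ℝ (fun z => matForm (G z)) y (basisVec k) (basisVec i) (basisVec j)
      = pd k (fun z => G z i j) y := by
  simp [fderiv_matForm h]

/-- Lowering the upper index removes the inverse matrix, so that later identities are linear in the
first derivatives of `G`. -/
theorem sum_mul_christoffel (h : IsMetricNear G y) (i j m : Fin n) :
    ∑ l, G y l m * christoffel G l i j y = (1 / 2 : ℝ) *
      (pd i (fun z => G z m j) y + pd j (fun z => G z m i) y - pd m (fun z => G z i j) y) := by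
  have hs := h.self_of_nhds.2.1
  have h1 : G y * (G y)⁻¹ = 1 := Matrix.mul_nonsing_inv _ (isUnit_iff_ne_zero.2 h.nondeg)
  unfold christoffel
  set f : Fin n → ℝ := fun m =>
    pd i (fun z => G z m j) y + pd j (fun z => G z m i) y - pd m (fun z => G z i j) y with hf
  have h2 : ∑ l, G y l m * (1 / 2 * ∑ p, (G y)⁻¹ l p * f p)
      = 1 / 2 * ∑ p, (G y * (G y)⁻¹) m p * f p := by
    simp only [Matrix.mul_apply, Finset.mul_sum, Finset.sum_mul]
    rw [Finset.sum_comm]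
    refine Finset.sum_congr rfl fun p _ => Finset.sum_congr rfl fun l _ => ?_
    rw [hs l m]
    ring
  rw [h2, h1]
  simp [Matrix.one_apply, hf]

theorem clm3_ext {Y : Type*} [NormedAddCommGroup Y] [NormedSpace ℝ Y]
    {A A' : Coord n →L[ℝ] Coord n →L[ℝ] Coord n →L[ℝ] Y}
    (h : ∀ i j k, A (basisVec i) (basisVec j) (basisVec k)
      = A' (basisVec i) (basisVec j) (basisVec k)) : A = A' := by
  ext u v w
  rw [← sum_apply_smul_basisVec u, ← sum_apply_smul_basisVec v, ← sum_apply_smul_basisVec w]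
  simp [h]

theorem form_connOf_basisVec (h : IsMetricNear G y) (i j m : Fin n) :
    matForm (G y) (connOf G y (basisVec i) (basisVec j)) (basisVec m) = (1 / 2 : ℝ) *
      (pd i (fun z => G z m j) y + pd j (fun z => G z m i) y - pd m (fun z => G z i j) y) := by
  rw [← sum_mul_christoffel h, matForm_apply]
  simp

theorem IsMetricNear.pd_symm (h : IsMetricNear G y) (k i j : Fin n) :
    pd k (fun z => G z i j) y = pd k (fun z => G z j i) y := by
  have : (fun z => G z i j) =ᶠ[𝓝 y] fun z => G z j i := by
    filter_upwards [h] with z hz using hz.2.1 i j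
  unfold pd
  rw [this.fderiv_eq]

theorem IsMetricNear.form_symm (h : IsMetricNear G y) (u v : Coord n) :
    matForm (G y) u v = matForm (G y) v u := by
  rw [matForm_apply, matForm_apply, Finset.sum_comm]
  refine Finset.sum_congr rfl fun i _ => Finset.sum_congr rfl fun j _ => ?_
  rw [h.self_of_nhds.2.1 i j]
  ring

theorem isLeviCivitaAt_connOf (h : IsMetricNear G y) :
    IsLeviCivitaAt (fun z => matForm (G z)) (connOf G) y where
  symm := h.form_symm
  torsion u v := by
    have hc : ∀ l i j, christoffel G l i j y = christoffel G l j i y := by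
      intro l i j
      unfold christoffel
      congr 1
      refine Finset.sum_congr rfl fun m _ => ?_
      rw [h.pd_symm m i j]
      ring
    ext l
    rw [connOf_apply, connOf_apply, Finset.sum_comm]
    refine Finset.sum_congr rfl fun i _ => Finset.sum_congr rfl fun j _ => ?_
    rw [hc l j i]
    ring
  compat u v w := by
    -- Both sides are trilinear, so comparison on basis vectors suffices. `P` sends (u, v, w) to
    -- g(Γ(u, v), w), and `Q` is `P` with the last two arguments exchanged.
    let P : Coord n →L[ℝ] Coord n →L[ℝ] Coord n →L[ℝ] ℝ :=
      (ContinuousLinearMap.compL ℝ (Coord n) (Coord n) (Coord n →L[ℝ] ℝ) (matForm (G y))).comp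
        (connOf G y)
    let Q : Coord n →L[ℝ] Coord n →L[ℝ] Coord n →L[ℝ] ℝ :=
      (ContinuousLinearMap.flipₗᵢ ℝ (Coord n) (Coord n) ℝ :
        (Coord n →L[ℝ] Coord n →L[ℝ] ℝ) →L[ℝ] Coord n →L[ℝ] Coord n →L[ℝ] ℝ).comp P
    have hPQ : fderiv ℝ (fun z => matForm (G z)) y = P + Q := by
      apply clm3_ext
      intro k i j
      rw [fderiv_matForm_basisVec h]
      have e1 : P (basisVec k) (basisVec i) (basisVec j)
        = matForm (G y) (connOf G y (basisVec k) (basisVec i)) (basisVec j) := rfl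
      have e2 : Q (basisVec k) (basisVec i) (basisVec j)
        = matForm (G y) (connOf G y (basisVec k) (basisVec j)) (basisVec i) := rfl
      rw [add_apply, add_apply, add_apply, e1, e2, form_connOf_basisVec h,
        form_connOf_basisVec h, h.pd_symm k j i, h.pd_symm j i k, h.pd_symm i k j]
      ring
    rw [hPQ]
    have e1 : (P + Q) u v w = matForm (G y) (connOf G y u v) w + matForm (G y) (connOf G y u w) v :=
      rfl
    rw [e1, h.form_symm v]

theorem pd_christoffel (h : IsMetricNear G y) (k l i j : Fin n) :
    fderiv ℝ (connOf G) y (basisVec k) (basisVec i) (basisVec j) l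
      = pd k (christoffel G l i j) y := by
  have hΓ : DifferentiableAt ℝ (connOf G) y := h.contDiffAt_connOf.differentiableAt (by simp)
  have e1 : (christoffel G l i j) = fun z =>
      (EuclideanSpace.proj l : Coord n →L[ℝ] ℝ) (connOf G z (basisVec i) (basisVec j)) := by
    ext z
    simp
  have e2 : HasFDerivAt (fun z => connOf G z (basisVec i) (basisVec j)) _ y :=
    ((hΓ.clm_apply (differentiableAt_const _)).clm_apply (differentiableAt_const _)).hasFDerivAt
  have e3 := ((EuclideanSpace.proj l : Coord n →L[ℝ] ℝ).hasFDerivAt.comp y e2).fderiv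
  unfold pd
  rw [e1]
  erw [e3]
  rw [fderiv_clm_apply (hΓ.clm_apply (differentiableAt_const _)) (differentiableAt_const _),
    fderiv_clm_apply hΓ (differentiableAt_const _)]
  simp

/-- Fixes the order of slots: the last two indices of the Riemann tensor are the directions of
differentiation, and its second index is the vector acted upon. -/
theorem curvOp_basisVec (h : IsMetricNear G y) (a b c d : Fin n) :
    curvOp (connOf G) y (basisVec c) (basisVec d) (basisVec b) a = riemannUp G a b c d y := by
  simp only [curvOp, riemannUp, PiLp.add_apply, PiLp.sub_apply, pd_christoffel h]
  congr 1
  rw [connOf_apply, connOf_apply, Finset.sum_sub_distrib]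
  simp

theorem isLinearMap_expand {Y : Type*} [AddCommGroup Y] [Module ℝ Y] {f : Coord n → Y}
    (hf : IsLinearMap ℝ f) (u : Coord n) : f u = ∑ i, u i • f (basisVec i) := by
  conv_lhs => rw [← sum_apply_smul_basisVec u]
  change hf.mk' f _ = _
  simp

theorem curvOp_apply (h : IsMetricNear G y) (u v w : Coord n) (a : Fin n) :
    curvOp (connOf G) y u v w a = ∑ b, ∑ c, ∑ d, riemannUp G a b c d y * w b * u c * v d := by
  have h1 : ∀ u v, IsLinearMap ℝ fun w => curvOp (connOf G) y u v w := fun u v =>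
    ⟨fun _ _ => by simp [curvOp]; abel, fun _ _ => by simp [curvOp, smul_sub, smul_add]⟩
  have h2 : ∀ v w, IsLinearMap ℝ fun u => curvOp (connOf G) y u v w := fun u v =>
    ⟨fun _ _ => by simp [curvOp]; abel, fun _ _ => by simp [curvOp, smul_sub, smul_add]⟩
  have h3 : ∀ u w, IsLinearMap ℝ fun v => curvOp (connOf G) y u v w := fun u v =>
    ⟨fun _ _ => by simp [curvOp]; abel, fun _ _ => by simp [curvOp, smul_sub, smul_add]⟩
  rw [isLinearMap_expand (h1 u v) w]
  simp only [WithLp.ofLp_sum, Finset.sum_apply, PiLp.smul_apply, smul_eq_mul]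
  refine Finset.sum_congr rfl fun b _ => ?_
  rw [isLinearMap_expand (h2 v _) u]
  simp only [WithLp.ofLp_sum, Finset.sum_apply, PiLp.smul_apply, smul_eq_mul, Finset.mul_sum]
  refine Finset.sum_congr rfl fun c _ => ?_
  rw [isLinearMap_expand (h3 _ _) v]
  simp only [WithLp.ofLp_sum, Finset.sum_apply, PiLp.smul_apply, smul_eq_mul, Finset.mul_sum,
    curvOp_basisVec h]
  exact Finset.sum_congr rfl fun d _ => by ring

theorem form_curvOp (h : IsMetricNear G y) (p u v w : Coord n) :
    matForm (G y) p (curvOp (connOf G) y u v w)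
      = ∑ a, ∑ b, ∑ c, ∑ d, riemannDown G a b c d y * p a * w b * u c * v d := by
  rw [matForm_apply]
  refine Finset.sum_congr rfl fun a _ => ?_
  simp only [curvOp_apply h, riemannDown, Finset.mul_sum, Finset.sum_mul]
  rw [Finset.sum_comm]
  refine Finset.sum_congr rfl fun b _ => ?_
  rw [Finset.sum_comm]
  refine Finset.sum_congr rfl fun c _ => ?_
  rw [Finset.sum_comm]
  exact Finset.sum_congr rfl fun d _ => Finset.sum_congr rfl fun e _ => by ring

end MatrixMetric

/-! ### Contractions in a Lorentz orthonormal frame; Levi-Civita and Weyl tensors on vectors. -/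

section LorentzFrame

/-- The signature `(-,+,+,+)`. -/
def lorentzSign (a : Fin 4) : ℝ := if a = 0 then -1 else 1

theorem lorentzSign_mul_self (a : Fin 4) : lorentzSign a * lorentzSign a = 1 := by
  unfold lorentzSign
  split_ifs <;> norm_num

/-- `e` is an orthonormal frame for the symmetric matrix `A`. -/
def IsLorentzFrame (A : Matrix (Fin 4) (Fin 4) ℝ) (e : Fin 4 → Coord 4) : Prop :=
  ∀ a b, matForm A (e a) (e b) = if a = b then lorentzSign a else 0

variable {A : Matrix (Fin 4) (Fin 4) ℝ} {e : Fin 4 → Coord 4}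

/-- With the frame as columns of `P`, orthonormality reads PᵀAP = H with H² = 1. So HPᵀA is a left
inverse of the square matrix `P`, hence a right inverse, and PHPᵀ inverts `A`. -/
theorem IsLorentzFrame.inv_mul (h : IsLorentzFrame A e) :
    (Matrix.of fun l l' => ∑ a, lorentzSign a * e a l * e a l') * A = 1 := by
  set P : Matrix (Fin 4) (Fin 4) ℝ := Matrix.of fun l a => e a l with hP
  set H : Matrix (Fin 4) (Fin 4) ℝ := Matrix.diagonal lorentzSign with hH
  have h1 : P.transpose * A * P = H := by
    ext a b
    rw [hH, Matrix.diagonal_apply, ← h a b, matForm_apply]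
    simp only [Matrix.mul_apply, Finset.sum_mul, Matrix.transpose_apply, hP, Matrix.of_apply]
    rw [Finset.sum_comm]
    exact Finset.sum_congr rfl fun i _ => Finset.sum_congr rfl fun j _ => by ring
  have h2 : H * H = 1 := by
    rw [hH, Matrix.diagonal_mul_diagonal]
    simp [lorentzSign_mul_self]
  have h3 : (H * P.transpose * A) * P = 1 := by
    rw [← h2, ← h1]
    simp only [Matrix.mul_assoc]
  have h4 := mul_eq_one_comm.1 h3
  have h5 : (Matrix.of fun l l' => ∑ a, lorentzSign a * e a l * e a l') = P * H * P.transpose := by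
    ext l l'
    rw [hH, Matrix.mul_apply]
    simp only [Matrix.mul_diagonal, hP, Matrix.of_apply, Matrix.transpose_apply]
    exact Finset.sum_congr rfl fun i _ => by ring
  rw [h5, ← h4]
  simp only [Matrix.mul_assoc]

theorem IsLorentzFrame.inv_eq (h : IsLorentzFrame A e) (l l' : Fin 4) :
    A⁻¹ l l' = ∑ a, lorentzSign a * e a l * e a l' := by
  rw [Matrix.inv_eq_left_inv h.inv_mul]
  rfl

theorem IsLorentzFrame.expand (h : IsLorentzFrame A e) (hA : ∀ i j, A i j = A j i) (z : Coord 4) :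
    z = ∑ a, (lorentzSign a * matForm A z (e a)) • e a := by
  have h1 : ∀ i j, ∑ l, (∑ a, lorentzSign a * e a i * e a l) * A l j = if i = j then 1 else 0 := by
    intro i j
    have := congrFun (congrFun h.inv_mul i) j
    simpa [Matrix.mul_apply, Matrix.one_apply] using this
  ext i
  have h2 : z i = ∑ j, (∑ l, (∑ a, lorentzSign a * e a i * e a l) * A l j) * z j := by
    simp [h1]
  rw [h2]
  simp only [matForm_apply, WithLp.ofLp_sum, Finset.sum_apply, PiLp.smul_apply, smul_eq_mul,
    Finset.mul_sum, Finset.sum_mul]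
  conv_rhs => rw [Finset.sum_comm]
  refine Finset.sum_congr rfl fun j _ => ?_
  rw [Finset.sum_comm]
  refine Finset.sum_congr rfl fun a _ => Finset.sum_congr rfl fun l _ => ?_
  rw [hA l j]
  ring

theorem IsLorentzFrame.form_eq (h : IsLorentzFrame A e) (hA : ∀ i j, A i j = A j i)
    (z w : Coord 4) :
    matForm A z w = ∑ a, lorentzSign a * matForm A z (e a) * matForm A w (e a) := by
  have hs : ∀ u v, matForm A u v = matForm A v u := by
    intro u v
    rw [matForm_apply, matForm_apply, Finset.sum_comm]
    refine Finset.sum_congr rfl fun i _ => Finset.sum_congr rfl fun j _ => ?_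
    rw [hA i j]
    ring
  conv_lhs => rw [h.expand hA z]
  simp [hs w]

/-- A trace does not depend on the basis; this form turns the coordinate trace that defines Ricci
into a frame sum. -/
theorem IsLorentzFrame.trace_eq (h : IsLorentzFrame A e) (hA : ∀ i j, A i j = A j i)
    {T : Coord 4 → Coord 4} (hT : IsLinearMap ℝ T) :
    ∑ c, T (basisVec c) c = ∑ a, lorentzSign a * matForm A (e a) (T (e a)) := by
  have h1 : ∀ c, T (basisVec c) c
      = ∑ a, lorentzSign a * matForm A (basisVec c) (e a) * T (e a) c := by
    intro c
    conv_lhs => rw [h.expand hA (basisVec c)]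
    change (hT.mk' T _).ofLp c = _
    simp only [map_sum, map_smul, WithLp.ofLp_sum, Finset.sum_apply, PiLp.smul_apply, smul_eq_mul]
    rfl
  simp only [h1]
  rw [Finset.sum_comm]
  refine Finset.sum_congr rfl fun a _ => ?_
  have hs : matForm A (e a) (T (e a)) = matForm A (T (e a)) (e a) := by
    rw [matForm_apply, matForm_apply, Finset.sum_comm]
    refine Finset.sum_congr rfl fun i _ => Finset.sum_congr rfl fun j _ => ?_
    rw [hA i j]
    ring
  rw [hs, isLinearMap_expand (f := fun u => matForm A u (e a)) ⟨fun _ _ => by simp, fun _ _ => by simp⟩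
    (T (e a)), Finset.mul_sum]
  exact Finset.sum_congr rfl fun c _ => by simp only [smul_eq_mul]; ring

/-- Contraction of two matrices with the inverse of the metric in an orthonormal frame. -/
theorem IsLorentzFrame.contract (h : IsLorentzFrame A e) (W E : Fin 4 → Fin 4 → ℝ) :
    ∑ l, ∑ s, ∑ l', ∑ s', W l s * (A⁻¹ l l' * A⁻¹ s s' * E l' s')
      = ∑ a, ∑ b, lorentzSign a * lorentzSign b * (∑ l, ∑ s, W l s * e a l * e b s) *
        (∑ l', ∑ s', E l' s' * e a l' * e b s') := by
  have key : ∀ (f g : Fin 4 → ℝ), ∑ l, ∑ l', A⁻¹ l l' * (f l * g l')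
      = ∑ a, lorentzSign a * ((∑ l, f l * e a l) * (∑ l', g l' * e a l')) := by
    intro f g
    simp only [h.inv_eq, Finset.sum_mul, Finset.mul_sum]
    conv_rhs => rw [Finset.sum_comm]
    rw [Finset.sum_comm]
    refine Finset.sum_congr rfl fun l _ => ?_
    rw [Finset.sum_comm]
    exact Finset.sum_congr rfl fun a _ => Finset.sum_congr rfl fun l' _ => by ring
  have e1 : ∀ l, ∑ s, ∑ l', ∑ s', W l s * (A⁻¹ l l' * A⁻¹ s s' * E l' s')
      = ∑ b, ∑ l', lorentzSign b *
        (A⁻¹ l l' * ((∑ s, W l s * e b s) * ∑ s', E l' s' * e b s')) := by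
    intro l
    rw [Finset.sum_comm]
    conv_rhs => rw [Finset.sum_comm]
    refine Finset.sum_congr rfl fun l' _ => ?_
    trans A⁻¹ l l' * ∑ s, ∑ s', A⁻¹ s s' * (W l s * E l' s')
    · simp only [Finset.mul_sum]
      exact Finset.sum_congr rfl fun a _ => Finset.sum_congr rfl fun l' _ => by ring
    · rw [key, Finset.mul_sum]
      exact Finset.sum_congr rfl fun a _ => by ring
  simp only [e1]
  rw [Finset.sum_comm]
  conv_rhs => rw [Finset.sum_comm]
  refine Finset.sum_congr rfl fun b _ => ?_
  simp only [← Finset.mul_sum]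
  rw [key, Finset.mul_sum]
  refine Finset.sum_congr rfl fun a _ => ?_
  have e2 : ∀ V : Fin 4 → Fin 4 → ℝ,
      ∑ l, (∑ s, V l s * e b s) * e a l = ∑ l, ∑ s, V l s * e a l * e b s := by
    intro V
    simp only [Finset.sum_mul]
    exact Finset.sum_congr rfl fun a _ => Finset.sum_congr rfl fun l' _ => by ring
  rw [e2, e2]
  ring

theorem isLinearMap_det_updateRow {n : ℕ} (M : Matrix (Fin n) (Fin n) ℝ) (i : Fin n) :
    IsLinearMap ℝ fun p : Coord n => (M.updateRow i ⇑p).det :=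
  ⟨fun p q => Matrix.det_updateRow_add M i p q, fun c p => Matrix.det_updateRow_smul M i c p⟩

/-- The determinant is multilinear in its rows, and its values on basis vectors are the permutation
symbols. -/
theorem permSymbol_sum (p q r s : Coord 4) :
    ∑ a, ∑ b, ∑ c, ∑ d, permSymbol ![a, b, c, d] * p a * q b * r c * s d
      = (Matrix.of ![⇑p, ⇑q, ⇑r, ⇑s]).det := by
  have h1 : ∀ q r s : Coord 4, IsLinearMap ℝ fun p : Coord 4 =>
      (Matrix.of ![⇑p, ⇑q, ⇑r, ⇑s]).det := fun q r s => by
    convert isLinearMap_det_updateRow (Matrix.of ![⇑q, ⇑q, ⇑r, ⇑s]) 0 using 3 with p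
    ext i j
    fin_cases i <;> simp [Matrix.updateRow_apply]
  have h2 : ∀ p r s : Coord 4, IsLinearMap ℝ fun q : Coord 4 =>
      (Matrix.of ![⇑p, ⇑q, ⇑r, ⇑s]).det := fun p r s => by
    convert isLinearMap_det_updateRow (Matrix.of ![⇑p, ⇑p, ⇑r, ⇑s]) 1 using 3 with p
    ext i j
    fin_cases i <;> simp [Matrix.updateRow_apply]
  have h3 : ∀ p q s : Coord 4, IsLinearMap ℝ fun r : Coord 4 =>
      (Matrix.of ![⇑p, ⇑q, ⇑r, ⇑s]).det := fun p q s => by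
    convert isLinearMap_det_updateRow (Matrix.of ![⇑p, ⇑q, ⇑p, ⇑s]) 2 using 3 with p
    ext i j
    fin_cases i <;> simp [Matrix.updateRow_apply]
  have h4 : ∀ p q r : Coord 4, IsLinearMap ℝ fun s : Coord 4 =>
      (Matrix.of ![⇑p, ⇑q, ⇑r, ⇑s]).det := fun p q r => by
    convert isLinearMap_det_updateRow (Matrix.of ![⇑p, ⇑q, ⇑r, ⇑p]) 3 using 3 with p
    ext i j
    fin_cases i <;> simp [Matrix.updateRow_apply]
  rw [isLinearMap_expand (h1 q r s) p]
  refine Finset.sum_congr rfl fun a _ => ?_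
  rw [isLinearMap_expand (h2 _ r s) q, Finset.smul_sum]
  refine Finset.sum_congr rfl fun b _ => ?_
  rw [isLinearMap_expand (h3 _ _ s) r, Finset.smul_sum, Finset.smul_sum]
  refine Finset.sum_congr rfl fun c _ => ?_
  rw [isLinearMap_expand (h4 _ _ _) s, Finset.smul_sum, Finset.smul_sum, Finset.smul_sum]
  refine Finset.sum_congr rfl fun d _ => ?_
  have : permSymbol ![a, b, c, d] = (Matrix.of
      ![⇑(basisVec a : Coord 4), ⇑(basisVec b : Coord 4), ⇑(basisVec c : Coord 4),
        ⇑(basisVec d : Coord 4)]).det := by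
    unfold permSymbol
    congr 1
    ext i j
    fin_cases i <;> simp [eq_comm]
  rw [this]
  simp only [smul_eq_mul]
  ring

/-- The Levi-Civita tensor evaluated on vectors. -/
def epsForm (A : Matrix (Fin 4) (Fin 4) ℝ) (p q r s : Coord 4) : ℝ :=
  ∑ a, ∑ b, ∑ c, ∑ d, leviCivita A ![a, b, c, d] * p a * q b * r c * s d

theorem epsForm_eq (A : Matrix (Fin 4) (Fin 4) ℝ) (p q r s : Coord 4) :
    epsForm A p q r s = Real.sqrt |A.det| * (Matrix.of ![⇑p, ⇑q, ⇑r, ⇑s]).det := by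
  rw [← permSymbol_sum]
  simp only [epsForm, leviCivita, Finset.mul_sum]
  exact Finset.sum_congr rfl fun a _ => Finset.sum_congr rfl fun b _ =>
    Finset.sum_congr rfl fun c _ => Finset.sum_congr rfl fun d _ => by ring

/-- The matrix of the chosen vectors is a selection matrix times the matrix of the frame, and
determinants multiply. -/
theorem epsForm_frame (A : Matrix (Fin 4) (Fin 4) ℝ) (e : Fin 4 → Coord 4) (a b c d : Fin 4) :
    epsForm A (e a) (e b) (e c) (e d)
      = permSymbol ![a, b, c, d] * epsForm A (e 0) (e 1) (e 2) (e 3) := by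
  have : (Matrix.of ![⇑(e a), ⇑(e b), ⇑(e c), ⇑(e d)])
      = (Matrix.of fun i j => if ![a, b, c, d] i = j then (1 : ℝ) else 0)
        * Matrix.of ![⇑(e 0), ⇑(e 1), ⇑(e 2), ⇑(e 3)] := by
    have h0 : Matrix.of ![⇑(e 0), ⇑(e 1), ⇑(e 2), ⇑(e 3)] = Matrix.of fun i => ⇑(e i) := by
      ext i j
      fin_cases i <;> rfl
    rw [h0]
    ext i j
    simp only [Matrix.mul_apply, Matrix.of_apply, ite_mul, one_mul, zero_mul, Finset.sum_ite_eq,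
      Finset.mem_univ, if_true]
    fin_cases i <;> rfl
  rw [epsForm_eq, epsForm_eq, this, Matrix.det_mul, permSymbol]
  ring

/-- Moving the time index from the third slot to the front takes two transpositions, so the sign is
unchanged. -/
theorem permSymbol_middle_zero (k l j : Fin 3) :
    permSymbol ![k.succ, l.succ, 0, j.succ] = permSymbol ![k, l, j] := by
  unfold permSymbol
  rw [Matrix.det_succ_column_zero, Finset.sum_eq_single 2]
  · have h1 : ((-1 : ℝ) ^ ((2 : Fin 4) : ℕ)) = 1 := by norm_num
    have h2 : (Matrix.of fun p q => if ![k.succ, l.succ, 0, j.succ] p = q then (1 : ℝ) else 0) 2 0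
        = 1 := by simp
    rw [h1, h2, one_mul, one_mul]
    congr 1
    ext a b
    fin_cases a <;> simp [Fin.succAbove] <;> congr
  · intro i _ hi
    fin_cases i <;> simp at hi ⊢
  · simp

theorem permSymbol_eq_zero {n : ℕ} {idx : Fin n → Fin n} {a b : Fin n} (hab : a ≠ b)
    (h : idx a = idx b) : permSymbol idx = 0 := by
  unfold permSymbol
  exact Matrix.det_zero_of_row_eq hab (by ext; simp [h])

/-- A closed form for case checks; the addition in `Fin 3` is cyclic, so `l = k + 1` singles out the
even permutations. -/
theorem permSymbol_three (k l j : Fin 3) : permSymbol ![k, l, j]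
    = (if k = l ∨ l = j ∨ k = j then 0 else if l = k + 1 then 1 else -1) := by
  unfold permSymbol
  rw [Matrix.det_fin_three]
  fin_cases k <;> fin_cases l <;> fin_cases j <;> simp

theorem sum_four_comm {ι κ : Type*} [Fintype ι] [Fintype κ] (f : ι → ι → ι → ι → κ → ℝ) :
    ∑ a, ∑ b, ∑ c, ∑ d, ∑ k, f a b c d k = ∑ k, ∑ a, ∑ b, ∑ c, ∑ d, f a b c d k := by
  trans ∑ a, ∑ k, ∑ b, ∑ c, ∑ d, f a b c d k
  · refine Finset.sum_congr rfl fun a _ => ?_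
    trans ∑ b, ∑ k, ∑ c, ∑ d, f a b c d k
    · refine Finset.sum_congr rfl fun b _ => ?_
      trans ∑ c, ∑ k, ∑ d, f a b c d k
      · exact Finset.sum_congr rfl fun c _ => Finset.sum_comm
      · exact Finset.sum_comm
    · exact Finset.sum_comm
  · exact Finset.sum_comm

theorem sum_pair_comm {ι : Type*} [Fintype ι] (f : ι → ι → ι → ι → ℝ) :
    ∑ a, ∑ b, ∑ c, ∑ d, f a b c d = ∑ c, ∑ d, ∑ a, ∑ b, f a b c d := by
  trans ∑ a, ∑ c, ∑ d, ∑ b, f a b c d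
  · refine Finset.sum_congr rfl fun a _ => ?_
    rw [Finset.sum_comm]
    exact Finset.sum_congr rfl fun c _ => Finset.sum_comm
  · rw [Finset.sum_comm]
    exact Finset.sum_congr rfl fun c _ => Finset.sum_comm

/-- The Weyl tensor evaluated on vectors. -/
def weylForm (G : Coord 4 → Matrix (Fin 4) (Fin 4) ℝ) (y p q r s : Coord 4) : ℝ :=
  ∑ a, ∑ b, ∑ c, ∑ d, weyl G a b c d y * p a * q b * r c * s d

/-- The magnetic part of the Weyl tensor with respect to `N`, evaluated on vectors. -/
def magForm (G : Coord 4 → Matrix (Fin 4) (Fin 4) ℝ) (y N u v : Coord 4) : ℝ :=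
  ∑ α, ∑ β, ∑ μ, ∑ ν, weylDual G α μ ν β y * N μ * N ν * u α * v β

theorem magForm_eq {G : Coord 4 → Matrix (Fin 4) (Fin 4) ℝ} {y : Coord 4}
    (h : IsLorentzFrame (G y) e) (N u v : Coord 4) :
    magForm G y N u v = (1 / 2 : ℝ) * ∑ a, ∑ b, lorentzSign a * lorentzSign b *
      weylForm G y u N (e a) (e b) * epsForm (G y) (e a) (e b) N v := by
  -- The partial contractions of the Weyl and Levi-Civita tensors are made opaque, so that the
  -- remaining sums can be rearranged as sums of products of scalars.
  obtain ⟨X, hX⟩ : ∃ X : Fin 4 → Fin 4 → Fin 4 → Fin 4 → ℝ, ∀ α μ a b,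
      ∑ l, ∑ s, weyl G α μ l s y * e a l * e b s = X α μ a b := ⟨_, fun _ _ _ _ => rfl⟩
  obtain ⟨Y, hY⟩ : ∃ Y : Fin 4 → Fin 4 → Fin 4 → Fin 4 → ℝ, ∀ ν β a b,
      ∑ l', ∑ s', leviCivita (G y) ![l', s', ν, β] * e a l' * e b s' = Y ν β a b :=
    ⟨_, fun _ _ _ _ => rfl⟩
  have h1 : ∀ α μ ν β, weylDual G α μ ν β y = (1 / 2 : ℝ) * ∑ a, ∑ b,
      lorentzSign a * lorentzSign b * X α μ a b * Y ν β a b := by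
    intro α μ ν β
    unfold weylDual
    rw [h.contract (fun l s => weyl G α μ l s y) (fun l' s' => leviCivita (G y) ![l', s', ν, β])]
    simp only [hX, hY]
  have h2 : ∀ a b, weylForm G y u N (e a) (e b) = ∑ α, ∑ μ, X α μ a b * (u α * N μ) := by
    intro a b
    simp only [weylForm, ← hX, Finset.sum_mul]
    exact Finset.sum_congr rfl fun a _ => Finset.sum_congr rfl fun b _ =>
      Finset.sum_congr rfl fun c _ => Finset.sum_congr rfl fun d _ => by ring
  have h3 : ∀ a b, epsForm (G y) (e a) (e b) N v = ∑ ν, ∑ β, Y ν β a b * (N ν * v β) := by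
    intro a b
    simp only [epsForm, ← hY, Finset.sum_mul]
    rw [sum_pair_comm]
    exact Finset.sum_congr rfl fun a _ => Finset.sum_congr rfl fun b _ =>
      Finset.sum_congr rfl fun c _ => Finset.sum_congr rfl fun d _ => by ring
  have h4 : ∀ X Y : Fin 4 → Fin 4 → ℝ,
      (∑ α, ∑ μ, X α μ) * (∑ ν, ∑ β, Y ν β) = ∑ α, ∑ β, ∑ μ, ∑ ν, X α μ * Y ν β := by
    intro X Y
    rw [Finset.sum_comm (f := Y), Finset.sum_mul_sum]
    simp only [Finset.sum_mul_sum]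
  have h5 : ∀ a b, weylForm G y u N (e a) (e b) * epsForm (G y) (e a) (e b) N v
      = ∑ α, ∑ β, ∑ μ, ∑ ν, X α μ a b * (u α * N μ) * (Y ν β a b * (N ν * v β)) := by
    intro a b
    rw [h2, h3, h4]
  unfold magForm
  simp only [h1, mul_assoc (lorentzSign _ * lorentzSign _) (weylForm _ _ _ _ _ _), h5]
  simp only [Finset.mul_sum, Finset.sum_mul]
  rw [sum_four_comm]
  refine Finset.sum_congr rfl fun a _ => ?_
  rw [sum_four_comm]
  exact Finset.sum_congr rfl fun b _ => Finset.sum_congr rfl fun _ _ =>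
    Finset.sum_congr rfl fun _ _ => Finset.sum_congr rfl fun _ _ =>
    Finset.sum_congr rfl fun _ _ => by ring

/-- Substituting Ricci = κ g in the definition of the Weyl tensor turns its Ricci terms into κ times
the same product of metrics that multiplies R/6. No relation between κ and R is needed. -/
theorem weylForm_eq {G : Coord 4 → Matrix (Fin 4) (Fin 4) ℝ} {y : Coord 4} {κ : ℝ}
    (h : IsMetricNear G y) (hric : ∀ a b, ricci G a b y = κ * G y a b) (p q r s : Coord 4) :
    weylForm G y p q r s = matForm (G y) p (curvOp (connOf G) y r s q)
      + (scalarCurv G y / 6 - κ) * (matForm (G y) p r * matForm (G y) q s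
        - matForm (G y) p s * matForm (G y) q r) := by
  have hs := h.self_of_nhds.2.1
  rw [form_curvOp h]
  have h1 : matForm (G y) p r * matForm (G y) q s
      = ∑ a, ∑ b, ∑ c, ∑ d, G y a c * G y b d * p a * q b * r c * s d := by
    rw [matForm_apply, matForm_apply, Finset.sum_mul_sum]
    simp only [Finset.sum_mul_sum]
    exact Finset.sum_congr rfl fun a _ => Finset.sum_congr rfl fun b _ =>
      Finset.sum_congr rfl fun c _ => Finset.sum_congr rfl fun d _ => by ring
  have h2 : matForm (G y) p s * matForm (G y) q r
      = ∑ a, ∑ b, ∑ c, ∑ d, G y a d * G y b c * p a * q b * r c * s d := by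
    rw [matForm_apply, matForm_apply, Finset.sum_mul_sum]
    simp only [Finset.sum_mul_sum]
    refine Finset.sum_congr rfl fun a _ => Finset.sum_congr rfl fun b _ => ?_
    rw [Finset.sum_comm]
    exact Finset.sum_congr rfl fun c _ => Finset.sum_congr rfl fun d _ => by ring
  rw [h1, h2]
  simp only [← Finset.sum_sub_distrib, Finset.mul_sum, ← Finset.sum_add_distrib]
  unfold weylForm
  refine Finset.sum_congr rfl fun a _ => Finset.sum_congr rfl fun b _ =>
      Finset.sum_congr rfl fun c _ => Finset.sum_congr rfl fun d _ => ?_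
  unfold weyl
  rw [hric, hric, hric, hric, hs d b, hs c b, hs d a, hs c a]
  ring

theorem sum_ricci {G : Coord 4 → Matrix (Fin 4) (Fin 4) ℝ} {y : Coord 4}
    (h : IsMetricNear G y) (he : IsLorentzFrame (G y) e) (u v : Coord 4) :
    ∑ a, ∑ b, ricci G a b y * u a * v b
      = ∑ a, lorentzSign a * matForm (G y) (e a) (curvOp (connOf G) y (e a) v u) := by
  have hT : IsLinearMap ℝ fun w => curvOp (connOf G) y w v u :=
    ⟨fun _ _ => by simp [curvOp]; abel, fun _ _ => by simp [curvOp, smul_sub, smul_add]⟩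
  rw [← he.trace_eq h.self_of_nhds.2.1 hT]
  simp only [curvOp_apply h, basisVec_apply, ricci, Finset.sum_mul]
  conv_rhs => rw [Finset.sum_comm]
  refine Finset.sum_congr rfl fun a _ => ?_
  rw [Finset.sum_comm]
  refine Finset.sum_congr rfl fun c _ => ?_
  simp

/-- The vacuum equations make the Ricci tensor a multiple of the metric. -/
theorem ricci_eq_of_vacuum {G : Coord 4 → Matrix (Fin 4) (Fin 4) ℝ} {y : Coord 4} {Λ : ℝ}
    (hvac : ∀ a b, ricci G a b y - (1 / 2 : ℝ) * scalarCurv G y * G y a b + Λ * G y a b = 0)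
    (a b : Fin 4) : ricci G a b y = (scalarCurv G y / 2 - Λ) * G y a b := by
  linarith [hvac a b]

/-! ### Magnetic part and momentum constraint in a frame whose time vector is the normal. -/

section Slice

variable {G : Coord 4 → Matrix (Fin 4) (Fin 4) ℝ} {y : Coord 4} {κ : ℝ}

/-- The Levi-Civita factor already contains `e 0`, so only spatial frame vectors contribute; the
metric products in `weylForm_eq` each contain g(e₀, e_k) or g(e₀, e_l) and vanish. -/
theorem magForm_eq_curvOp (h : IsMetricNear G y) (he : IsLorentzFrame (G y) e)
    (hric : ∀ a b, ricci G a b y = κ * G y a b)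
    (hor : epsForm (G y) (e 0) (e 1) (e 2) (e 3) = 1) (i j : Fin 3) :
    magForm G y (e 0) (e i.succ) (e j.succ) = (1 / 2 : ℝ) * ∑ k : Fin 3, ∑ l : Fin 3,
      permSymbol ![k, l, j] *
        matForm (G y) (e i.succ) (curvOp (connOf G) y (e k.succ) (e l.succ) (e 0)) := by
  have h00 : ∀ b c d, permSymbol ![(0 : Fin 4), b, 0, d] = 0 ∧ permSymbol ![c, (0 : Fin 4), 0, d] = 0 :=
    fun b c d => ⟨permSymbol_eq_zero (a := 0) (b := 2) (by decide) rfl,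
      permSymbol_eq_zero (a := 1) (b := 2) (by decide) rfl⟩
  rw [magForm_eq he]
  congr 1
  rw [Fin.sum_univ_succ]
  have e0 : ∀ k : Fin 3, ∀ j : Fin 3, matForm (G y) (e 0) (e k.succ) = 0 := fun k j => by
    rw [he, if_neg (Fin.succ_ne_zero k).symm]
  have z1 : ∑ b, lorentzSign 0 * lorentzSign b * weylForm G y (e i.succ) (e 0) (e 0) (e b) *
      epsForm (G y) (e 0) (e b) (e 0) (e j.succ) = 0 :=
    Finset.sum_eq_zero fun b _ => by rw [epsForm_frame, (h00 b 0 j.succ).1]; ring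
  rw [z1, zero_add]
  refine Finset.sum_congr rfl fun k _ => ?_
  rw [Fin.sum_univ_succ, epsForm_frame, (h00 0 k.succ j.succ).2]
  simp only [zero_mul, mul_zero, zero_add]
  refine Finset.sum_congr rfl fun l _ => ?_
  rw [epsForm_frame, hor, permSymbol_middle_zero, weylForm_eq h hric, e0 l 0, e0 k 0]
  have hk : ∀ k : Fin 3, lorentzSign k.succ = 1 := fun k => by simp [lorentzSign]
  rw [hk, hk]
  ring

/-- The momentum constraint. Ric(e₀, e_k) is a multiple of g(e₀, e_k) = 0, and the timelike term of
its frame expansion vanishes by `curvOp_skew`. -/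
theorem sum_form_curvOp (h : IsMetricNear G y) (he : IsLorentzFrame (G y) e)
    (hric : ∀ a b, ricci G a b y = κ * G y a b) (k : Fin 3) :
    ∑ i : Fin 3, matForm (G y) (e i.succ) (curvOp (connOf G) y (e i.succ) (e k.succ) (e 0)) = 0 := by
  have h1 := sum_ricci h he (e 0) (e k.succ)
  have h2 : ∑ a, ∑ b, ricci G a b y * e 0 a * e k.succ b = 0 := by
    have := he 0 k.succ
    rw [if_neg (Fin.succ_ne_zero k).symm, matForm_apply] at this
    simp only [hric, mul_assoc]
    simp only [← Finset.mul_sum]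
    simp only [mul_assoc] at this
    rw [this, mul_zero]
  have hlc : ∀ᶠ z in 𝓝 y, IsLeviCivitaAt (fun z => matForm (G z)) (connOf G) z := by
    filter_upwards [h.eventually] with z hz using isLeviCivitaAt_connOf hz
  have h3 := curvOp_skew hlc (h.contDiffAt_matForm.of_le ENat.LEInfty.out)
    (h.contDiffAt_connOf.differentiableAt (by simp)) (e 0) (e k.succ) (e 0) (e 0)
  have h5 := h.form_symm (curvOp (connOf G) y (e 0) (e k.succ) (e 0)) (e 0)
  have h4 : matForm (G y) (e 0) (curvOp (connOf G) y (e 0) (e k.succ) (e 0)) = 0 := by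
    linarith
  have h6 : ∀ f : Fin 4 → ℝ, f 0 = 0 → ∑ a, lorentzSign a * f a = ∑ i : Fin 3, f i.succ := by
    intro f hf
    rw [Fin.sum_univ_succ, hf]
    simp [lorentzSign]
  rw [← h6 (fun a => matForm (G y) (e a) (curvOp (connOf G) y (e a) (e k.succ) (e 0))) h4, ← h2]
  exact h1.symm

end Slice

end LorentzFrame

/-! ### The two local identities: B is minus the curl of K, and the flux vectors differ by a curl.
-/

section Slice

variable {G : Coord 4 → Matrix (Fin 4) (Fin 4) ℝ} {F N : Coord 3 → Coord 4} {x : Coord 3} {κ : ℝ}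

/-- The second fundamental form in coordinates. -/
def sffCoord (G : Coord 4 → Matrix (Fin 4) (Fin 4) ℝ) (F N : Coord 3 → Coord 4) (i j : Fin 3)
    (x : Coord 3) : ℝ :=
  secondForm (fun z => matForm (G z)) (connOf G) F N x (basisVec i) (basisVec j)

theorem contDiffAt_sffCoord (hG : IsMetricNear G (F x)) (hF : ContDiffAt ℝ ∞ F x)
    (hN : ContDiffAt ℝ ∞ N x) (i j : Fin 3) : ContDiffAt ℝ ∞ (sffCoord G F N i j) x := by
  have h1 : ∀ u : Coord 3, ContDiffAt ℝ ∞ (fun z => fderiv ℝ F z u) x := fun u =>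
    (hF.fderiv_right (m := ∞) (by simp)).clm_apply contDiffAt_const
  have h2 : ∀ u : Coord 3, ContDiffAt ℝ ∞ (fun z => fderiv ℝ N z u) x := fun u =>
    (hN.fderiv_right (m := ∞) (by simp)).clm_apply contDiffAt_const
  have h3 : ContDiffAt ℝ ∞ (fun z => matForm (G (F z))) x := hG.contDiffAt_matForm.comp x hF
  have h4 : ContDiffAt ℝ ∞ (fun z => connOf G (F z)) x := hG.contDiffAt_connOf.comp x hF
  unfold sffCoord secondForm covAlong
  exact ((h3.clm_apply ((h2 _).add ((h4.clm_apply (h1 _)).clm_apply hN))).clm_apply (h1 _)).neg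

/-- The frame adapted to the hypersurface. -/
def sliceFrame (F N : Coord 3 → Coord 4) (x : Coord 3) : Fin 4 → Coord 4 :=
  Fin.cons (N x) fun i => fderiv ℝ F x (basisVec i)

theorem isLorentzFrame_sliceFrame (hG : IsMetricNear G (F x))
    (hs : IsOrthonormalSlice (fun z => matForm (G z)) (connOf G) F N (basisVec (n := 3)) x) :
    IsLorentzFrame (G (F x)) (sliceFrame F N x) := by
  have h1 := hs.tangent.self_of_nhds
  have h2 := hs.orthogonal.self_of_nhds
  have h3 := hs.unit.self_of_nhds
  intro a b
  refine Fin.cases ?_ (fun i => ?_) a <;> refine Fin.cases ?_ (fun j => ?_) b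
  · simpa [sliceFrame, lorentzSign] using h3
  · simpa [sliceFrame, lorentzSign, (Fin.succ_ne_zero _).symm] using h2 j
  · rw [hG.form_symm]
    simpa [sliceFrame, lorentzSign, (Fin.succ_ne_zero _)] using h2 i
  · simpa [sliceFrame, lorentzSign] using h1 i j

/-- In vacuum the magnetic part of the Weyl tensor is minus the curl of the extrinsic curvature. -/
theorem magForm_eq_curl (hG : IsMetricNear G (F x))
    (hs : ∀ᶠ z in 𝓝 x,
      IsOrthonormalSlice (fun z => matForm (G z)) (connOf G) F N (basisVec (n := 3)) z)
    (hric : ∀ a b, ricci G a b (F x) = κ * G (F x) a b)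
    (hor : epsForm (G (F x)) (N x) (fderiv ℝ F x (basisVec 0)) (fderiv ℝ F x (basisVec 1))
      (fderiv ℝ F x (basisVec 2)) = 1) (i j : Fin 3) :
    magForm G (F x) (N x) (fderiv ℝ F x (basisVec i)) (fderiv ℝ F x (basisVec j))
      = -∑ k, ∑ l, permSymbol ![i, k, l] * pd k (sffCoord G F N l j) x := by
  have hs0 := hs.self_of_nhds
  have hfr := isLorentzFrame_sliceFrame hG hs0
  have hc : ∀ z w, matForm (G (F x)) z w
      = -(matForm (G (F x)) z (N x) * matForm (G (F x)) w (N x))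
        + ∑ m, matForm (G (F x)) z (fderiv ℝ F x (basisVec m))
          * matForm (G (F x)) w (fderiv ℝ F x (basisVec m)) := by
    intro z w
    rw [hfr.form_eq hG.self_of_nhds.2.1, Fin.sum_univ_succ]
    simp [sliceFrame, lorentzSign]
  have hcod : ∀ k l i, matForm (G (F x)) (fderiv ℝ F x (basisVec i))
      (curvOp (connOf G) (F x) (fderiv ℝ F x (basisVec k)) (fderiv ℝ F x (basisVec l)) (N x))
      = -(pd k (sffCoord G F N l i) x - pd l (sffCoord G F N k i) x) := by
    intro k l i
    have h1 := hs0.codazzi hc k l i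
    rw [hG.form_symm]
    unfold pd sffCoord
    linarith
  have hsymm : ∀ k l i, pd k (sffCoord G F N l i) x = pd k (sffCoord G F N i l) x := by
    intro k l i
    have : sffCoord G F N l i =ᶠ[𝓝 x] sffCoord G F N i l := by
      filter_upwards [hs] with z hz using hz.secondForm_symm l i
    unfold pd
    rw [this.fderiv_eq]
  have h1 := magForm_eq_curvOp hG hfr hric hor i j
  have h2 := sum_form_curvOp hG hfr hric
  simp only [sliceFrame, Fin.cons_zero, Fin.cons_succ, hcod] at h1 h2
  rw [h1]
  -- At this point the left side is minus the curl of K with `i` and `j` interchanged. The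
  -- antisymmetric part of the curl is the divergence of K minus the gradient of its trace, and
  -- `m0`, `m1`, `m2` say that this vanishes.
  have m0 := h2 0
  have m1 := h2 1
  have m2 := h2 2
  simp only [Fin.sum_univ_three, permSymbol_three] at m0 m1 m2 ⊢
  have s := fun k => And.intro (hsymm k 0 1) (And.intro (hsymm k 0 2) (hsymm k 1 2))
  have s0 := s 0
  have s1 := s 1
  have s2 := s 2
  fin_cases i <;> fin_cases j <;> simp <;> linarith

/-- The difference between the flux vectors of the magnetic part and of the momentum is a curl. -/
theorem mag_sub_momentum_eq_curl {K B : Fin 3 → Fin 3 → Coord 3 → ℝ} {x : Coord 3}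
    (hK : ∀ i j, DifferentiableAt ℝ (K i j) x) (hsymm : ∀ i j, K i j x = K j i x)
    (hB : ∀ i j, B i j x = -∑ k, ∑ l, permSymbol ![i, k, l] * pd k (K l j) x) (k i : Fin 3) :
    ∑ j, B i j x * (∑ m, permSymbol ![k, m, j] * x m)
      - (-K i k x + (∑ m, K m m x) * if i = k then 1 else 0)
      = -∑ m, ∑ l, permSymbol ![i, m, l]
        * pd m (fun z => ∑ j, K l j z * ∑ p, permSymbol ![k, p, j] * z p) x := by
  have hlin : ∀ j, HasFDerivAt (fun z : Coord 3 => ∑ p, permSymbol ![k, p, j] * z p)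
      (∑ p, permSymbol ![k, p, j] • (EuclideanSpace.proj p : Coord 3 →L[ℝ] ℝ)) x := by
    intro j
    exact HasFDerivAt.fun_sum fun p _ =>
      ((EuclideanSpace.proj p : Coord 3 →L[ℝ] ℝ).hasFDerivAt).const_mul _
  have hd : ∀ m l, pd m (fun z => ∑ j, K l j z * ∑ p, permSymbol ![k, p, j] * z p) x
      = ∑ j, (K l j x * permSymbol ![k, m, j]
        + (∑ p, permSymbol ![k, p, j] * x p) * pd m (K l j) x) := by
    intro m l
    unfold pd
    rw [(HasFDerivAt.fun_sum fun j _ => (hK l j).hasFDerivAt.fun_mul (hlin j)).fderiv]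
    simp
  simp only [hd, hB]
  -- The terms with a derivative of K match B. In the others ε_{iml} ε_{kmj} = δ_ik δ_lj - δ_ij δ_lk
  -- produces K δ_ik - K_ki; symmetry of K makes this the momentum component.
  have h01 := hsymm 0 1
  have h02 := hsymm 0 2
  have h12 := hsymm 1 2
  simp only [Fin.sum_univ_three, permSymbol_three]
  fin_cases k <;> fin_cases i <;> simp <;> linarith

end Slice

set_option linter.unusedSectionVars false

/-! ### Components of vectors and bilinear forms in charts, and their transformation. -/

section Charts

variable {n : ℕ} {N : Type*} [TopologicalSpace N] [ChartedSpace (Coord n) N]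
  [IsManifold (𝓡 n) ∞ N] {e : OpenPartialHomeomorph N (Coord n)}

theorem mdifferentiable_of_mem_maximalAtlas (he : e ∈ IsManifold.maximalAtlas (𝓡 n) ∞ N) :
    e.MDifferentiable (𝓡 n) (𝓡 n) :=
  ⟨(contMDiffOn_of_mem_maximalAtlas he).mdifferentiableOn (by simp),
    (contMDiffOn_symm_of_mem_maximalAtlas he).mdifferentiableOn (by simp)⟩

theorem comp_frame (he : e ∈ IsManifold.maximalAtlas (𝓡 n) ∞ N) {y : Coord n} (hy : y ∈ e.target)
    (i : Fin n) : comp e (e.symm y) (frame e i y) = basisVec i := by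
  have := (mdifferentiable_of_mem_maximalAtlas he).comp_symm_deriv hy
  exact congrArg (fun L => L (basisVec i)) this

theorem comp_injective (he : e ∈ IsManifold.maximalAtlas (𝓡 n) ∞ N) {p : N} (hp : p ∈ e.source) :
    Function.Injective (comp e p) :=
  (mdifferentiable_of_mem_maximalAtlas he).mfderiv_injective hp

theorem isLinearMap_comp (p : N) : IsLinearMap ℝ (comp e p) :=
  ⟨fun u v => map_add (mfderiv (𝓡 n) (𝓡 n) e p) u v,
    fun c u => map_smul (mfderiv (𝓡 n) (𝓡 n) e p) c u⟩

theorem eq_sum_comp_smul_frame (he : e ∈ IsManifold.maximalAtlas (𝓡 n) ∞ N) {y : Coord n}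
    (hy : y ∈ e.target) (v : TangentSpace (𝓡 n) (e.symm y)) :
    v = ∑ i, comp e (e.symm y) v i • frame e i y := by
  apply comp_injective he (e.map_target hy)
  change _ = (isLinearMap_comp (e := e) (e.symm y)).mk' _ _
  rw [map_sum]
  simp only [map_smul, IsLinearMap.mk'_apply, comp_frame he hy]
  exact (sum_apply_smul_basisVec _).symm

theorem exists_comp_eq (he : e ∈ IsManifold.maximalAtlas (𝓡 n) ∞ N) {y : Coord n}
    (hy : y ∈ e.target) (u : Coord n) :
    ∃ v : TangentSpace (𝓡 n) (e.symm y), comp e (e.symm y) v = u :=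
  ⟨mfderiv (𝓡 n) (𝓡 n) e.symm y u, congrArg (fun L => L u)
    ((mdifferentiable_of_mem_maximalAtlas he).comp_symm_deriv hy)⟩

/-- The coordinate change between two charts is smooth. -/
theorem contDiffAt_transition {e' : OpenPartialHomeomorph N (Coord n)}
    (he : e ∈ IsManifold.maximalAtlas (𝓡 n) ∞ N) (he' : e' ∈ IsManifold.maximalAtlas (𝓡 n) ∞ N)
    {y : Coord n} (hy : y ∈ e.target) (hy' : e.symm y ∈ e'.source) :
    ContDiffAt ℝ ∞ (fun z => e' (e.symm z)) y := by
  rw [← contMDiffAt_iff_contDiffAt]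
  exact ((contMDiffOn_of_mem_maximalAtlas he').contMDiffAt (e'.open_source.mem_nhds hy')).comp y
    ((contMDiffOn_symm_of_mem_maximalAtlas he).contMDiffAt (e.open_target.mem_nhds hy))

theorem comp_change {e' : OpenPartialHomeomorph N (Coord n)}
    (he : e ∈ IsManifold.maximalAtlas (𝓡 n) ∞ N) (he' : e' ∈ IsManifold.maximalAtlas (𝓡 n) ∞ N)
    {p : N} (hp : p ∈ e.source) (hp' : p ∈ e'.source) (v : TangentSpace (𝓡 n) p) :
    comp e' p v = fderiv ℝ (fun z => e' (e.symm z)) (e p) (comp e p v) := by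
  have h1 : (e' : N → Coord n) =ᶠ[𝓝 p] (fun z => e' (e.symm z)) ∘ e := by
    filter_upwards [e.open_source.mem_nhds hp] with q hq
    simp [e.left_inv hq]
  have h2 : MDifferentiableAt (𝓡 n) (𝓡 n) (fun z => e' (e.symm z)) (e p) :=
    ((contDiffAt_transition he he' (e.map_source hp)
      (by rwa [e.left_inv hp])).differentiableAt (by simp)).mdifferentiableAt
  have h3 := mfderiv_comp p h2
    ((mdifferentiable_of_mem_maximalAtlas he).mdifferentiableAt hp)
  rw [← mfderiv_eq_fderiv]
  exact (congrArg (fun L : TangentSpace (𝓡 n) p →L[ℝ] Coord n => L v) h1.mfderiv_eq).trans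
    (congrArg (fun L : TangentSpace (𝓡 n) p →L[ℝ] Coord n => L v) h3)

theorem form_eq_matForm_of_target (g : BilinField n N) (he : e ∈ IsManifold.maximalAtlas (𝓡 n) ∞ N)
    {y : Coord n} (hy : y ∈ e.target) (u v : TangentSpace (𝓡 n) (e.symm y)) :
    g (e.symm y) u v
      = matForm (coordMetric g e y) (comp e (e.symm y) u) (comp e (e.symm y) v) := by
  conv_lhs => rw [eq_sum_comp_smul_frame he hy u, eq_sum_comp_smul_frame he hy v]
  rw [matForm_apply]
  simp only [map_sum, map_smul, LinearMap.sum_apply, LinearMap.smul_apply, smul_eq_mul,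
    Finset.mul_sum]
  rw [Finset.sum_comm]
  refine Finset.sum_congr rfl fun i _ => Finset.sum_congr rfl fun j _ => ?_
  simp only [coordMetric, coordMatrix, Matrix.of_apply]
  ring

theorem form_eq_matForm (g : BilinField n N) (he : e ∈ IsManifold.maximalAtlas (𝓡 n) ∞ N)
    {p : N} (hp : p ∈ e.source) (u v : TangentSpace (𝓡 n) p) :
    g p u v = matForm (coordMetric g e (e p)) (comp e p u) (comp e p v) := by
  obtain ⟨y, hy, rfl⟩ : ∃ y ∈ e.target, e.symm y = p := ⟨e p, e.map_source hp, e.left_inv hp⟩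
  rw [e.right_inv hy]
  exact form_eq_matForm_of_target g he hy u v

theorem matForm_change (g : BilinField n N) {e' : OpenPartialHomeomorph N (Coord n)}
    (he : e ∈ IsManifold.maximalAtlas (𝓡 n) ∞ N) (he' : e' ∈ IsManifold.maximalAtlas (𝓡 n) ∞ N)
    {y : Coord n} (hy : y ∈ e.target) (hy' : e.symm y ∈ e'.source) (u v : Coord n) :
    matForm (coordMetric g e y) u v = matForm (coordMetric g e' (e' (e.symm y)))
      (fderiv ℝ (fun z => e' (e.symm z)) y u) (fderiv ℝ (fun z => e' (e.symm z)) y v) := by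
  obtain ⟨U, rfl⟩ := exists_comp_eq he hy u
  obtain ⟨V, rfl⟩ := exists_comp_eq he hy v
  have h1 := comp_change he he' (e.map_target hy) hy' U
  have h2 := comp_change he he' (e.map_target hy) hy' V
  rw [e.right_inv hy] at h1 h2
  rw [← form_eq_matForm_of_target g he hy, ← h1, ← h2, ← form_eq_matForm g he' hy']

end Charts

/-! ### The immersion in charts; chart independence of the extrinsic curvature. -/

section Spacetime

variable {M : Type*} [TopologicalSpace M] [ChartedSpace (Coord 4) M] [IsManifold (𝓡 4) ∞ M]
  (g : LorentzMetric M)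

theorem LorentzMetric.isMetricNear {e : OpenPartialHomeomorph M (Coord 4)}
    (he : e ∈ atlas (Coord 4) M) {y : Coord 4} (hy : y ∈ e.target) :
    IsMetricNear (coordMetric g.form e) y := by
  filter_upwards [e.open_target.mem_nhds hy] with z hz
  have he' : e ∈ IsManifold.maximalAtlas (𝓡 4) ∞ M := IsManifold.subset_maximalAtlas he
  refine ⟨fun i j => (g.smooth e he i j).contDiffAt (e.open_target.mem_nhds hz),
    fun i j => g.symm _ _ _, ?_⟩
  obtain ⟨b, hb⟩ := g.signature (e.symm z)
  have hf : IsLorentzFrame (coordMetric g.form e z) fun a => comp e (e.symm z) (b a) := by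
    intro a c
    rw [← form_eq_matForm_of_target g.form he' hz, hb]
    rfl
  have := congrArg Matrix.det hf.inv_mul
  rw [Matrix.det_mul, Matrix.det_one] at this
  exact right_ne_zero_of_mul_eq_one this

namespace SpatialHypersurface

variable {g} {S : Type*} [TopologicalSpace S] [ChartedSpace (Coord 3) S] [IsManifold (𝓡 3) ∞ S]
  (φ : SpatialHypersurface g S) {e : OpenPartialHomeomorph M (Coord 4)}
  {c : OpenPartialHomeomorph S (Coord 3)}

/-- The immersion in the charts `c` and `e`. -/
def localMap (e : OpenPartialHomeomorph M (Coord 4)) (c : OpenPartialHomeomorph S (Coord 3))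
    (x : Coord 3) : Coord 4 :=
  e (φ.map (c.symm x))

/-- The unit normal in the charts `c` and `e`. -/
def localNormal (e : OpenPartialHomeomorph M (Coord 4)) (c : OpenPartialHomeomorph S (Coord 3))
    (x : Coord 3) : Coord 4 :=
  comp e (φ.map (c.symm x)) (φ.normal (c.symm x))

variable {φ} {x : Coord 3}

theorem contDiffAt_localMap (he : e ∈ IsManifold.maximalAtlas (𝓡 4) ∞ M)
    (hc : c ∈ IsManifold.maximalAtlas (𝓡 3) ∞ S) (hx : x ∈ c.target)
    (hxe : φ.map (c.symm x) ∈ e.source) : ContDiffAt ℝ ∞ (φ.localMap e c) x := by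
  rw [← contMDiffAt_iff_contDiffAt]
  have h1 : ContMDiffAt (𝓡 3) (𝓡 3) ∞ c.symm x :=
    (contMDiffOn_symm_of_mem_maximalAtlas hc).contMDiffAt (c.open_target.mem_nhds hx)
  have h2 : ContMDiffAt (𝓡 4) (𝓡 4) ∞ e (φ.map (c.symm x)) :=
    (contMDiffOn_of_mem_maximalAtlas he).contMDiffAt (e.open_source.mem_nhds hxe)
  exact h2.comp x ((φ.map_smooth _).comp x h1)

/-- The components are the fibre part of the tangent map of the chart applied to the normal, viewed
as a smooth map into the tangent bundle. -/
theorem contMDiffAt_comp_normal (he : e ∈ IsManifold.maximalAtlas (𝓡 4) ∞ M) {q : S}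
    (hq : φ.map q ∈ e.source) :
    ContMDiffAt (𝓡 3) 𝓘(ℝ, Coord 4) ∞ (fun q' => comp e (φ.map q') (φ.normal q')) q := by
  have h1 := (contMDiffOn_of_mem_maximalAtlas he).contMDiffOn_tangentMapWithin (m := ∞) (by simp)
    e.open_source.uniqueMDiffOn
  have h2 := h1.comp (s := φ.map ⁻¹' e.source) φ.normal_smooth.contMDiffOn (fun q hq => hq)
  have h3 := (contMDiff_snd_tangentBundle_modelSpace (Coord 4) (𝓡 4) (n := ∞)).comp_contMDiffOn h2
  have ho : IsOpen (φ.map ⁻¹' e.source) := e.open_source.preimage φ.map_smooth.continuous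
  have h4 := h3.contMDiffAt (ho.mem_nhds hq)
  refine h4.congr_of_eventuallyEq ?_
  filter_upwards [ho.mem_nhds hq] with q' hq'
  exact congrArg (fun L => L (φ.normal q')) (mfderivWithin_of_isOpen (I := 𝓡 4)
    (I' := 𝓡 4) (f := e) e.open_source hq').symm

theorem contDiffAt_localNormal (he : e ∈ IsManifold.maximalAtlas (𝓡 4) ∞ M)
    (hc : c ∈ IsManifold.maximalAtlas (𝓡 3) ∞ S) (hx : x ∈ c.target)
    (hxe : φ.map (c.symm x) ∈ e.source) : ContDiffAt ℝ ∞ (φ.localNormal e c) x := by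
  rw [← contMDiffAt_iff_contDiffAt]
  have h1 : ContMDiffAt (𝓡 3) (𝓡 3) ∞ c.symm x :=
    (contMDiffOn_symm_of_mem_maximalAtlas hc).contMDiffAt (c.open_target.mem_nhds hx)
  exact (contMDiffAt_comp_normal he hxe).comp x h1

theorem comp_push_frame (he : e ∈ IsManifold.maximalAtlas (𝓡 4) ∞ M)
    (hc : c ∈ IsManifold.maximalAtlas (𝓡 3) ∞ S) (hx : x ∈ c.target)
    (hxe : φ.map (c.symm x) ∈ e.source) (i : Fin 3) :
    comp e (φ.map (c.symm x)) (φ.push (c.symm x) (frame c i x))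
      = fderiv ℝ (φ.localMap e c) x (basisVec i) := by
  have h1 : MDifferentiableAt (𝓡 3) (𝓡 3) c.symm x :=
    (mdifferentiable_of_mem_maximalAtlas hc).mdifferentiableAt_symm hx
  have h2 : MDifferentiableAt (𝓡 4) (𝓡 4) e (φ.map (c.symm x)) :=
    (mdifferentiable_of_mem_maximalAtlas he).mdifferentiableAt hxe
  have h3 : MDifferentiableAt (𝓡 3) (𝓡 4) φ.map (c.symm x) :=
    (φ.map_smooth _).mdifferentiableAt (by simp)
  have h4 := mfderiv_comp x h2 (h3.comp x h1)
  rw [mfderiv_comp x h3 h1] at h4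
  rw [← mfderiv_eq_fderiv]
  exact (congrArg (fun L => L (basisVec i)) h4).symm

theorem dirDeriv_frame {f : S → ℝ} (hc : c ∈ IsManifold.maximalAtlas (𝓡 3) ∞ S)
    (hx : x ∈ c.target) (hf : MDifferentiableAt (𝓡 3) 𝓘(ℝ, ℝ) f (c.symm x)) (i : Fin 3) :
    dirDeriv f (c.symm x) (frame c i x) = fderiv ℝ (fun z => f (c.symm z)) x (basisVec i) := by
  have h1 : MDifferentiableAt (𝓡 3) (𝓡 3) c.symm x :=
    (mdifferentiable_of_mem_maximalAtlas hc).mdifferentiableAt_symm hx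
  have h4 := mfderiv_comp x hf h1
  rw [← mfderiv_eq_fderiv]
  exact (congrArg (fun L => L (basisVec i)) h4).symm

theorem isLinearMap_comp_push (q : S) : IsLinearMap ℝ fun u => comp e (φ.map q) (φ.push q u) :=
  ⟨fun u v => by
    rw [← (isLinearMap_comp _).map_add]
    exact congrArg _ (map_add (mfderiv (𝓡 3) (𝓡 4) φ.map q) u v),
  fun a u => by
    rw [← (isLinearMap_comp _).map_smul]
    exact congrArg _ (map_smul (mfderiv (𝓡 3) (𝓡 4) φ.map q) a u)⟩

theorem extrinsicCurv_frame_chartAt (hc : c ∈ IsManifold.maximalAtlas (𝓡 3) ∞ S)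
    (hx : x ∈ c.target) (i j : Fin 3) :
    φ.extrinsicCurv (c.symm x) (frame c i x) (frame c j x)
      = sffCoord (coordMetric g.form (chartAt (Coord 4) (φ.map (c.symm x))))
        (φ.localMap (chartAt (Coord 4) (φ.map (c.symm x))) c)
        (φ.localNormal (chartAt (Coord 4) (φ.map (c.symm x))) c) i j x := by
  have hxe := mem_chart_source (Coord 4) (φ.map (c.symm x))
  have he : chartAt (Coord 4) (φ.map (c.symm x)) ∈ IsManifold.maximalAtlas (𝓡 4) ∞ M :=
    IsManifold.chart_mem_maximalAtlas _
  unfold extrinsicCurv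
  generalize chartAt (Coord 4) (φ.map (c.symm x)) = e at hxe he ⊢
  have hN := contDiffAt_localNormal he hc hx hxe
  have hmd := contMDiffAt_comp_normal he hxe
  have hn : ∀ μ, φ.normalDeriv e (c.symm x) (frame c i x) μ
      = covAlong (connOf (coordMetric g.form e)) (φ.localMap e c) (φ.localNormal e c) x
        (basisVec i) μ := by
    intro μ
    unfold normalDeriv covAlong
    rw [PiLp.add_apply, connOf_apply, comp_push_frame he hc hx hxe]
    congr 1
    rw [dirDeriv_frame hc hx]
    · have h1 := ((EuclideanSpace.proj μ : Coord 4 →L[ℝ] ℝ).hasFDerivAt.comp x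
        (hN.differentiableAt (by simp)).hasFDerivAt).fderiv
      exact congrArg (fun L => L (basisVec i)) h1
    · exact ((EuclideanSpace.proj μ : Coord 4 →L[ℝ] ℝ).contMDiff.contMDiffAt.comp _
        hmd).mdifferentiableAt (by simp)
  simp only [hn, comp_push_frame he hc hx hxe, Finset.sum_neg_distrib]
  unfold sffCoord secondForm
  rw [matForm_apply]
  rfl

/-- The definition uses the preferred spacetime chart at each point, which may jump as the point
moves. Covariance (`form_covAlong_comp`, applied to the transition map) replaces it by one fixed
chart, so the components can be differentiated. -/
theorem extrinsicCurv_frame (he : e ∈ atlas (Coord 4) M)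
    (hc : c ∈ IsManifold.maximalAtlas (𝓡 3) ∞ S) (hx : x ∈ c.target)
    (hxe : φ.map (c.symm x) ∈ e.source) (i j : Fin 3) :
    φ.extrinsicCurv (c.symm x) (frame c i x) (frame c j x)
      = sffCoord (coordMetric g.form e) (φ.localMap e c) (φ.localNormal e c) i j x := by
  rw [extrinsicCurv_frame_chartAt hc hx]
  have hxe' := mem_chart_source (Coord 4) (φ.map (c.symm x))
  have hat : chartAt (Coord 4) (φ.map (c.symm x)) ∈ atlas (Coord 4) M := chart_mem_atlas _ _
  generalize chartAt (Coord 4) (φ.map (c.symm x)) = e' at hxe' hat ⊢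
  have he1 : e ∈ IsManifold.maximalAtlas (𝓡 4) ∞ M := IsManifold.subset_maximalAtlas he
  have he1' : e' ∈ IsManifold.maximalAtlas (𝓡 4) ∞ M := IsManifold.subset_maximalAtlas hat
  set F := φ.localMap e c with hFdef
  set V := φ.localNormal e c with hVdef
  set ψ : Coord 4 → Coord 4 := fun z => e' (e.symm z) with hψdef
  have hF : ContDiffAt ℝ ∞ F x := contDiffAt_localMap he1 hc hx hxe
  have hV : ContDiffAt ℝ ∞ V x := contDiffAt_localNormal he1 hc hx hxe
  have hFx : F x ∈ e.target := e.map_source hxe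
  have hsymm : e.symm (F x) = φ.map (c.symm x) := e.left_inv hxe
  have hψ : ContDiffAt ℝ ∞ ψ (F x) :=
    contDiffAt_transition he1 he1' hFx (by rw [hsymm]; exact hxe')
  have hψF : ψ (F x) = φ.localMap e' c x := by
    simp only [hψdef, hsymm]
    rfl
  have hG' : IsMetricNear (coordMetric g.form e') (ψ (F x)) := by
    rw [hψF]
    exact g.isMetricNear hat (e'.map_source hxe')
  have hG := g.isMetricNear he hFx
  have hcont : ContinuousAt (fun z => φ.map (c.symm z)) x :=
    φ.map_smooth.continuous.continuousAt.comp (c.continuousAt_symm hx)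
  have hev : ∀ᶠ z in 𝓝 x, z ∈ c.target ∧ φ.map (c.symm z) ∈ e.source ∧
      φ.map (c.symm z) ∈ e'.source :=
    Filter.Eventually.and (c.open_target.mem_nhds hx) ((hcont.eventually (e.open_source.mem_nhds hxe)).and
      (hcont.eventually (e'.open_source.mem_nhds hxe')))
  have hmap : φ.localMap e' c =ᶠ[𝓝 x] fun z => ψ (F z) := by
    filter_upwards [hev] with z hz
    simp only [hψdef, hFdef, localMap, e.left_inv hz.2.1]
  have hnor : φ.localNormal e' c =ᶠ[𝓝 x] fun z => fderiv ℝ ψ (F z) (V z) := by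
    filter_upwards [hev] with z hz
    exact comp_change he1 he1' hz.2.1 hz.2.2 _
  have hBB : ∀ᶠ y in 𝓝 (F x), ∀ u v, matForm (coordMetric g.form e y) u v
      = matForm (coordMetric g.form e' (ψ y)) (fderiv ℝ ψ y u) (fderiv ℝ ψ y v) := by
    have hcs : ContinuousAt e.symm (F x) := e.continuousAt_symm hFx
    filter_upwards [e.open_target.mem_nhds hFx,
      hcs.eventually (e'.open_source.mem_nhds (by rw [hsymm]; exact hxe'))] with y hy hy' u v
    exact matForm_change g.form he1 he1' hy hy' u v
  have key := form_covAlong_comp (B := fun z => matForm (coordMetric g.form e z))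
    (B' := fun z => matForm (coordMetric g.form e' z)) (hψ.of_le ENat.LEInfty.out)
    (hG'.contDiffAt_matForm.differentiableAt (by simp)) (hF.differentiableAt (by simp))
    (hV.differentiableAt (by simp)) hBB (hG.contDiffAt_matForm.differentiableAt (by simp))
    (isLeviCivitaAt_connOf hG) (isLeviCivitaAt_connOf hG') (basisVec i)
    (fderiv ℝ F x (basisVec j))
  have hd : fderiv ℝ (φ.localMap e' c) x (basisVec j) = fderiv ℝ ψ (F x) (fderiv ℝ F x (basisVec j)) := by
    rw [hmap.fderiv_eq]
    exact congrArg (fun L => L (basisVec j)) (fderiv_comp (g := ψ) x (hψ.differentiableAt (by simp))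
      (hF.differentiableAt (by simp)))
  have hcov : covAlong (connOf (coordMetric g.form e')) (φ.localMap e' c) (φ.localNormal e' c) x
      (basisVec i) = covAlong (connOf (coordMetric g.form e')) (fun z => ψ (F z))
        (fun z => fderiv ℝ ψ (F z) (V z)) x (basisVec i) := by
    unfold covAlong
    rw [hmap.fderiv_eq, hnor.fderiv_eq, hmap.eq_of_nhds, hnor.eq_of_nhds]
  unfold sffCoord secondForm
  rw [hcov, hd, ← hψF]
  exact congrArg Neg.neg key

end SpatialHypersurface

end Spacetime

/-! ### Linearity of the magnetic form, and determinants of components in a frame. -/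

section Frames

theorem isLinearMap_magForm_left (G : Coord 4 → Matrix (Fin 4) (Fin 4) ℝ) (y N v : Coord 4) :
    IsLinearMap ℝ fun u => magForm G y N u v := by
  constructor
  · intro u w
    simp only [magForm, PiLp.add_apply, mul_add, add_mul, Finset.sum_add_distrib]
  · intro c u
    simp only [magForm, PiLp.smul_apply, smul_eq_mul, Finset.mul_sum]
    exact Finset.sum_congr rfl fun _ _ => Finset.sum_congr rfl fun _ _ =>
      Finset.sum_congr rfl fun _ _ => Finset.sum_congr rfl fun _ _ => by ring

theorem isLinearMap_magForm_right (G : Coord 4 → Matrix (Fin 4) (Fin 4) ℝ) (y N u : Coord 4) :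
    IsLinearMap ℝ fun v => magForm G y N u v := by
  constructor
  · intro u w
    simp only [magForm, PiLp.add_apply, mul_add, Finset.sum_add_distrib]
  · intro c u
    simp only [magForm, PiLp.smul_apply, smul_eq_mul, Finset.mul_sum]
    exact Finset.sum_congr rfl fun _ _ => Finset.sum_congr rfl fun _ _ =>
      Finset.sum_congr rfl fun _ _ => Finset.sum_congr rfl fun _ _ => by ring

theorem inv_eq_of_orthonormal {n : ℕ} {A : Matrix (Fin n) (Fin n) ℝ} {f : Fin n → Coord n}
    (h : ∀ i j, matForm A (f i) (f j) = if i = j then 1 else 0) (l l' : Fin n) :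
    A⁻¹ l l' = ∑ m, f m l * f m l' := by
  set P : Matrix (Fin n) (Fin n) ℝ := Matrix.of fun l a => f a l with hP
  have h1 : P.transpose * A * P = 1 := by
    ext a b
    rw [Matrix.one_apply, ← h a b, matForm_apply]
    simp only [Matrix.mul_apply, Finset.sum_mul, Matrix.transpose_apply, hP, Matrix.of_apply]
    rw [Finset.sum_comm]
    exact Finset.sum_congr rfl fun i _ => Finset.sum_congr rfl fun j _ => by ring
  have h2 := mul_eq_one_comm.1 h1
  rw [← Matrix.mul_assoc] at h2
  rw [Matrix.inv_eq_left_inv h2, Matrix.mul_apply]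
  rfl

/-- The three-dimensional determinant of the components with respect to a frame of vectors. -/
theorem epsForm_combination (A : Matrix (Fin 4) (Fin 4) ℝ) (N : Coord 4) (f : Fin 3 → Coord 4)
    (u v w : Fin 3 → ℝ) :
    epsForm A N (∑ i, u i • f i) (∑ i, v i • f i) (∑ i, w i • f i)
      = (Matrix.of ![u, v, w]).det * epsForm A N (f 0) (f 1) (f 2) := by
  -- `Q` is the block matrix 1 ⊕ (u, v, w), which expresses the four vectors in terms of `N` and
  -- `f`.
  set Q : Matrix (Fin 4) (Fin 4) ℝ := Matrix.of ![Fin.cons 1 0, Fin.cons 0 u, Fin.cons 0 v,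
    Fin.cons 0 w] with hQ
  have h1 : Matrix.of ![⇑N, ⇑(∑ i, u i • f i), ⇑(∑ i, v i • f i), ⇑(∑ i, w i • f i)]
      = Q * Matrix.of ![⇑N, ⇑(f 0), ⇑(f 1), ⇑(f 2)] := by
    ext i j
    have hsum : ∀ t : Fin 4 → ℝ, ∑ a, t a
        = t 0 + (t (Fin.succ 0) + t (Fin.succ 1) + t (Fin.succ 2)) := fun t => by
      rw [Fin.sum_univ_succ, Fin.sum_univ_three]
    rw [Matrix.mul_apply, hsum]
    have h0 : ∀ i, Q i 0 = ![1, 0, 0, 0] i := by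
      intro i
      fin_cases i <;> rfl
    have hs : ∀ i (k : Fin 3), Q i k.succ = ![0, u, v, w] i k := by
      intro i k
      fin_cases i <;> rfl
    rw [h0, hs, hs, hs]
    fin_cases i <;> simp [Fin.sum_univ_three]
  have h2 : Q.det = (Matrix.of ![u, v, w]).det := by
    rw [Matrix.det_succ_row_zero, Finset.sum_eq_single 0]
    · have e0 : Q 0 0 = 1 := rfl
      rw [e0]
      simp only [Fin.val_zero, pow_zero, one_mul]
      congr 1
      ext i j
      fin_cases i <;> simp [hQ]
    · intro i _ hi
      have e0 : Q 0 i = 0 := by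
        obtain ⟨j, rfl⟩ := Fin.exists_succ_eq.2 hi
        rfl
      rw [e0]
      ring
    · simp
  rw [epsForm_eq, epsForm_eq, h1, Matrix.det_mul, h2]
  ring

end Frames

/-! ### Traces and raised indices computed in an orthonormal basis. -/

section Hypersurface

variable {n : ℕ}

theorem bilin_eq_matForm (b : Coord n →ₗ[ℝ] Coord n →ₗ[ℝ] ℝ) (u v : Coord n) :
    b u v = matForm (Matrix.of fun i j => b (basisVec i) (basisVec j)) u v := by
  conv_lhs => rw [← sum_apply_smul_basisVec u, ← sum_apply_smul_basisVec v]
  rw [matForm_apply]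
  simp only [map_sum, map_smul, LinearMap.sum_apply, LinearMap.smul_apply, smul_eq_mul,
    Finset.mul_sum, Matrix.of_apply]
  rw [Finset.sum_comm]
  exact Finset.sum_congr rfl fun i _ => Finset.sum_congr rfl fun j _ => by ring

theorem sum_inv_mul {A : Matrix (Fin n) (Fin n) ℝ} {f : Fin n → Coord n}
    (hf : ∀ i j, matForm A (f i) (f j) = if i = j then 1 else 0) {h : Coord n → Coord n → ℝ}
    (h1 : ∀ v, IsLinearMap ℝ fun u => h u v) (h2 : ∀ u, IsLinearMap ℝ fun v => h u v) :
    ∑ i, ∑ j, A⁻¹ i j * h (basisVec i) (basisVec j) = ∑ m, h (f m) (f m) := by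
  have e : ∀ m, h (f m) (f m) = ∑ i, ∑ j, f m i * f m j * h (basisVec i) (basisVec j) := by
    intro m
    refine (isLinearMap_expand (h1 (f m)) (f m)).trans (Finset.sum_congr rfl fun i _ => ?_)
    rw [isLinearMap_expand (h2 (basisVec i)) (f m), Finset.smul_sum]
    refine Finset.sum_congr rfl fun j _ => ?_
    simp only [smul_eq_mul]
    ring
  simp only [e, inv_eq_of_orthonormal hf, Finset.sum_mul]
  conv_rhs => rw [Finset.sum_comm]
  refine Finset.sum_congr rfl fun i _ => ?_
  rw [Finset.sum_comm]

theorem sum_inv_smul {A : Matrix (Fin n) (Fin n) ℝ} {f : Fin n → Coord n}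
    (hf : ∀ i j, matForm A (f i) (f j) = if i = j then 1 else 0) {h : Coord n → ℝ}
    (h1 : IsLinearMap ℝ h) :
    ∑ i, (∑ a, A⁻¹ i a * h (basisVec a)) • (basisVec i : Coord n) = ∑ m, h (f m) • f m := by
  have e : ∀ m, h (f m) = ∑ i, f m i * h (basisVec i) := fun m => isLinearMap_expand h1 (f m)
  ext l
  simp only [WithLp.ofLp_sum, Finset.sum_apply, PiLp.smul_apply, smul_eq_mul, basisVec_apply,
    mul_ite, mul_one, mul_zero, Finset.sum_ite_eq, Finset.mem_univ, if_true,
    inv_eq_of_orthonormal hf, e, Finset.sum_mul]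
  rw [Finset.sum_comm]
  exact Finset.sum_congr rfl fun i _ => Finset.sum_congr rfl fun j _ => by ring

variable {N : Type*} [TopologicalSpace N] [ChartedSpace (Coord n) N]

/-- The trace is defined by the Gram matrix in the standard basis of the tangent space, which need
not be orthonormal; this passes to a frame that is. -/
theorem trace_eq_sum (γ : BilinField n N)
    (h : ∀ p : N, TangentSpace (𝓡 n) p → TangentSpace (𝓡 n) p → ℝ) (q : N)
    (h1 : ∀ v, IsLinearMap ℝ fun u => h q u v) (h2 : ∀ u, IsLinearMap ℝ fun v => h q u v)
    {f : Fin n → TangentSpace (𝓡 n) q}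
    (hf : ∀ i j, γ q (f i) (f j) = if i = j then 1 else 0) :
    trace γ h q = ∑ m, h q (f m) (f m) :=
  sum_inv_mul (A := gram γ q) (f := f)
    (fun i j => (bilin_eq_matForm (γ q) (f i) (f j)).symm.trans (hf i j)) (h := h q) h1 h2

theorem raiseContract_eq_sum (γ : BilinField n N)
    (h : ∀ p : N, TangentSpace (𝓡 n) p → TangentSpace (𝓡 n) p → ℝ) (X : VecField n N) (q : N)
    (h1 : ∀ v, IsLinearMap ℝ fun u => h q u v) {f : Fin n → TangentSpace (𝓡 n) q}
    (hf : ∀ i j, γ q (f i) (f j) = if i = j then 1 else 0) :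
    raiseContract γ h X q = ∑ m, h q (f m) (X q) • f m :=
  sum_inv_smul (A := gram γ q) (f := f)
    (fun i j => (bilin_eq_matForm (γ q) (f i) (f j)).symm.trans (hf i j)) (h := fun u => h q u (X q))
    (h1 (X q))

end Hypersurface

/-! ### Linearity of the tensors on the hypersurface in each argument. -/

section Spacetime

variable {M : Type*} [TopologicalSpace M] [ChartedSpace (Coord 4) M] [IsManifold (𝓡 4) ∞ M]
  {g : LorentzMetric M}

namespace SpatialHypersurface

variable {S : Type*} [TopologicalSpace S] [ChartedSpace (Coord 3) S] [IsManifold (𝓡 3) ∞ S]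
  (φ : SpatialHypersurface g S) {c : OpenPartialHomeomorph S (Coord 3)} {x : Coord 3}

theorem isLinearMap_normalDeriv (e : OpenPartialHomeomorph M (Coord 4)) (q : S) (μ : Fin 4) :
    IsLinearMap ℝ fun u => φ.normalDeriv e q u μ := by
  have h1 : IsLinearMap ℝ fun u => dirDeriv (fun q' : S => comp e (φ.map q') (φ.normal q') μ) q u :=
    ⟨fun u v => map_add (mfderiv (𝓡 3) 𝓘(ℝ, ℝ) _ q) u v,
      fun a u => map_smul (mfderiv (𝓡 3) 𝓘(ℝ, ℝ) _ q) a u⟩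
  have h2 := isLinearMap_comp_push (e := e) (φ := φ) q
  constructor
  · intro u v
    simp only [normalDeriv, h1.map_add, h2.map_add, PiLp.add_apply, mul_add, add_mul,
      Finset.sum_add_distrib]
    ring
  · intro a u
    simp only [normalDeriv, h1.map_smul, h2.map_smul, PiLp.smul_apply, smul_eq_mul, mul_add,
      Finset.mul_sum]
    congr 1
    exact Finset.sum_congr rfl fun _ _ => Finset.sum_congr rfl fun _ _ => by ring

theorem isLinearMap_extrinsicCurv_left (q : S) (v : TangentSpace (𝓡 3) q) :
    IsLinearMap ℝ fun u => φ.extrinsicCurv q u v := by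
  have h1 := φ.isLinearMap_normalDeriv (chartAt (Coord 4) (φ.map q)) q
  constructor
  · intro u w
    simp only [extrinsicCurv, (h1 _).map_add, mul_add, add_mul, neg_add, Finset.sum_add_distrib]
  · intro a u
    simp only [extrinsicCurv, (h1 _).map_smul, smul_eq_mul, Finset.mul_sum]
    exact Finset.sum_congr rfl fun _ _ => Finset.sum_congr rfl fun _ _ => by ring

theorem isLinearMap_extrinsicCurv_right (q : S) (u : TangentSpace (𝓡 3) q) :
    IsLinearMap ℝ fun v => φ.extrinsicCurv q u v := by
  have h2 := isLinearMap_comp_push (e := chartAt (Coord 4) (φ.map q)) (φ := φ) q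
  constructor
  · intro v w
    simp only [extrinsicCurv, h2.map_add, PiLp.add_apply, mul_add, neg_add, Finset.sum_add_distrib]
  · intro a v
    simp only [extrinsicCurv, h2.map_smul, PiLp.smul_apply, smul_eq_mul, Finset.mul_sum]
    exact Finset.sum_congr rfl fun _ _ => Finset.sum_congr rfl fun _ _ => by ring

theorem isLinearMap_magneticPart_left (q : S) (v : TangentSpace (𝓡 3) q) :
    IsLinearMap ℝ fun u => φ.magneticPart q u v := by
  have h1 := isLinearMap_comp_push (e := chartAt (Coord 4) (φ.map q)) (φ := φ) q
  exact IsLinearMap.mk (fun u w => (congrArg (fun z => magForm _ _ _ z _) (h1.map_add u w)).trans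
    ((isLinearMap_magForm_left _ _ _ _).map_add _ _))
    (fun u w => (congrArg (fun z => magForm _ _ _ z _) (h1.map_smul u w)).trans
    ((isLinearMap_magForm_left _ _ _ _).map_smul _ _))

theorem isLinearMap_magneticPart_right (q : S) (u : TangentSpace (𝓡 3) q) :
    IsLinearMap ℝ fun v => φ.magneticPart q u v := by
  have h1 := isLinearMap_comp_push (e := chartAt (Coord 4) (φ.map q)) (φ := φ) q
  exact IsLinearMap.mk (fun u w => (congrArg (fun z => magForm _ _ _ _ z) (h1.map_add u w)).trans
    ((isLinearMap_magForm_right _ _ _ _).map_add _ _))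
    (fun u w => (congrArg (fun z => magForm _ _ _ _ z) (h1.map_smul u w)).trans
    ((isLinearMap_magForm_right _ _ _ _).map_smul _ _))

theorem isLinearMap_admMomentum_left (q : S) (v : TangentSpace (𝓡 3) q) :
    IsLinearMap ℝ fun u => φ.admMomentum q u v := by
  have h1 := φ.isLinearMap_extrinsicCurv_left q v
  constructor
  · intro u w
    simp only [admMomentum, h1.map_add, map_add, LinearMap.add_apply]
    ring
  · intro a u
    simp only [admMomentum, h1.map_smul, map_smul, LinearMap.smul_apply, smul_eq_mul]
    ring

end SpatialHypersurface

end Spacetime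

/-! ### The local identities transported to Cartesian charts of the hypersurface. -/

section Cartesian

variable {M : Type*} [TopologicalSpace M] [ChartedSpace (Coord 4) M] [IsManifold (𝓡 4) ∞ M]
  {g : LorentzMetric M}

namespace SpatialHypersurface

variable {S : Type*} [TopologicalSpace S] [ChartedSpace (Coord 3) S] [IsManifold (𝓡 3) ∞ S]
  {φ : SpatialHypersurface g S} {c : OpenPartialHomeomorph S (Coord 3)} {x : Coord 3}
  {e : OpenPartialHomeomorph M (Coord 4)}

theorem IsCartesian.orthonormal (hc : φ.IsCartesian c) (hx : x ∈ c.target) (i j : Fin 3) :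
    φ.inducedMetric (c.symm x) (frame c i x) (frame c j x) = if i = j then 1 else 0 := by
  have := congrFun (congrFun (hc.2 x hx).1 i) j
  rwa [Matrix.one_apply] at this

theorem eventually_mem_source (hx : x ∈ c.target) (hxe : φ.map (c.symm x) ∈ e.source) :
    ∀ᶠ z in 𝓝 x, z ∈ c.target ∧ φ.map (c.symm z) ∈ e.source := by
  have hcont : ContinuousAt (fun z => φ.map (c.symm z)) x :=
    φ.map_smooth.continuous.continuousAt.comp (c.continuousAt_symm hx)
  exact Filter.Eventually.and (c.open_target.mem_nhds hx)
    (hcont.eventually (e.open_source.mem_nhds hxe))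

theorem IsCartesian.isOrthonormalSlice (hc : φ.IsCartesian c) (he : e ∈ atlas (Coord 4) M)
    (hx : x ∈ c.target) (hxe : φ.map (c.symm x) ∈ e.source) :
    IsOrthonormalSlice (fun z => matForm (coordMetric g.form e z)) (connOf (coordMetric g.form e))
      (φ.localMap e c) (φ.localNormal e c) (basisVec (n := 3)) x := by
  have he1 : e ∈ IsManifold.maximalAtlas (𝓡 4) ∞ M := IsManifold.subset_maximalAtlas he
  have hG : IsMetricNear (coordMetric g.form e) (φ.localMap e c x) :=
    g.isMetricNear he (e.map_source hxe)
  have hev := eventually_mem_source hx hxe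
  refine ⟨hG.contDiffAt_matForm, hG.contDiffAt_connOf, contDiffAt_localMap he1 hc.1 hx hxe,
    contDiffAt_localNormal he1 hc.1 hx hxe, ?_, ?_, ?_, ?_⟩
  · filter_upwards [hG.eventually] with z hz using isLeviCivitaAt_connOf hz
  · filter_upwards [hev] with z hz i j
    rw [← hc.orthonormal hz.1 i j, ← comp_push_frame he1 hc.1 hz.1 hz.2,
      ← comp_push_frame he1 hc.1 hz.1 hz.2]
    exact (form_eq_matForm g.form he1 hz.2 _ _).symm
  · filter_upwards [hev] with z hz i
    rw [← comp_push_frame he1 hc.1 hz.1 hz.2]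
    exact (form_eq_matForm g.form he1 hz.2 _ _).symm.trans (φ.normal_orthogonal _ _)
  · filter_upwards [hev] with z hz
    exact (form_eq_matForm g.form he1 hz.2 _ _).symm.trans (φ.normal_unit _)

/-- The components of the extrinsic curvature in the chart `c`. -/
def curvComp (φ : SpatialHypersurface g S) (c : OpenPartialHomeomorph S (Coord 3)) (i j : Fin 3)
    (x : Coord 3) : ℝ :=
  φ.extrinsicCurv (c.symm x) (frame c i x) (frame c j x)

theorem curvComp_eventuallyEq (he : e ∈ atlas (Coord 4) M)
    (hc : c ∈ IsManifold.maximalAtlas (𝓡 3) ∞ S) (hx : x ∈ c.target)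
    (hxe : φ.map (c.symm x) ∈ e.source) (i j : Fin 3) :
    φ.curvComp c i j =ᶠ[𝓝 x]
      sffCoord (coordMetric g.form e) (φ.localMap e c) (φ.localNormal e c) i j := by
  filter_upwards [eventually_mem_source hx hxe] with z hz
  exact extrinsicCurv_frame he hc hz.1 hz.2 i j

theorem contDiffAt_curvComp (hc : c ∈ IsManifold.maximalAtlas (𝓡 3) ∞ S) (hx : x ∈ c.target)
    (i j : Fin 3) : ContDiffAt ℝ ∞ (φ.curvComp c i j) x := by
  have hxe := mem_chart_source (Coord 4) (φ.map (c.symm x))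
  have he : chartAt (Coord 4) (φ.map (c.symm x)) ∈ IsManifold.maximalAtlas (𝓡 4) ∞ M :=
    IsManifold.chart_mem_maximalAtlas _
  refine ContDiffAt.congr_of_eventuallyEq ?_
    (curvComp_eventuallyEq (chart_mem_atlas _ _) hc hx hxe i j)
  exact contDiffAt_sffCoord (g.isMetricNear (chart_mem_atlas _ _)
    ((chartAt (Coord 4) (φ.map (c.symm x))).map_source hxe))
    (contDiffAt_localMap he hc hx hxe) (contDiffAt_localNormal he hc hx hxe) i j

theorem IsCartesian.curvComp_symm (hc : φ.IsCartesian c) (hx : x ∈ c.target) (i j : Fin 3) :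
    φ.curvComp c i j x = φ.curvComp c j i x := by
  have hxe := mem_chart_source (Coord 4) (φ.map (c.symm x))
  rw [(curvComp_eventuallyEq (chart_mem_atlas _ _) hc.1 hx hxe i j).eq_of_nhds,
    (curvComp_eventuallyEq (chart_mem_atlas _ _) hc.1 hx hxe j i).eq_of_nhds]
  exact (hc.isOrthonormalSlice (chart_mem_atlas _ _) hx hxe).secondForm_symm i j

theorem IsCartesian.epsForm_eq_one (hc : φ.IsCartesian c) (hx : x ∈ c.target) :
    let e := chartAt (Coord 4) (φ.map (c.symm x))
    epsForm (coordMetric g.form e (e (φ.map (c.symm x)))) (φ.localNormal e c x)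
      (fderiv ℝ (φ.localMap e c) x (basisVec 0)) (fderiv ℝ (φ.localMap e c) x (basisVec 1))
      (fderiv ℝ (φ.localMap e c) x (basisVec 2)) = 1 := by
  have hxe := mem_chart_source (Coord 4) (φ.map (c.symm x))
  have he : chartAt (Coord 4) (φ.map (c.symm x)) ∈ IsManifold.maximalAtlas (𝓡 4) ∞ M :=
    IsManifold.chart_mem_maximalAtlas _
  intro e
  rw [← comp_push_frame he hc.1 hx hxe, ← comp_push_frame he hc.1 hx hxe,
    ← comp_push_frame he hc.1 hx hxe]
  exact (hc.2 x hx).2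

theorem IsCartesian.magneticPart_frame (hc : φ.IsCartesian c) {Λ : ℝ} (hvac : g.IsVacuum Λ)
    (hx : x ∈ c.target) (i j : Fin 3) :
    φ.magneticPart (c.symm x) (frame c i x) (frame c j x)
      = -∑ k, ∑ l, permSymbol ![i, k, l] * pd k (φ.curvComp c l j) x := by
  have hxe := mem_chart_source (Coord 4) (φ.map (c.symm x))
  have hat : chartAt (Coord 4) (φ.map (c.symm x)) ∈ atlas (Coord 4) M := chart_mem_atlas _ _
  have he : chartAt (Coord 4) (φ.map (c.symm x)) ∈ IsManifold.maximalAtlas (𝓡 4) ∞ M :=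
    IsManifold.chart_mem_maximalAtlas _
  have hG : IsMetricNear (coordMetric g.form (chartAt (Coord 4) (φ.map (c.symm x))))
      (φ.localMap (chartAt (Coord 4) (φ.map (c.symm x))) c x) :=
    g.isMetricNear hat ((chartAt (Coord 4) (φ.map (c.symm x))).map_source hxe)
  have hs : ∀ᶠ z in 𝓝 x, IsOrthonormalSlice
      (fun z => matForm (coordMetric g.form (chartAt (Coord 4) (φ.map (c.symm x))) z))
      (connOf (coordMetric g.form (chartAt (Coord 4) (φ.map (c.symm x)))))
      (φ.localMap (chartAt (Coord 4) (φ.map (c.symm x))) c)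
      (φ.localNormal (chartAt (Coord 4) (φ.map (c.symm x))) c) (basisVec (n := 3)) z := by
    filter_upwards [eventually_mem_source hx hxe] with z hz
    exact hc.isOrthonormalSlice hat hz.1 hz.2
  have key := magForm_eq_curl hG hs (ricci_eq_of_vacuum (hvac (φ.map (c.symm x))))
    (hc.epsForm_eq_one hx) i j
  rw [← comp_push_frame he hc.1 hx hxe, ← comp_push_frame he hc.1 hx hxe] at key
  refine Eq.trans key ?_
  refine congrArg Neg.neg (Finset.sum_congr rfl fun k _ => Finset.sum_congr rfl fun l _ => ?_)
  unfold pd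
  rw [(curvComp_eventuallyEq hat hc.1 hx hxe l j).fderiv_eq]

/-- The pushed-forward vectors are combinations of the coordinate frame, on which the form is
normalised to 1; `epsForm_combination` extracts the determinant. -/
theorem IsCartesian.volForm_eq (hc : φ.IsCartesian c) (hx : x ∈ c.target)
    (u v w : TangentSpace (𝓡 3) (c.symm x)) :
    φ.volForm (c.symm x) u v w
      = (Matrix.of ![⇑(comp c (c.symm x) u), ⇑(comp c (c.symm x) v), ⇑(comp c (c.symm x) w)]).det := by
  have hxe := mem_chart_source (Coord 4) (φ.map (c.symm x))
  have he : chartAt (Coord 4) (φ.map (c.symm x)) ∈ IsManifold.maximalAtlas (𝓡 4) ∞ M :=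
    IsManifold.chart_mem_maximalAtlas _
  have h1 := hc.epsForm_eq_one hx
  have hp : ∀ u, comp (chartAt (Coord 4) (φ.map (c.symm x))) (φ.map (c.symm x))
      (φ.push (c.symm x) u) = ∑ i, comp c (c.symm x) u i •
        fderiv ℝ (φ.localMap (chartAt (Coord 4) (φ.map (c.symm x))) c) x (basisVec i) := by
    intro u
    have hl := isLinearMap_comp_push (e := chartAt (Coord 4) (φ.map (c.symm x))) (φ := φ) (c.symm x)
    conv_lhs => rw [eq_sum_comp_smul_frame hc.1 hx u]
    change hl.mk' _ _ = _
    simp only [map_sum, map_smul, IsLinearMap.mk'_apply, comp_push_frame he hc.1 hx hxe]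
  have h2 := epsForm_combination (coordMetric g.form (chartAt (Coord 4) (φ.map (c.symm x)))
    (chartAt (Coord 4) (φ.map (c.symm x)) (φ.map (c.symm x))))
    (φ.localNormal (chartAt (Coord 4) (φ.map (c.symm x))) c x)
    (fun i => fderiv ℝ (φ.localMap (chartAt (Coord 4) (φ.map (c.symm x))) c) x (basisVec i))
    (comp c (c.symm x) u) (comp c (c.symm x) v) (comp c (c.symm x) w)
  rw [h1, mul_one, ← hp, ← hp, ← hp] at h2
  exact h2

/-- In an orthonormal frame the position of an index is immaterial. -/
theorem comp_raiseContract (hc : φ.IsCartesian c) (hx : x ∈ c.target)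
    {h : ∀ p : S, TangentSpace (𝓡 3) p → TangentSpace (𝓡 3) p → ℝ}
    (h1 : ∀ v, IsLinearMap ℝ fun u => h (c.symm x) u v) (X : VecField 3 S) (i : Fin 3) :
    comp c (c.symm x) (raiseContract φ.inducedMetric h X (c.symm x)) i
      = h (c.symm x) (frame c i x) (X (c.symm x)) := by
  rw [raiseContract_eq_sum φ.inducedMetric h X (c.symm x) h1 (hc.orthonormal hx)]
  change ((isLinearMap_comp (e := c) (c.symm x)).mk' _ _).ofLp i = _
  simp only [map_sum, map_smul, IsLinearMap.mk'_apply, comp_frame hc.1 hx, WithLp.ofLp_sum,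
    Finset.sum_apply, PiLp.smul_apply, basisVec_apply, smul_eq_mul, mul_ite, mul_one, mul_zero,
    Finset.sum_ite_eq, Finset.mem_univ, if_true]

/-- The components in the chart `c` of the covector `K(·, X)`. -/
def curvCovector (φ : SpatialHypersurface g S) (c : OpenPartialHomeomorph S (Coord 3))
    (X : VecField 3 S) (l : Fin 3) (x : Coord 3) : ℝ :=
  φ.extrinsicCurv (c.symm x) (frame c l x) (X (c.symm x))

/-! ### The one-form K(·, R) and the exactness of the difference of the fluxes. -/

section Generators

variable {T R : VecField 3 S} {k : Fin 3}

theorem curvCovector_eq (hx : x ∈ c.target)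
    (hR : ∀ y ∈ c.target, R (c.symm y)
      = ∑ i, ∑ j, (permSymbol ![k, i, j] * y i) • frame c j y) (l : Fin 3) :
    φ.curvCovector c R l x
      = ∑ j, φ.curvComp c l j x * ∑ i, permSymbol ![k, i, j] * x i := by
  unfold curvCovector
  have hl := φ.isLinearMap_extrinsicCurv_right (c.symm x) (frame c l x)
  rw [hR x hx]
  change hl.mk' _ _ = _
  simp only [map_sum, map_smul, IsLinearMap.mk'_apply, smul_eq_mul, Finset.mul_sum]
  rw [Finset.sum_comm]
  exact Finset.sum_congr rfl fun j _ => Finset.sum_congr rfl fun i _ => mul_comm _ _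

theorem contDiffAt_curvCovector (hc : c ∈ IsManifold.maximalAtlas (𝓡 3) ∞ S) (hx : x ∈ c.target)
    (hR : ∀ y ∈ c.target, R (c.symm y)
      = ∑ i, ∑ j, (permSymbol ![k, i, j] * y i) • frame c j y) (l : Fin 3) :
    ContDiffAt ℝ ∞ (φ.curvCovector c R l) x := by
  have h1 : φ.curvCovector c R l =ᶠ[𝓝 x]
      fun z => ∑ j, φ.curvComp c l j z * ∑ i, permSymbol ![k, i, j] * z i := by
    filter_upwards [c.open_target.mem_nhds hx] with z hz using curvCovector_eq hz hR l
  refine ContDiffAt.congr_of_eventuallyEq ?_ h1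
  exact ContDiffAt.sum fun j _ => (contDiffAt_curvComp hc hx l j).mul (ContDiffAt.sum fun i _ =>
    contDiffAt_const.mul (EuclideanSpace.proj i : Coord 3 →L[ℝ] ℝ).contDiff.contDiffAt)

/-- The components of the momentum vector `P(·, T)`. -/
theorem admMomentum_frame (hc : φ.IsCartesian c) (hx : x ∈ c.target)
    (hT : T (c.symm x) = frame c k x) (i : Fin 3) :
    φ.admMomentum (c.symm x) (frame c i x) (T (c.symm x))
      = -φ.curvComp c i k x + (∑ m, φ.curvComp c m m x) * if i = k then 1 else 0 := by
  unfold admMomentum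
  rw [trace_eq_sum φ.inducedMetric φ.extrinsicCurv (c.symm x)
    (φ.isLinearMap_extrinsicCurv_left _) (φ.isLinearMap_extrinsicCurv_right _)
    (hc.orthonormal hx), hT, hc.orthonormal hx]
  rfl

theorem magneticPart_sub_admMomentum (hc : φ.IsCartesian c) {Λ : ℝ} (hvac : g.IsVacuum Λ)
    (hx : x ∈ c.target) (hT : T (c.symm x) = frame c k x)
    (hR : ∀ y ∈ c.target, R (c.symm y)
      = ∑ i, ∑ j, (permSymbol ![k, i, j] * y i) • frame c j y) (i : Fin 3) :
    φ.magneticPart (c.symm x) (frame c i x) (R (c.symm x))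
      - φ.admMomentum (c.symm x) (frame c i x) (T (c.symm x))
      = -∑ m, ∑ l, permSymbol ![i, m, l] * pd m (φ.curvCovector c R l) x := by
  have h0 : ∀ m l, pd m (φ.curvCovector c R l) x
      = pd m (fun z => ∑ j, φ.curvComp c l j z * ∑ i, permSymbol ![k, i, j] * z i) x := by
    intro m l
    have h1 : φ.curvCovector c R l =ᶠ[𝓝 x]
        fun z => ∑ j, φ.curvComp c l j z * ∑ i, permSymbol ![k, i, j] * z i := by
      filter_upwards [c.open_target.mem_nhds hx] with z hz using curvCovector_eq hz hR l
    unfold pd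
    rw [h1.fderiv_eq]
  have h2 : φ.magneticPart (c.symm x) (frame c i x) (R (c.symm x))
      = ∑ j, φ.magneticPart (c.symm x) (frame c i x) (frame c j x)
        * ∑ p, permSymbol ![k, p, j] * x p := by
    have hl := φ.isLinearMap_magneticPart_right (c.symm x) (frame c i x)
    rw [hR x hx]
    change hl.mk' _ _ = _
    simp only [map_sum, map_smul, IsLinearMap.mk'_apply, smul_eq_mul, Finset.mul_sum]
    rw [Finset.sum_comm]
    exact Finset.sum_congr rfl fun j _ => Finset.sum_congr rfl fun i _ => mul_comm _ _
  rw [h2, admMomentum_frame hc hx hT]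
  simp only [h0]
  exact mag_sub_momentum_eq_curl (K := φ.curvComp c)
    (B := fun i j x => φ.magneticPart (c.symm x) (frame c i x) (frame c j x))
    (fun i j => (contDiffAt_curvComp hc.1 hx i j).differentiableAt (by simp))
    (hc.curvComp_symm hx) (fun i j => hc.magneticPart_frame hvac hx i j) k i

/-- The two-form of the difference of the two flux vectors is exact. -/
theorem volForm_magneticPart (hc : φ.IsCartesian c) {Λ : ℝ} (hvac : g.IsVacuum Λ)
    (hx : x ∈ c.target) (hT : T (c.symm x) = frame c k x)
    (hR : ∀ y ∈ c.target, R (c.symm y)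
      = ∑ i, ∑ j, (permSymbol ![k, i, j] * y i) • frame c j y)
    (v w : TangentSpace (𝓡 3) (c.symm x)) :
    φ.volForm (c.symm x) (raiseContract φ.inducedMetric φ.magneticPart R (c.symm x)) v w
      = φ.volForm (c.symm x) (raiseContract φ.inducedMetric φ.admMomentum T (c.symm x)) v w
        - ∑ m, ∑ l, pd m (φ.curvCovector c R l) x
          * (comp c (c.symm x) v m * comp c (c.symm x) w l
            - comp c (c.symm x) v l * comp c (c.symm x) w m) := by
  rw [hc.volForm_eq hx, hc.volForm_eq hx]
  have h1 := comp_raiseContract (X := R) hc hx (φ.isLinearMap_magneticPart_left (c.symm x))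
  have h2 := comp_raiseContract (X := T) hc hx (φ.isLinearMap_admMomentum_left (c.symm x))
  have h3 := fun i => magneticPart_sub_admMomentum hc hvac hx hT hR i
  have k0 := h3 0
  have k1 := h3 1
  have k2 := h3 2
  simp only [Fin.sum_univ_three, permSymbol_three] at k0 k1 k2
  simp at k0 k1 k2
  rw [Matrix.det_fin_three, Matrix.det_fin_three]
  simp only [Fin.sum_univ_three]
  simp [h1, h2]
  rw [sub_eq_iff_eq_add] at k0 k1 k2
  rw [k0, k1, k2]
  ring

theorem volForm_admMomentum (hc : φ.IsCartesian c) (hx : x ∈ c.target)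
    (hT : T (c.symm x) = frame c k x) (v w : TangentSpace (𝓡 3) (c.symm x)) :
    φ.volForm (c.symm x) (raiseContract φ.inducedMetric φ.admMomentum T (c.symm x)) v w
      = (Matrix.of ![fun i => -φ.curvComp c i k x
          + (∑ m, φ.curvComp c m m x) * if i = k then 1 else 0,
        ⇑(comp c (c.symm x) v), ⇑(comp c (c.symm x) w)]).det := by
  rw [hc.volForm_eq hx]
  have h2 := comp_raiseContract (X := T) hc hx (φ.isLinearMap_admMomentum_left (c.symm x))
  have h3 : (comp c (c.symm x) (raiseContract φ.inducedMetric φ.admMomentum T (c.symm x))).ofLp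
      = fun i => -φ.curvComp c i k x + (∑ m, φ.curvComp c m m x) * if i = k then 1 else 0 := by
    ext i
    rw [h2, admMomentum_frame hc hx hT]
  rw [h3]

end Generators

end SpatialHypersurface

end Cartesian

/-! ### Integrals over open sets of functions vanishing off a compact subset. -/

section CompactSupport

open MeasureTheory

variable {n : ℕ} {U K : Set (Coord n)}

theorem integrableOn_of_zero_off_compact (hU : IsOpen U) (hK : IsCompact K) (hKU : K ⊆ U)
    {f : Coord n → ℝ} (hf : ContinuousOn f U) (h0 : ∀ y ∈ U, y ∉ K → f y = 0) :
    IntegrableOn f U :=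
  ((hf.mono hKU).integrableOn_compact hK).of_forall_sdiff_eq_zero hU.measurableSet
    fun y hy => h0 y hy.1 hy.2

/-- A partial derivative of a compactly supported function integrates to zero. -/
theorem setIntegral_pd_eq_zero (hU : IsOpen U) (hK : IsCompact K) (hKU : K ⊆ U)
    {f : Coord n → ℝ} (hf : ∀ y ∈ U, ContDiffAt ℝ 1 f y) (h0 : ∀ y ∈ U, y ∉ K → f y = 0)
    (i : Fin n) : IntegrableOn (pd i f) U ∧ ∫ y in U, pd i f y = 0 := by
  -- Extension by zero is C¹ on the whole space, because `U` and the complement of `K` are open and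
  -- cover it.
  set F : Coord n → ℝ := U.indicator f with hF
  have hin : ∀ y ∈ U, F =ᶠ[𝓝 y] f := fun y hy => by
    filter_upwards [hU.mem_nhds hy] with z hz using Set.indicator_of_mem hz f
  have hout : ∀ y ∉ K, F =ᶠ[𝓝 y] fun _ => 0 := fun y hy => by
    filter_upwards [hK.isClosed.isOpen_compl.mem_nhds hy] with z hz
    by_cases hzU : z ∈ U
    · rw [hF, Set.indicator_of_mem hzU, h0 z hzU hz]
    · rw [hF, Set.indicator_of_notMem hzU]
  have hsm : ContDiff ℝ 1 F := by
    rw [contDiff_iff_contDiffAt]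
    intro y
    by_cases hy : y ∈ U
    · exact (hf y hy).congr_of_eventuallyEq (hin y hy)
    · exact contDiffAt_const.congr_of_eventuallyEq (hout y fun h => hy (hKU h))
  have hcs : HasCompactSupport F := HasCompactSupport.intro hK fun y hy => (hout y hy).eq_of_nhds
  have hpd : ∀ y ∈ U, pd i f y = pd i F y := fun y hy => by
    unfold pd
    rw [(hin y hy).fderiv_eq]
  have hcont : Continuous (pd i F) := by
    unfold pd
    exact (hsm.continuous_fderiv (by norm_num)).clm_apply continuous_const
  have hcs' : HasCompactSupport (pd i F) := HasCompactSupport.intro hK fun y hy => by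
    unfold pd
    rw [(hout y hy).fderiv_eq]
    simp
  have hint : Integrable (pd i F) := hcont.integrable_of_hasCompactSupport hcs'
  refine ⟨hint.integrableOn.congr_fun (fun y hy => (hpd y hy).symm) hU.measurableSet, ?_⟩
  rw [setIntegral_congr_fun hU.measurableSet hpd, setIntegral_eq_integral_of_forall_compl_eq_zero]
  · have := integral_mul_fderiv_eq_neg_fderiv_mul_of_integrable (𝕜 := ℝ) (μ := volume)
      (f := fun _ : Coord n => (1 : ℝ)) (g := F) (v := basisVec i) (by simp)
      (by simp only [one_mul]; exact hint)
      (by simpa using hsm.continuous.integrable_of_hasCompactSupport hcs)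
      (fun x _ => differentiableAt_const _) (fun x _ => hsm.differentiable (by norm_num) x)
    simpa [pd] using this
  · intro y hy
    unfold pd
    rw [(hout y fun h => hy (hKU h)).fderiv_eq]
    simp

end CompactSupport

/-! ### Integration of two-forms in charts. -/

section TwoForms

open MeasureTheory

variable {A : Type*} [TopologicalSpace A] [ChartedSpace (Coord 2) A] [IsManifold (𝓡 2) ∞ A]

/-- The integral of a two-form over the domain of a chart. -/
def chartIntegral (β : ∀ p : A, TangentSpace (𝓡 2) p → TangentSpace (𝓡 2) p → ℝ)
    (e : OpenPartialHomeomorph A (Coord 2)) : ℝ :=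
  ∫ y in e.target, β (e.symm y) (frame e 0 y) (frame e 1 y)

theorem twoForm_expand {β : ∀ p : A, TangentSpace (𝓡 2) p → TangentSpace (𝓡 2) p → ℝ}
    (hl : ∀ p v, IsLinearMap ℝ fun u => β p u v) (hs : ∀ p u v, β p u v = -β p v u)
    {e : OpenPartialHomeomorph A (Coord 2)} (he : e ∈ IsManifold.maximalAtlas (𝓡 2) ∞ A) {p : A}
    (hp : p ∈ e.source) (u v : TangentSpace (𝓡 2) p) :
    β p u v = (comp e p u 0 * comp e p v 1 - comp e p u 1 * comp e p v 0)
      * β (e.symm (e p)) (frame e 0 (e p)) (frame e 1 (e p)) := by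
  obtain ⟨y, hy, rfl⟩ : ∃ y ∈ e.target, e.symm y = p := ⟨e p, e.map_source hp, e.left_inv hp⟩
  rw [e.right_inv hy]
  have h1 : ∀ u v, β (e.symm y) u v = ∑ i, comp e (e.symm y) u i * β (e.symm y) (frame e i y) v := by
    intro u v
    conv_lhs => rw [eq_sum_comp_smul_frame he hy u]
    change (hl (e.symm y) v).mk' _ _ = _
    simp only [map_sum, map_smul, IsLinearMap.mk'_apply, smul_eq_mul]
  rw [h1 u v, Fin.sum_univ_two, hs _ (frame e 0 y) v, hs _ (frame e 1 y) v, h1 v, h1 v,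
    Fin.sum_univ_two, Fin.sum_univ_two]
  have h00 := hs _ (frame e 0 y) (frame e 0 y)
  have h11 := hs _ (frame e 1 y) (frame e 1 y)
  have h10 := hs _ (frame e 1 y) (frame e 0 y)
  have k0 : β (e.symm y) (frame e 0 y) (frame e 0 y) = 0 := by linarith
  have k1 : β (e.symm y) (frame e 1 y) (frame e 1 y) = 0 := by linarith
  rw [k0, k1, h10]
  ring

theorem det_clm_two (L : Coord 2 →L[ℝ] Coord 2) :
    L.det = L (basisVec 0) 0 * L (basisVec 1) 1 - L (basisVec 0) 1 * L (basisVec 1) 0 := by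
  have h := LinearMap.det_toMatrix (EuclideanSpace.basisFun (Fin 2) ℝ).toBasis (L : Coord 2 →ₗ[ℝ] Coord 2)
  rw [Matrix.det_fin_two] at h
  simp [LinearMap.toMatrix_apply] at h
  rw [ContinuousLinearMap.det, ← h]
  simp only [basisVec]
  ring

/-- Vanishing off either chart domain reduces both integrals to the overlap. There the change of
variables brings in the absolute Jacobian, the form brings in the Jacobian itself, and the
orientation makes them equal. -/
theorem chartIntegral_eq (hA : IsOrientedAtlas 2 A)
    {β : ∀ p : A, TangentSpace (𝓡 2) p → TangentSpace (𝓡 2) p → ℝ}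
    (hl : ∀ p v, IsLinearMap ℝ fun u => β p u v) (hs : ∀ p u v, β p u v = -β p v u)
    {e e' : OpenPartialHomeomorph A (Coord 2)} (he : e ∈ atlas (Coord 2) A)
    (he' : e' ∈ atlas (Coord 2) A) (h0 : ∀ p, p ∉ e.source → ∀ u v, β p u v = 0)
    (h0' : ∀ p, p ∉ e'.source → ∀ u v, β p u v = 0) :
    chartIntegral β e = chartIntegral β e' := by
  have he1 : e ∈ IsManifold.maximalAtlas (𝓡 2) ∞ A := IsManifold.subset_maximalAtlas he
  have he1' : e' ∈ IsManifold.maximalAtlas (𝓡 2) ∞ A := IsManifold.subset_maximalAtlas he'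
  set τ := e.symm.trans e' with hτ
  have hsub : τ.source ⊆ e.target := fun y hy => hy.1
  have hsub' : τ.target ⊆ e'.target := fun y hy => hy.1
  have hmem : ∀ y, y ∈ τ.source ↔ y ∈ e.target ∧ e.symm y ∈ e'.source := fun y => Iff.rfl
  have hmem' : ∀ y, y ∈ τ.target ↔ y ∈ e'.target ∧ e'.symm y ∈ e.source := fun y => Iff.rfl
  unfold chartIntegral
  rw [setIntegral_eq_of_subset_of_forall_sdiff_eq_zero e.open_target.measurableSet hsub
      fun y hy => h0' _ (fun h => hy.2 ((hmem y).2 ⟨hy.1, h⟩)) _ _,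
    setIntegral_eq_of_subset_of_forall_sdiff_eq_zero e'.open_target.measurableSet hsub'
      fun y hy => h0 _ (fun h => hy.2 ((hmem' y).2 ⟨hy.1, h⟩)) _ _,
    ← τ.image_source_eq_target]
  have hτd : ∀ y ∈ τ.source, ContDiffAt ℝ ∞ τ y := fun y hy =>
    contDiffAt_transition he1 he1' hy.1 hy.2
  rw [integral_image_eq_integral_abs_det_fderiv_smul volume τ.open_source.measurableSet
    (fun y hy => ((hτd y hy).differentiableAt (by simp)).hasFDerivAt.hasFDerivWithinAt) τ.injOn]
  refine setIntegral_congr_fun τ.open_source.measurableSet fun y hy => ?_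
  have hpos := hA e he e' he' y hy
  rw [abs_of_pos hpos, twoForm_expand hl hs he1' ((hmem y).1 hy).2,
    comp_change he1 he1' (e.map_target hy.1) hy.2, comp_change he1 he1' (e.map_target hy.1) hy.2,
    comp_frame he1 hy.1, comp_frame he1 hy.1, e.right_inv hy.1, det_clm_two]
  rfl

/-! ### Stokes' theorem on a closed oriented surface by a partition of unity. -/

section Stokes

variable [CompactSpace A] [T2Space A]

variable (A) in
theorem unityPartition_isSubordinate :
    (unityPartition A).IsSubordinate fun x => (chartAt (Coord 2) x).source :=
  (SmoothPartitionOfUnity.exists_isSubordinate_chartAt_source (𝓡 2) A).choose_spec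

variable (A) in
theorem finite_support_unityPartition :
    {a : A | (Function.support (unityPartition A a)).Nonempty}.Finite :=
  (unityPartition A).locallyFinite'.finite_nonempty_of_compact

theorem unityPartition_eq_zero {a : A} {e : OpenPartialHomeomorph A (Coord 2)} {y : Coord 2}
    (hy : y ∈ e.target) (hK : y ∉ e '' tsupport (unityPartition A a)) :
    e.symm y ∉ tsupport (unityPartition A a) :=
  fun h => hK ⟨e.symm y, h, e.right_inv hy⟩

variable (A) in
theorem isCompact_image_tsupport (a : A) :
    IsCompact (chartAt (Coord 2) a '' tsupport (unityPartition A a)) :=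
  (isClosed_tsupport _).isCompact.image_of_continuousOn
    ((chartAt (Coord 2) a).continuousOn.mono (unityPartition_isSubordinate A a))

variable (A) in
theorem image_tsupport_subset (a : A) :
    chartAt (Coord 2) a '' tsupport (unityPartition A a) ⊆ (chartAt (Coord 2) a).target := by
  rintro _ ⟨p, hp, rfl⟩
  exact (chartAt (Coord 2) a).map_source (unityPartition_isSubordinate A a hp)

variable {e : OpenPartialHomeomorph A (Coord 2)} {y : Coord 2}

theorem contDiffAt_comp_symm (he : e ∈ IsManifold.maximalAtlas (𝓡 2) ∞ A) (hy : y ∈ e.target)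
    (a : A) : ContDiffAt ℝ ∞ (fun z => unityPartition A a (e.symm z)) y := by
  rw [← contMDiffAt_iff_contDiffAt]
  exact (unityPartition A a).contMDiff.contMDiffAt.comp y
    ((contMDiffOn_symm_of_mem_maximalAtlas he).contMDiffAt (e.open_target.mem_nhds hy))

theorem dirDeriv_unityPartition (he : e ∈ IsManifold.maximalAtlas (𝓡 2) ∞ A) (hy : y ∈ e.target)
    (a : A) (i : Fin 2) : dirDeriv (unityPartition A a) (e.symm y) (frame e i y)
      = pd i (fun z => unityPartition A a (e.symm z)) y := by
  have h1 : MDifferentiableAt (𝓡 2) (𝓡 2) e.symm y :=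
    (mdifferentiable_of_mem_maximalAtlas he).mdifferentiableAt_symm hy
  have h2 : MDifferentiableAt (𝓡 2) 𝓘(ℝ, ℝ) (unityPartition A a) (e.symm y) :=
    (unityPartition A a).contMDiff.mdifferentiableAt (by simp)
  have h4 := mfderiv_comp y h2 h1
  unfold pd
  rw [← mfderiv_eq_fderiv]
  exact (congrArg (fun L => L (basisVec i)) h4).symm

/-- The components of a one-form in the chart `e`. -/
def formComp (η : ∀ p : A, TangentSpace (𝓡 2) p → ℝ) (e : OpenPartialHomeomorph A (Coord 2))
    (i : Fin 2) (y : Coord 2) : ℝ :=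
  η (e.symm y) (frame e i y)

/-- The two-form `dρ_a ∧ η`. -/
def cutoffWedge (η : ∀ p : A, TangentSpace (𝓡 2) p → ℝ) (a p : A)
    (u v : TangentSpace (𝓡 2) p) : ℝ :=
  dirDeriv (unityPartition A a) p u * η p v - dirDeriv (unityPartition A a) p v * η p u

theorem isLinearMap_dirDeriv (f : A → ℝ) (p : A) : IsLinearMap ℝ fun u : TangentSpace (𝓡 2) p => dirDeriv f p u :=
  ⟨fun u v => map_add (mfderiv (𝓡 2) 𝓘(ℝ, ℝ) f p) u v,
    fun a u => map_smul (mfderiv (𝓡 2) 𝓘(ℝ, ℝ) f p) a u⟩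

theorem cutoffWedge_eq_zero (η : ∀ p : A, TangentSpace (𝓡 2) p → ℝ) {a p : A}
    (hp : p ∉ tsupport (unityPartition A a)) (u v : TangentSpace (𝓡 2) p) :
    cutoffWedge η a p u v = 0 := by
  have h1 : (unityPartition A a : A → ℝ) =ᶠ[𝓝 p] fun _ => 0 := notMem_tsupport_iff_eventuallyEq.1 hp
  have h2 : ∀ u, dirDeriv (unityPartition A a) p u = 0 := fun u => by
    have h3 := h1.mfderiv_eq (I := 𝓡 2) (I' := 𝓘(ℝ, ℝ))
    refine (congrArg (fun L : TangentSpace (𝓡 2) p →L[ℝ] ℝ => L u) h3).trans ?_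
    rw [mfderiv_const]
    rfl
  unfold cutoffWedge
  rw [h2, h2]
  ring

theorem cutoffWedge_frame (η : ∀ p : A, TangentSpace (𝓡 2) p → ℝ)
    (he : e ∈ IsManifold.maximalAtlas (𝓡 2) ∞ A) (hy : y ∈ e.target) (a : A) :
    cutoffWedge η a (e.symm y) (frame e 0 y) (frame e 1 y)
      = pd 0 (fun z => unityPartition A a (e.symm z)) y * formComp η e 1 y
        - pd 1 (fun z => unityPartition A a (e.symm z)) y * formComp η e 0 y := by
  unfold cutoffWedge
  rw [dirDeriv_unityPartition he hy, dirDeriv_unityPartition he hy]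
  rfl

theorem continuousOn_cutoffWedge {η : ∀ p : A, TangentSpace (𝓡 2) p → ℝ}
    (he : e ∈ IsManifold.maximalAtlas (𝓡 2) ∞ A)
    (hη : ∀ i, ∀ y ∈ e.target, ContDiffAt ℝ 1 (formComp η e i) y) (a : A) :
    ContinuousOn (fun y => cutoffWedge η a (e.symm y) (frame e 0 y) (frame e 1 y)) e.target := by
  have h1 : ∀ i, ContinuousOn (pd i fun z => unityPartition A a (e.symm z)) e.target := by
    intro i y hy
    have := (contDiffAt_comp_symm he hy a).fderiv_right (m := ∞) (by simp)
    exact (this.clm_apply contDiffAt_const).continuousAt.continuousWithinAt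
  have h2 : ∀ i, ContinuousOn (formComp η e i) e.target := fun i y hy =>
    (hη i y hy).continuousAt.continuousWithinAt
  exact (((h1 0).mul (h2 1)).sub ((h1 1).mul (h2 0))).congr fun y hy => cutoffWedge_frame η he hy a

theorem pd_mul {n : ℕ} {f h : Coord n → ℝ} {y : Coord n} (hf : DifferentiableAt ℝ f y)
    (hh : DifferentiableAt ℝ h y) (i : Fin n) :
    pd i (fun z => f z * h z) y = f y * pd i h y + pd i f y * h y := by
  unfold pd
  rw [fderiv_fun_mul hf hh]
  simp [mul_comm]

/-- Write ρ dη = d(ρη) - dρ ∧ η; the exact term has compact support in the chart and integrates to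
zero. -/
theorem setIntegral_cutoff_mul_curl {η : ∀ p : A, TangentSpace (𝓡 2) p → ℝ} (a : A)
    (hη : ∀ i, ∀ y ∈ (chartAt (Coord 2) a).target,
      ContDiffAt ℝ 1 (formComp η (chartAt (Coord 2) a) i) y) :
    ∫ y in (chartAt (Coord 2) a).target, unityPartition A a ((chartAt (Coord 2) a).symm y) *
      (pd 0 (formComp η (chartAt (Coord 2) a) 1) y - pd 1 (formComp η (chartAt (Coord 2) a) 0) y)
      = -chartIntegral (cutoffWedge η a) (chartAt (Coord 2) a) := by
  have he : chartAt (Coord 2) a ∈ IsManifold.maximalAtlas (𝓡 2) ∞ A :=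
    IsManifold.chart_mem_maximalAtlas _
  have hK := isCompact_image_tsupport A a
  have hKU := image_tsupport_subset A a
  set e := chartAt (Coord 2) a with hedef
  set r : Coord 2 → ℝ := fun z => unityPartition A a (e.symm z) with hr
  have hr0 : ∀ y ∈ e.target, y ∉ e '' tsupport (unityPartition A a) → r y = 0 := fun y hy hyK =>
    image_eq_zero_of_notMem_tsupport (f := unityPartition A a) (unityPartition_eq_zero hy hyK)
  have hsm : ∀ i, ∀ y ∈ e.target, ContDiffAt ℝ 1 (fun z => r z * formComp η e i z) y :=
    fun i y hy => ((contDiffAt_comp_symm he hy a).of_le ENat.LEInfty.out).mul (hη i y hy)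
  have hz : ∀ i, ∀ y ∈ e.target, y ∉ e '' tsupport (unityPartition A a) →
      r y * formComp η e i y = 0 := fun i y hy hyK => by rw [hr0 y hy hyK, zero_mul]
  obtain ⟨i0, z0⟩ := setIntegral_pd_eq_zero e.open_target hK hKU (hsm 1) (hz 1) 0
  obtain ⟨i1, z1⟩ := setIntegral_pd_eq_zero e.open_target hK hKU (hsm 0) (hz 0) 1
  have iw : IntegrableOn (fun y => cutoffWedge η a (e.symm y) (frame e 0 y) (frame e 1 y))
      e.target := integrableOn_of_zero_off_compact e.open_target hK hKU
        (continuousOn_cutoffWedge he hη a)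
        fun y hy hyK => cutoffWedge_eq_zero η (unityPartition_eq_zero hy hyK) _ _
  have hsplit : ∀ y ∈ e.target, r y * (pd 0 (formComp η e 1) y - pd 1 (formComp η e 0) y)
      = pd 0 (fun z => r z * formComp η e 1 z) y - pd 1 (fun z => r z * formComp η e 0 z) y
        - cutoffWedge η a (e.symm y) (frame e 0 y) (frame e 1 y) := by
    intro y hy
    have hrd : DifferentiableAt ℝ r y := (contDiffAt_comp_symm he hy a).differentiableAt (by simp)
    rw [pd_mul hrd ((hη 1 y hy).differentiableAt (by norm_num)),
      pd_mul hrd ((hη 0 y hy).differentiableAt (by norm_num)), cutoffWedge_frame η he hy]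
    ring
  rw [setIntegral_congr_fun e.open_target.measurableSet hsplit]
  have h01 : IntegrableOn (fun y => pd 0 (fun z => r z * formComp η e 1 z) y
      - pd 1 (fun z => r z * formComp η e 0 z) y) e.target := i0.sub i1
  rw [integral_sub h01 iw, integral_sub i0 i1, z0, z1]
  unfold chartIntegral
  ring

/-- Stokes' theorem on a closed oriented surface. -/
theorem finsum_setIntegral_curl_eq_zero (hA : IsOrientedAtlas 2 A)
    {η : ∀ p : A, TangentSpace (𝓡 2) p → ℝ} (hl : ∀ p, IsLinearMap ℝ fun u => η p u)
    (hη : ∀ a i, ∀ y ∈ (chartAt (Coord 2) a).target,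
      ContDiffAt ℝ 1 (formComp η (chartAt (Coord 2) a) i) y) :
    ∑ᶠ a : A, ∫ y in (chartAt (Coord 2) a).target,
      unityPartition A a ((chartAt (Coord 2) a).symm y) *
      (pd 0 (formComp η (chartAt (Coord 2) a) 1) y - pd 1 (formComp η (chartAt (Coord 2) a) 0) y)
      = 0 := by
  classical
  have hmax : ∀ a : A, chartAt (Coord 2) a ∈ IsManifold.maximalAtlas (𝓡 2) ∞ A := fun a =>
    IsManifold.chart_mem_maximalAtlas _
  set s := (finite_support_unityPartition A).toFinset with hs
  have hs0 : ∀ a ∉ s, ∀ p, unityPartition A a p = 0 := by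
    intro a ha p
    by_contra h
    exact ha ((finite_support_unityPartition A).mem_toFinset.2 ⟨p, h⟩)
  have hsum : ∀ p : A, ∑ a ∈ s, unityPartition A a p = 1 := by
    intro p
    rw [← (unityPartition A).sum_eq_one (Set.mem_univ p)]
    refine (finsum_eq_sum_of_support_subset _ fun a ha => ?_).symm
    by_contra h
    exact ha (hs0 a h p)
  rw [finsum_eq_sum_of_support_subset (s := s)]
  swap
  · intro a ha
    by_contra h
    refine ha ?_
    simp [hs0 a h]
  simp only [fun a => setIntegral_cutoff_mul_curl a (hη a), Finset.sum_neg_distrib, neg_eq_zero]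
  -- A second partition of unity factor: ρ_b dρ_a ∧ η is supported in both the chart of `a` and the
  -- chart of `b`, so it may be integrated in either. Summing over `b` recovers dρ_a ∧ η.
  set β : A → A → ∀ p : A, TangentSpace (𝓡 2) p → TangentSpace (𝓡 2) p → ℝ :=
    fun b a p u v => unityPartition A b p * cutoffWedge η a p u v with hβ
  have hw : ∀ a p v, IsLinearMap ℝ fun u => cutoffWedge η a p u v := by
    intro a p v
    have h1 := isLinearMap_dirDeriv (unityPartition A a) p
    constructor
    · intro u w
      simp only [cutoffWedge, h1.map_add, (hl p).map_add]
      ring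
    · intro t u
      simp only [cutoffWedge, h1.map_smul, (hl p).map_smul, smul_eq_mul]
      ring
  have hchange : ∀ a b, chartIntegral (β b a) (chartAt (Coord 2) a)
      = chartIntegral (β b a) (chartAt (Coord 2) b) := by
    intro a b
    refine chartIntegral_eq hA (fun p v => ?_) (fun p u v => ?_) (chart_mem_atlas _ _)
      (chart_mem_atlas _ _) (fun p hp u v => ?_) (fun p hp u v => ?_)
    · constructor
      · intro u w
        simp only [hβ, (hw a p v).map_add, mul_add]
      · intro t u
        simp only [hβ, (hw a p v).map_smul, smul_eq_mul]
        ring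
    · simp only [hβ, cutoffWedge]
      ring
    · simp only [hβ]
      rw [cutoffWedge_eq_zero η fun h => hp (unityPartition_isSubordinate A a h), mul_zero]
    · simp only [hβ]
      rw [image_eq_zero_of_notMem_tsupport fun h => hp (unityPartition_isSubordinate A b h),
        zero_mul]
  have hcont : ∀ a b c, ContinuousOn (fun y => β b a ((chartAt (Coord 2) c).symm y)
      (frame (chartAt (Coord 2) c) 0 y) (frame (chartAt (Coord 2) c) 1 y))
      (chartAt (Coord 2) c).target := fun a b c =>
    ContinuousOn.mul (fun y hy => (contDiffAt_comp_symm (hmax c) hy b).continuousAt.continuousWithinAt)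
      (continuousOn_cutoffWedge (hmax c) (hη c) a)
  have e1 : ∀ a, chartIntegral (cutoffWedge η a) (chartAt (Coord 2) a)
      = ∑ b ∈ s, chartIntegral (β b a) (chartAt (Coord 2) a) := by
    intro a
    unfold chartIntegral
    rw [← integral_finsetSum]
    · refine setIntegral_congr_fun (chartAt (Coord 2) a).open_target.measurableSet fun y _ => ?_
      simp only [hβ, ← Finset.sum_mul, hsum, one_mul]
    · intro b _
      refine integrableOn_of_zero_off_compact (chartAt (Coord 2) a).open_target
        (isCompact_image_tsupport A a) (image_tsupport_subset A a) (hcont a b a) fun y hy hyK => ?_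
      simp only [hβ]
      rw [cutoffWedge_eq_zero η (unityPartition_eq_zero hy hyK), mul_zero]
  -- With the chart of `b` fixed, the sum over `a` contains d(∑ ρ_a) = d1 = 0.
  have e2 : ∀ b, ∑ a ∈ s, chartIntegral (β b a) (chartAt (Coord 2) b) = 0 := by
    intro b
    unfold chartIntegral
    rw [← integral_finsetSum]
    · refine (setIntegral_congr_fun (g := fun _ => (0 : ℝ))
        (chartAt (Coord 2) b).open_target.measurableSet fun y hy => ?_).trans (by simp)
      have hd : ∀ i, ∑ a ∈ s, pd i (fun z => unityPartition A a ((chartAt (Coord 2) b).symm z)) y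
          = 0 := by
        intro i
        have h1 : fderiv ℝ (fun z => ∑ a ∈ s,
            unityPartition A a ((chartAt (Coord 2) b).symm z)) y = 0 := by
          simp only [hsum]
          exact fderiv_const_apply _
        rw [fderiv_fun_sum fun a _ =>
          (contDiffAt_comp_symm (hmax b) hy a).differentiableAt (by simp)] at h1
        have h2 := congrArg (fun L => L (basisVec i)) h1
        simpa [pd] using h2
      simp only [hβ, cutoffWedge_frame η (hmax b) hy, ← Finset.mul_sum, Finset.sum_sub_distrib,
        ← Finset.sum_mul, hd, zero_mul, sub_zero, mul_zero]
    · intro a _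
      refine integrableOn_of_zero_off_compact (chartAt (Coord 2) b).open_target
        (isCompact_image_tsupport A b) (image_tsupport_subset A b) (hcont a b b) fun y hy hyK => ?_
      simp only [hβ]
      rw [image_eq_zero_of_notMem_tsupport (unityPartition_eq_zero hy hyK), zero_mul]
  rw [Finset.sum_congr rfl fun a _ => (e1 a).trans (Finset.sum_congr rfl fun b _ => hchange a b),
    Finset.sum_comm]
  exact Finset.sum_eq_zero fun b _ => e2 b

end Stokes

end TwoForms

/-- The exterior derivative of a pulled back one-form. -/
theorem curl_pullback {θ : Fin 3 → Coord 3 → ℝ} {H : Coord 2 → Coord 3} {y : Coord 2}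
    (hH : ContDiffAt ℝ 2 H y) (hθ : ∀ l, DifferentiableAt ℝ (θ l) (H y)) (i j : Fin 2) :
    pd i (fun z => ∑ l, fderiv ℝ H z (basisVec j) l * θ l (H z)) y
      - pd j (fun z => ∑ l, fderiv ℝ H z (basisVec i) l * θ l (H z)) y
      = ∑ m, ∑ l, pd m (θ l) (H y) *
        (fderiv ℝ H y (basisVec i) m * fderiv ℝ H y (basisVec j) l
          - fderiv ℝ H y (basisVec i) l * fderiv ℝ H y (basisVec j) m) := by
  have hH1 : DifferentiableAt ℝ (fderiv ℝ H) y :=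
    (hH.fderiv_right (m := 1) (by norm_num)).differentiableAt (by norm_num)
  have hH0 : DifferentiableAt ℝ H y := hH.differentiableAt (by norm_num)
  have hd : ∀ j : Fin 2, DifferentiableAt ℝ (fun z => fderiv ℝ H z (basisVec j)) y := fun j =>
    hH1.clm_apply (differentiableAt_const _)
  have hdl : ∀ (j : Fin 2) (l : Fin 3), HasFDerivAt (fun z => fderiv ℝ H z (basisVec j) l)
      ((EuclideanSpace.proj l : Coord 3 →L[ℝ] ℝ).comp
        (fderiv ℝ (fun z => fderiv ℝ H z (basisVec j)) y)) y := fun j l =>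
    (EuclideanSpace.proj l : Coord 3 →L[ℝ] ℝ).hasFDerivAt.comp y (hd j).hasFDerivAt
  have hθl : ∀ l, HasFDerivAt (fun z => θ l (H z)) ((fderiv ℝ (θ l) (H y)).comp (fderiv ℝ H y)) y :=
    fun l => (hθ l).hasFDerivAt.comp y hH0.hasFDerivAt
  have hexp : ∀ l (v : Coord 3), fderiv ℝ (θ l) (H y) v = ∑ m, v m * pd m (θ l) (H y) := fun l v =>
    isLinearMap_expand ⟨map_add _, map_smul _⟩ v
  have key : ∀ i j : Fin 2, pd i (fun z => ∑ l, fderiv ℝ H z (basisVec j) l * θ l (H z)) y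
      = ∑ l, (fderiv ℝ H y (basisVec j) l * ∑ m, fderiv ℝ H y (basisVec i) m * pd m (θ l) (H y)
        + θ l (H y) * fderiv ℝ (fun z => fderiv ℝ H z (basisVec j)) y (basisVec i) l) := by
    intro i j
    change fderiv ℝ _ y (basisVec i) = _
    rw [(HasFDerivAt.fun_sum fun l _ => (hdl j l).fun_mul (hθl l)).fderiv]
    simp only [← hexp]
    simp
  rw [key, key, fderiv_fderiv_apply_comm hH (basisVec i) (basisVec j)]
  simp only [Fin.sum_univ_three]
  ring

/-! ### Pulling the identity back to the surface and comparing the fluxes. -/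

section Surface

variable {M : Type*} [TopologicalSpace M] [ChartedSpace (Coord 4) M] [IsManifold (𝓡 4) ∞ M]
  {g : LorentzMetric M} {S : Type*} [TopologicalSpace S] [ChartedSpace (Coord 3) S]
  [IsManifold (𝓡 3) ∞ S] {φ : SpatialHypersurface g S}
  {c : OpenPartialHomeomorph S (Coord 3)}
  {A : Type*} [TopologicalSpace A] [ChartedSpace (Coord 2) A] [IsManifold (𝓡 2) ∞ A]
  {ι : A → S} {e : OpenPartialHomeomorph A (Coord 2)} {y : Coord 2}

theorem extrinsicCurv_eq_sum {q : S} {X : VecField 3 S}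
    (hc : c ∈ IsManifold.maximalAtlas (𝓡 3) ∞ S) (hq : q ∈ c.source) (u : TangentSpace (𝓡 3) q) :
    φ.extrinsicCurv q u (X q) = ∑ l, comp c q u l * φ.curvCovector c X l (c q) := by
  obtain ⟨x, hx, rfl⟩ : ∃ x ∈ c.target, c.symm x = q := ⟨c q, c.map_source hq, c.left_inv hq⟩
  rw [c.right_inv hx]
  conv_lhs => rw [eq_sum_comp_smul_frame hc hx u]
  change (φ.isLinearMap_extrinsicCurv_left (c.symm x) (X (c.symm x))).mk' _ _ = _
  simp only [map_sum, map_smul, IsLinearMap.mk'_apply, smul_eq_mul]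
  rfl

/-- The map `ι` in the charts `e` and `c`. -/
def surfaceMap (ι : A → S) (e : OpenPartialHomeomorph A (Coord 2))
    (c : OpenPartialHomeomorph S (Coord 3)) (y : Coord 2) : Coord 3 :=
  c (ι (e.symm y))

theorem contDiffAt_surfaceMap (hι : ContMDiff (𝓡 2) (𝓡 3) ∞ ι)
    (he : e ∈ IsManifold.maximalAtlas (𝓡 2) ∞ A) (hc : c ∈ IsManifold.maximalAtlas (𝓡 3) ∞ S)
    (hy : y ∈ e.target) (hyc : ι (e.symm y) ∈ c.source) :
    ContDiffAt ℝ ∞ (surfaceMap ι e c) y := by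
  rw [← contMDiffAt_iff_contDiffAt]
  have h1 : ContMDiffAt (𝓡 2) (𝓡 2) ∞ e.symm y :=
    (contMDiffOn_symm_of_mem_maximalAtlas he).contMDiffAt (e.open_target.mem_nhds hy)
  have h2 : ContMDiffAt (𝓡 3) (𝓡 3) ∞ c (ι (e.symm y)) :=
    (contMDiffOn_of_mem_maximalAtlas hc).contMDiffAt (c.open_source.mem_nhds hyc)
  exact h2.comp y ((hι _).comp y h1)

theorem eventually_mem_chart (hι : ContMDiff (𝓡 2) (𝓡 3) ∞ ι) (hy : y ∈ e.target)
    (hyc : ι (e.symm y) ∈ c.source) :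
    ∀ᶠ z in 𝓝 y, z ∈ e.target ∧ ι (e.symm z) ∈ c.source := by
  have hcont : ContinuousAt (fun z => ι (e.symm z)) y :=
    hι.continuous.continuousAt.comp (e.continuousAt_symm hy)
  exact Filter.Eventually.and (e.open_target.mem_nhds hy)
    (hcont.eventually (c.open_source.mem_nhds hyc))

/-- The coordinate tangent vectors of the surface. -/
def surfaceVec (ι : A → S) (e : OpenPartialHomeomorph A (Coord 2)) (i : Fin 2) (y : Coord 2) :
    TangentSpace (𝓡 3) (ι (e.symm y)) :=
  mfderiv (𝓡 2) (𝓡 3) (ι ∘ e.symm) y (basisVec i : Coord 2)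

theorem surfaceVec_eq (hι : ContMDiff (𝓡 2) (𝓡 3) ∞ ι)
    (he : e ∈ IsManifold.maximalAtlas (𝓡 2) ∞ A) (hy : y ∈ e.target) (i : Fin 2) :
    surfaceVec ι e i y = mfderiv (𝓡 2) (𝓡 3) ι (e.symm y) (frame e i y) :=
  congrArg (fun L => L (basisVec i)) (mfderiv_comp y ((hι _).mdifferentiableAt (by simp))
    ((mdifferentiable_of_mem_maximalAtlas he).mdifferentiableAt_symm hy))

theorem comp_surfaceVec (hι : ContMDiff (𝓡 2) (𝓡 3) ∞ ι)
    (he : e ∈ IsManifold.maximalAtlas (𝓡 2) ∞ A) (hc : c ∈ IsManifold.maximalAtlas (𝓡 3) ∞ S)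
    (hy : y ∈ e.target) (hyc : ι (e.symm y) ∈ c.source) (i : Fin 2) :
    comp c (ι (e.symm y)) (surfaceVec ι e i y) = fderiv ℝ (surfaceMap ι e c) y (basisVec i) := by
  have h1 : MDifferentiableAt (𝓡 2) (𝓡 2) e.symm y :=
    (mdifferentiable_of_mem_maximalAtlas he).mdifferentiableAt_symm hy
  have h2 : MDifferentiableAt (𝓡 3) (𝓡 3) c (ι (e.symm y)) :=
    (mdifferentiable_of_mem_maximalAtlas hc).mdifferentiableAt hyc
  have h3 : MDifferentiableAt (𝓡 2) (𝓡 3) ι (e.symm y) := (hι _).mdifferentiableAt (by simp)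
  have h4 := mfderiv_comp y h2 (h3.comp y h1)
  rw [← mfderiv_eq_fderiv]
  exact (congrArg (fun L => L (basisVec i)) h4).symm

/-- The pull-back to the surface of the one-form `K(·, X)`. -/
def pulledCurv (φ : SpatialHypersurface g S) (ι : A → S) (X : VecField 3 S) (p : A)
    (u : TangentSpace (𝓡 2) p) : ℝ :=
  φ.extrinsicCurv (ι p) (mfderiv (𝓡 2) (𝓡 3) ι p u) (X (ι p))

theorem isLinearMap_pulledCurv (X : VecField 3 S) (p : A) :
    IsLinearMap ℝ fun u => pulledCurv φ ι X p u := by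
  have h := φ.isLinearMap_extrinsicCurv_left (ι p) (X (ι p))
  constructor
  · intro u v
    simp only [pulledCurv, map_add, h.map_add]
  · intro a u
    simp only [pulledCurv, map_smul, h.map_smul]

theorem formComp_pulledCurv (hι : ContMDiff (𝓡 2) (𝓡 3) ∞ ι)
    (he : e ∈ IsManifold.maximalAtlas (𝓡 2) ∞ A) (hc : c ∈ IsManifold.maximalAtlas (𝓡 3) ∞ S)
    (hy : y ∈ e.target) (hyc : ι (e.symm y) ∈ c.source) (X : VecField 3 S) (i : Fin 2) :
    formComp (pulledCurv φ ι X) e i =ᶠ[𝓝 y] fun z => ∑ l,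
      fderiv ℝ (surfaceMap ι e c) z (basisVec i) l * φ.curvCovector c X l (surfaceMap ι e c z) := by
  filter_upwards [eventually_mem_chart hι hy hyc] with z hz
  rw [← comp_surfaceVec hι he hc hz.1 hz.2, surfaceVec_eq hι he hz.1]
  exact extrinsicCurv_eq_sum hc hz.2 _

variable {T R : VecField 3 S} {k : Fin 3}

theorem contDiffAt_formComp_pulledCurv (hι : ContMDiff (𝓡 2) (𝓡 3) ∞ ι)
    (he : e ∈ IsManifold.maximalAtlas (𝓡 2) ∞ A) (hTR : φ.AreGenerators k T R)
    (hy : y ∈ e.target) (i : Fin 2) :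
    ContDiffAt ℝ ∞ (formComp (pulledCurv φ ι R) e i) y := by
  obtain ⟨c, hyc, hc, hcTR⟩ := hTR (ι (e.symm y))
  have hH := contDiffAt_surfaceMap hι he hc.1 hy hyc
  refine ContDiffAt.congr_of_eventuallyEq ?_ (formComp_pulledCurv hι he hc.1 hy hyc R i)
  refine ContDiffAt.sum fun l _ => ContDiffAt.mul ?_ ?_
  · exact (EuclideanSpace.proj l : Coord 3 →L[ℝ] ℝ).contDiff.contDiffAt.comp y
      ((hH.fderiv_right (m := ∞) (by simp)).clm_apply contDiffAt_const)
  · have hθ : ContDiffAt ℝ ∞ (φ.curvCovector c R l) (surfaceMap ι e c y) :=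
      SpatialHypersurface.contDiffAt_curvCovector hc.1 (c.map_source hyc)
        (fun z hz => (hcTR z hz).2) l
    exact hθ.comp y hH

/-- The integrand of the flux through the surface. -/
def fluxDensity (φ : SpatialHypersurface g S) (ι : A → S) (V : VecField 3 S)
    (e : OpenPartialHomeomorph A (Coord 2)) (y : Coord 2) : ℝ :=
  φ.volForm (ι (e.symm y)) (V (ι (e.symm y))) (surfaceVec ι e 0 y) (surfaceVec ι e 1 y)

/-- Pointwise form of the theorem before integration. The Cartesian chart serves only near one
point; the correction term is expressed by the globally defined `pulledCurv`, so charts at different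
points need not be compared. -/
theorem fluxDensity_magneticPart {Λ : ℝ} (hvac : g.IsVacuum Λ)
    (hι : ContMDiff (𝓡 2) (𝓡 3) ∞ ι) (he : e ∈ IsManifold.maximalAtlas (𝓡 2) ∞ A)
    (hTR : φ.AreGenerators k T R) (hy : y ∈ e.target) :
    fluxDensity φ ι (raiseContract φ.inducedMetric φ.magneticPart R) e y
      = fluxDensity φ ι (raiseContract φ.inducedMetric φ.admMomentum T) e y
        - (pd 0 (formComp (pulledCurv φ ι R) e 1) y - pd 1 (formComp (pulledCurv φ ι R) e 0) y) := by
  obtain ⟨c, hyc, hc, hcTR⟩ := hTR (ι (e.symm y))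
  have hH := contDiffAt_surfaceMap hι he hc.1 hy hyc
  have hpd : ∀ i j, pd i (formComp (pulledCurv φ ι R) e j) y = pd i (fun z => ∑ l,
      fderiv ℝ (surfaceMap ι e c) z (basisVec j) l
        * φ.curvCovector c R l (surfaceMap ι e c z)) y := fun i j => by
    unfold pd
    rw [(formComp_pulledCurv hι he hc.1 hy hyc R j).fderiv_eq]
  rw [hpd, hpd, curl_pullback (hH.of_le ENat.LEInfty.out) fun l =>
    (SpatialHypersurface.contDiffAt_curvCovector hc.1 (c.map_source hyc)
      (fun z hz => (hcTR z hz).2) l).differentiableAt (by simp),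
    ← comp_surfaceVec hι he hc.1 hy hyc, ← comp_surfaceVec hι he hc.1 hy hyc]
  unfold fluxDensity surfaceMap
  -- The base point can be rewritten as `c.symm x` only once the vectors in the tangent space over
  -- it are free variables.
  generalize surfaceVec ι e 0 y = v
  generalize surfaceVec ι e 1 y = w
  generalize ι (e.symm y) = q at hyc v w
  obtain ⟨x, hx, rfl⟩ : ∃ x ∈ c.target, c.symm x = q := ⟨c q, c.map_source hyc, c.left_inv hyc⟩
  rw [c.right_inv hx]
  exact SpatialHypersurface.volForm_magneticPart hc hvac hx (hcTR x hx).1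
    (fun z hz => (hcTR z hz).2) v w

/-- Supplies the integrability needed to split the integral of a difference; the magnetic density is
then expressed through this one and a curl. -/
theorem continuousAt_fluxDensity_admMomentum (hι : ContMDiff (𝓡 2) (𝓡 3) ∞ ι)
    (he : e ∈ IsManifold.maximalAtlas (𝓡 2) ∞ A) (hTR : φ.AreGenerators k T R)
    (hy : y ∈ e.target) :
    ContinuousAt (fluxDensity φ ι (raiseContract φ.inducedMetric φ.admMomentum T) e) y := by
  obtain ⟨c, hyc, hc, hcTR⟩ := hTR (ι (e.symm y))
  have hH := contDiffAt_surfaceMap hι he hc.1 hy hyc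
  have hq : ∀ q ∈ c.source, ∀ v w : TangentSpace (𝓡 3) q,
      φ.volForm q (raiseContract φ.inducedMetric φ.admMomentum T q) v w
      = (Matrix.of ![fun i => -φ.curvComp c i k (c q)
          + (∑ m, φ.curvComp c m m (c q)) * if i = k then 1 else 0,
        ⇑(comp c q v), ⇑(comp c q w)]).det := by
    intro q hq v w
    obtain ⟨x, hx, rfl⟩ : ∃ x ∈ c.target, c.symm x = q := ⟨c q, c.map_source hq, c.left_inv hq⟩
    rw [c.right_inv hx]
    exact SpatialHypersurface.volForm_admMomentum hc hx (hcTR x hx).1 v w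
  have hev : fluxDensity φ ι (raiseContract φ.inducedMetric φ.admMomentum T) e =ᶠ[𝓝 y] fun z =>
      (Matrix.of ![fun i => -φ.curvComp c i k (surfaceMap ι e c z)
          + (∑ m, φ.curvComp c m m (surfaceMap ι e c z)) * if i = k then 1 else 0,
        ⇑(fderiv ℝ (surfaceMap ι e c) z (basisVec 0)),
        ⇑(fderiv ℝ (surfaceMap ι e c) z (basisVec 1))]).det := by
    filter_upwards [eventually_mem_chart hι hy hyc] with z hz
    rw [← comp_surfaceVec hι he hc.1 hz.1 hz.2, ← comp_surfaceVec hι he hc.1 hz.1 hz.2]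
    exact hq _ hz.2 _ _
  refine ContinuousAt.congr_of_eventuallyEq ?_ hev
  refine ContDiffAt.continuousAt (𝕜 := ℝ) (n := ∞) (contDiffAt_det fun a b => ?_)
  have hK : ∀ i j, ContDiffAt ℝ ∞ (fun z => φ.curvComp c i j (surfaceMap ι e c z)) y := by
    intro i j
    have h0 : ContDiffAt ℝ ∞ (φ.curvComp c i j) (surfaceMap ι e c y) :=
      SpatialHypersurface.contDiffAt_curvComp hc.1 (c.map_source hyc) i j
    exact h0.comp y hH
  have hD : ∀ (i : Fin 2) (l : Fin 3),
      ContDiffAt ℝ ∞ (fun z => fderiv ℝ (surfaceMap ι e c) z (basisVec i) l) y := fun i l =>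
    (EuclideanSpace.proj l : Coord 3 →L[ℝ] ℝ).contDiff.contDiffAt.comp y
      ((hH.fderiv_right (m := ∞) (by simp)).clm_apply contDiffAt_const)
  fin_cases a
  · exact (hK b k).neg.add ((ContDiffAt.sum fun m _ => hK m m).mul contDiffAt_const)
  · exact hD 0 b
  · exact hD 1 b

open MeasureTheory in
theorem flux_magneticPart_eq {Λ : ℝ} (hvac : g.IsVacuum Λ) (hTR : φ.AreGenerators k T R)
    [CompactSpace A] [T2Space A] (hA : IsOrientedAtlas 2 A) (hι : ContMDiff (𝓡 2) (𝓡 3) ∞ ι) :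
    flux φ ι (raiseContract φ.inducedMetric φ.magneticPart R) =
      flux φ ι (raiseContract φ.inducedMetric φ.admMomentum T) := by
  have hmax : ∀ a : A, chartAt (Coord 2) a ∈ IsManifold.maximalAtlas (𝓡 2) ∞ A := fun a =>
    IsManifold.chart_mem_maximalAtlas _
  have hη : ∀ (a : A) i, ∀ y ∈ (chartAt (Coord 2) a).target,
      ContDiffAt ℝ 1 (formComp (pulledCurv φ ι R) (chartAt (Coord 2) a) i) y := fun a i y hy =>
    (contDiffAt_formComp_pulledCurv hι (hmax a) hTR hy i).of_le ENat.LEInfty.out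
  have hstokes := finsum_setIntegral_curl_eq_zero hA
    (η := pulledCurv φ ι R) (isLinearMap_pulledCurv R) hη
  have hint : ∀ (a : A) (f : Coord 2 → ℝ), (∀ y ∈ (chartAt (Coord 2) a).target, ContinuousAt f y) →
      IntegrableOn (fun y => unityPartition A a ((chartAt (Coord 2) a).symm y) * f y)
        (chartAt (Coord 2) a).target := by
    intro a f hf
    refine integrableOn_of_zero_off_compact (chartAt (Coord 2) a).open_target
      (isCompact_image_tsupport A a) (image_tsupport_subset A a) ?_ fun y hy hyK => ?_
    · exact fun y hy => ((contDiffAt_comp_symm (hmax a) hy a).continuousAt.mul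
        (hf y hy)).continuousWithinAt
    · rw [image_eq_zero_of_notMem_tsupport (f := unityPartition A a)
        (unityPartition_eq_zero hy hyK), zero_mul]
  have hpdc : ∀ (a : A) (i j : Fin 2), ∀ y ∈ (chartAt (Coord 2) a).target,
      ContinuousAt (pd i (formComp (pulledCurv φ ι R) (chartAt (Coord 2) a) j)) y := by
    intro a i j y hy
    have := (hη a j y hy).fderiv_right (m := 0) (by norm_num)
    exact (this.clm_apply contDiffAt_const).continuousAt
  have hsplit : ∀ a : A, ∫ y in (chartAt (Coord 2) a).target,
      unityPartition A a ((chartAt (Coord 2) a).symm y) *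
        fluxDensity φ ι (raiseContract φ.inducedMetric φ.magneticPart R) (chartAt (Coord 2) a) y
      = (∫ y in (chartAt (Coord 2) a).target,
        unityPartition A a ((chartAt (Coord 2) a).symm y) *
        fluxDensity φ ι (raiseContract φ.inducedMetric φ.admMomentum T) (chartAt (Coord 2) a) y)
      - ∫ y in (chartAt (Coord 2) a).target,
        unityPartition A a ((chartAt (Coord 2) a).symm y) *
        (pd 0 (formComp (pulledCurv φ ι R) (chartAt (Coord 2) a) 1) y
          - pd 1 (formComp (pulledCurv φ ι R) (chartAt (Coord 2) a) 0) y) := by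
    intro a
    rw [← integral_sub (hint a _ fun y hy =>
        continuousAt_fluxDensity_admMomentum hι (hmax a) hTR hy)
      (hint a (fun y => pd 0 (formComp (pulledCurv φ ι R) (chartAt (Coord 2) a) 1) y
        - pd 1 (formComp (pulledCurv φ ι R) (chartAt (Coord 2) a) 0) y)
        fun y hy => (hpdc a 0 1 y hy).sub (hpdc a 1 0 y hy))]
    refine setIntegral_congr_fun (chartAt (Coord 2) a).open_target.measurableSet fun y hy => ?_
    simp only [fluxDensity_magneticPart hvac hι (hmax a) hTR hy, mul_sub]
  -- A `finsum` distributes over a difference only when both supports are finite; here compactness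
  -- leaves finitely many nonzero members of the partition of unity.
  have hfin : ∀ f : A → Coord 2 → ℝ, (Function.support fun a : A =>
      ∫ y in (chartAt (Coord 2) a).target,
        unityPartition A a ((chartAt (Coord 2) a).symm y) * f a y).Finite := by
    intro f
    refine (finite_support_unityPartition A).subset fun a ha => ?_
    by_contra h
    refine ha ?_
    have h0 : ∀ p, unityPartition A a p = 0 := fun p => by
      by_contra hp
      exact h ⟨p, hp⟩
    simp [h0]
  refine (finsum_congr hsplit).trans ?_
  rw [finsum_sub_distrib (hfin _) (hfin _), hstokes, sub_zero]
  rfl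

end Surface

end GravCharge
end

theorem theorem4p1
    -- an oriented spacetime satisfying the Einstein vacuum equations
    {M : Type*} [TopologicalSpace M] [ChartedSpace (GravCharge.Coord 4) M]
    [IsManifold (𝓡 4) ∞ M] (hM : GravCharge.IsOrientedAtlas 4 M)
    (g : GravCharge.LorentzMetric M) (Λ : ℝ) (hvac : g.IsVacuum Λ)
    -- a flat spatial hypersurface
    {S : Type*} [TopologicalSpace S] [ChartedSpace (GravCharge.Coord 3) S]
    [IsManifold (𝓡 3) ∞ S] (φ : GravCharge.SpatialHypersurface g S)
    (hflat : GravCharge.IsFlat φ.inducedMetric)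
    -- the magnetic part is divergence free
    (hdiv : ∀ (q : S) (j : Fin 3),
      GravCharge.divergence φ.inducedMetric φ.magneticPart q j = 0)
    -- the translation and rotation generators belonging to an axis
    (k : Fin 3) (T R : GravCharge.VecField 3 S) (hTR : φ.AreGenerators k T R)
    -- an immersed oriented closed surface
    {A : Type*} [TopologicalSpace A] [ChartedSpace (GravCharge.Coord 2) A]
    [IsManifold (𝓡 2) ∞ A] [CompactSpace A] [T2Space A]
    (hA : GravCharge.IsOrientedAtlas 2 A)
    (ι : A → S) (hι : ContMDiff (𝓡 2) (𝓡 3) ∞ ι)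
    (hι' : ∀ p : A, Function.Injective (mfderiv (𝓡 2) (𝓡 3) ι p)) :
    GravCharge.flux φ ι (GravCharge.raiseContract φ.inducedMetric φ.magneticPart R) =
      GravCharge.flux φ ι (GravCharge.raiseContract φ.inducedMetric φ.admMomentum T) :=
  GravCharge.flux_magneticPart_eq hvac hTR hA hι
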